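/- **Theorem.** Let $\mathcal G\rightrightarrows M$ be a Lie groupoid (smooth, finite-dimensional) with source $s$, target $t$, units $1_x$ and inversion $i$; arrows $g,h$ with $s(g)=t(h)$ compose to $gh$. A *$\mathcal{VB}$-groupoid* over it consists of vector bundles $\mathcal V\to\mathcal G$ and $E\to M$ and a Lie groupoid structure $\mathcal V\rightrightarrows E$ whose structure maps $\tilde s,\tilde t,\tilde 1,\tilde i,\tilde m$ are vector bundle morphisms over those of $\mathcal G\rightrightarrows M$. It is an *$\mathcal{LA}$-groupoid* if moreover $\mathcal V\to\mathcal G$ and $E\to M$ are Lie algebroids and all structure maps are Lie algebroid morphisms (for $\tilde m$: on the Lie algebroid $\mathcal V\times_E\mathcal V$ of composable pairs, a subalgebroid of $\mathcal V\times\mathcal V$). The *core* is the vector bundle $C=\ker(\tilde s)|_M=1^*\ker(\tilde s)$ over $M$. A section $c\in\Gamma(C)$ defines sections of $\mathcal V$ by $c^r(g)=c(t(g))\cdot 0_g$ and $c^l(g)=-0_g\cdot\tilde i(c(s(g)))$. A section $V\in\Gamma(\mathcal V)$ is *multiplicative* if it is a groupoid morphism $\mathcal G\to\mathcal V$ over some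 section $e\in\Gamma(E)$; $\Gamma_{mult}(\mathcal V)$ denotes the space of these. The category $\mathrm{Sec}(\mathcal G,\mathcal V)$ has the multiplicative sections as objects; its morphisms $V\Rightarrow V'$ are the smooth natural transformations $\tau:M\to\mathcal V$ from the functor $V$ to the functor $V'$ with $\tau(x)\in\mathcal V_{1_x}$, composed by $(\sigma\circ\tau)(x)=\sigma(x)\tau(x)$. Let $\mathcal V\rightrightarrows E$ be any $\mathcal{LA}$-groupoid over $\mathcal G\rightrightarrows M$. Then $\Gamma_{mult}(\mathcal V)$ is a Lie subalgebra of $\Gamma(\mathcal V)$, and $\Gamma(C)$ is a Lie algebra for the bracket determined by $[c,c']^r=[c^r,c'^r]$. Moreover: 1. The maps $\delta:\Gamma(C)\to\Gamma_{mult}(\mathcal V)$, $\delta(c)=c^r-c^l$, and $D:\Gamma_{mult}(\mathcal V)\to\mathrm{Der}(\Gamma(C))$, $D_V(c)=[V,c^r]\circ 1$, are well-defined Lie algebra homomorphisms and form a crossed module of Lie algebras: $D_{\delta(c)}c'=[c,c']$ and $\delta(D_V c)=[V,\delta(c)]$. 2. With the Lie bracket $$[(c,V),(c',V')]=\big([c,c']+D_V(c')-D_{V'}(c),\,[V,V']\big)$$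 on $\Gamma(C)\oplus\Gamma_{mult}(\mathcal V)$, the 2-vector space $\Gamma(C)\oplus\Gamma_{mult}(\mathcal V)\rightrightarrows\Gamma_{mult}(\mathcal V)$ with source $(c,V)\mapsto V$, target $(c,V)\mapsto V+c^r-c^l$, units $V\mapsto(0,V)$ and composition $(c_1,V_1)\circ(c_0,V_0)=(c_1+c_0,V_0)$ (for $V_1=V_0+c_0^r-c_0^l$) is a strict Lie 2-algebra, i.e. a category internal to Lie algebras. 3. The underlying category of this Lie 2-algebra is isomorphic to $\mathrm{Sec}(\mathcal G,\mathcal V)$, by the functor which is the identity on objects and sends $(c,V)$ to the natural transformation $x\mapsto c(x)+V(1_x)$. In particular, the tangent groupoid $T\mathcal G\rightrightarrows TM$, whose structure maps are the derivatives of those of $\mathcal G\rightrightarrows M$ and whose Lie algebroid structures are given by the Lie bracket of vector fields, is an $\mathcal{LA}$-groupoid over $\mathcal G\rightrightarrows M$, and hence the category of multiplicative vector fields on $\mathcal G$ is a strict Lie 2-algebra in this way (Hepworth's conjecture). -/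

import Mathlib

open Bundle
open scoped Manifold ContDiff CategoryTheory

noncomputable section

theorem two_le_infty : (2 : ℕ∞ω) ≤ ∞ := ENat.LEInfty.out

theorem three_le_infty : (3 : ℕ∞ω) ≤ ∞ := ENat.LEInfty.out

section TotalSpace

variable {G F : Type*} {V : G → Type*}

theorem totalSpace_mk_rec (p : TotalSpace F V) {g : G} (h : p.1 = g) :
    (⟨g, h ▸ p.2⟩ : TotalSpace F V) = p := by
  subst h
  rfl

theorem totalSpace_add_eq [∀ x, AddCommGroup (V x)] {g k : G} {a b : V g} {a' b' : V k}
    (h₁ : (⟨g, a⟩ : TotalSpace F V) = ⟨k, a'⟩) (h₂ : (⟨g, b⟩ : TotalSpace F V) = ⟨k, b'⟩) :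
    (⟨g, a + b⟩ : TotalSpace F V) = ⟨k, a' + b'⟩ := by
  obtain rfl : g = k := congrArg TotalSpace.proj h₁
  rw [TotalSpace.mk_inj] at *
  rw [h₁, h₂]

theorem totalSpace_smul_eq [∀ x, AddCommGroup (V x)] [∀ x, Module ℝ (V x)] {g k : G} {a : V g}
    {a' : V k} (r : ℝ) (h : (⟨g, a⟩ : TotalSpace F V) = ⟨k, a'⟩) :
    (⟨g, r • a⟩ : TotalSpace F V) = ⟨k, r • a'⟩ := by
  obtain rfl : g = k := congrArg TotalSpace.proj h
  rw [TotalSpace.mk_inj] at *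
  rw [h]

end TotalSpace

section Algebroid

variable {EM HM M : Type*} [NormedAddCommGroup EM] [NormedSpace ℝ EM] [TopologicalSpace HM]
  [TopologicalSpace M] [ChartedSpace HM M]

/-- A (real, smooth) Lie algebroid structure on a smooth vector bundle `A → M` with typical fibre
`F`: an anchor `ρ : A → TM`, which is a smooth bundle map over the identity of `M`, and a Lie
bracket on the space of smooth sections which satisfies the Leibniz rule
`[X, f Y] = f [X, Y] + (ρ(X) f) Y`. -/
class LieAlgebroid (I : ModelWithCorners ℝ EM HM) [IsManifold I ∞ M]
    (F : Type*) [NormedAddCommGroup F] [NormedSpace ℝ F]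
    (A : M → Type*) [TopologicalSpace (TotalSpace F A)] [∀ x, TopologicalSpace (A x)]
    [∀ x, AddCommGroup (A x)] [∀ x, Module ℝ (A x)] [FiberBundle F A] [VectorBundle ℝ F A]
    [ContMDiffVectorBundle ∞ F A I] where
  /-- the anchor -/
  anchor : ∀ x, A x →L[ℝ] TangentSpace I x
  contMDiff_anchor : ContMDiff (I.prod 𝓘(ℝ, F)) I.tangent ∞
    (fun v : TotalSpace F A => (⟨v.1, anchor v.1 v.2⟩ : TangentBundle I M))
  /-- the bracket of smooth sections -/
  bracket : Cₛ^∞⟮I; F, A⟯ → Cₛ^∞⟮I; F, A⟯ → Cₛ^∞⟮I; F, A⟯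
  bracket_add : ∀ X Y Z, bracket X (Y + Z) = bracket X Y + bracket X Z
  bracket_smul : ∀ (r : ℝ) X Y, bracket X (r • Y) = r • bracket X Y
  add_bracket : ∀ X Y Z, bracket (X + Y) Z = bracket X Z + bracket Y Z
  bracket_self : ∀ X, bracket X X = 0
  jacobi : ∀ X Y Z, bracket X (bracket Y Z) = bracket (bracket X Y) Z + bracket Y (bracket X Z)
  leibniz : ∀ (X Y : Cₛ^∞⟮I; F, A⟯) (f : C^∞⟮I, M; ℝ⟯) (x : M),
    bracket X ⟨(f : M → ℝ) • (Y : ∀ x, A x), f.contMDiff.smul_section Y.contMDiff⟩ x =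
      f x • bracket X Y x + mvfderiv I f x (anchor x (X x)) • Y x

variable (I : ModelWithCorners ℝ EM HM) [IsManifold I ∞ M]
    (F : Type*) [NormedAddCommGroup F] [NormedSpace ℝ F]
    (A : M → Type*) [TopologicalSpace (TotalSpace F A)] [∀ x, TopologicalSpace (A x)]
    [∀ x, AddCommGroup (A x)] [∀ x, Module ℝ (A x)] [FiberBundle F A] [VectorBundle ℝ F A]
    [ContMDiffVectorBundle ∞ F A I] [LieAlgebroid I F A]

variable {A} in
/-- The anchor `ρ : A → TM`, with the bundle data as explicit arguments. -/
abbrev LieAlgebroid.rho (x : M) : A x →L[ℝ] TangentSpace I x :=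
  LieAlgebroid.anchor (F := F) x

/-- The Lie algebra of sections of a Lie algebroid. -/
instance LieAlgebroid.instLieRing : LieRing Cₛ^∞⟮I; F, A⟯ where
  bracket := LieAlgebroid.bracket
  add_lie := LieAlgebroid.add_bracket
  lie_add := LieAlgebroid.bracket_add
  lie_self := LieAlgebroid.bracket_self
  leibniz_lie := LieAlgebroid.jacobi

instance LieAlgebroid.instLieAlgebra : LieAlgebra ℝ Cₛ^∞⟮I; F, A⟯ where
  lie_smul := LieAlgebroid.bracket_smul

theorem contMDiff_mlieBracket [CompleteSpace EM]
    (X Y : Cₛ^∞⟮I; EM, (TangentSpace I : M → Type _)⟯) :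
    ContMDiff I I.tangent ∞
      (fun x => (⟨x, VectorField.mlieBracket I X Y x⟩ : TangentBundle I M)) := by
  have : IsManifold I (((⊤ : ℕ∞) : ℕ∞ω) + 1) M := ‹IsManifold I ∞ M›
  have : IsManifold I (minSmoothness ℝ 2) M := .of_le (n := ∞) (by simpa using two_le_infty)
  exact ContDiff.mlieBracket_vectorField (m := ⊤) (n := ⊤) X.contMDiff Y.contMDiff (by simp)

/-- The tangent Lie algebroid of a manifold: the anchor is the identity and the bracket is the Lie
bracket of vector fields. -/
instance tangentLieAlgebroid [FiniteDimensional ℝ EM] :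
    LieAlgebroid I EM (TangentSpace I : M → Type _) where
  anchor x := ContinuousLinearMap.id ℝ (TangentSpace I x)
  contMDiff_anchor := contMDiff_id
  bracket X Y := ⟨VectorField.mlieBracket I X Y, have := FiniteDimensional.complete ℝ EM; contMDiff_mlieBracket I X Y⟩
  bracket_add X Y Z := by
    ext x
    have := FiniteDimensional.complete ℝ EM
    have : IsManifold I (minSmoothness ℝ 2) M := .of_le (n := ∞) (by simpa using two_le_infty)
    exact VectorField.mlieBracket_add_right (Y.contMDiff.mdifferentiable (by simp) x)
      (Z.contMDiff.mdifferentiable (by simp) x)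
  bracket_smul r X Y := by
    ext x
    have := FiniteDimensional.complete ℝ EM
    have : IsManifold I (minSmoothness ℝ 2) M := .of_le (n := ∞) (by simpa using two_le_infty)
    exact VectorField.mlieBracket_const_smul_right (Y.contMDiff.mdifferentiable (by simp) x)
  add_bracket X Y Z := by
    ext x
    have := FiniteDimensional.complete ℝ EM
    have : IsManifold I (minSmoothness ℝ 2) M := .of_le (n := ∞) (by simpa using two_le_infty)
    exact VectorField.mlieBracket_add_left (X.contMDiff.mdifferentiable (by simp) x)
      (Y.contMDiff.mdifferentiable (by simp) x)
  bracket_self X := by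
    ext x
    exact congrFun VectorField.mlieBracket_self x
  jacobi X Y Z := by
    ext x
    have := FiniteDimensional.complete ℝ EM
    have : IsManifold I (minSmoothness ℝ 3) M := .of_le (n := ∞) (by simpa using three_le_infty)
    exact VectorField.leibniz_identity_mlieBracket_apply
      (X.contMDiff.of_le (by simpa using two_le_infty) x)
      (Y.contMDiff.of_le (by simpa using two_le_infty) x)
      (Z.contMDiff.of_le (by simpa using two_le_infty) x)
  leibniz X Y f x :=
    have := FiniteDimensional.complete ℝ EM
    (VectorField.mlieBracket_smul_right (f.contMDiff.mdifferentiable (by simp) x)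
      (Y.contMDiff.mdifferentiable (by simp) x)).trans (add_comm _ _)

end Algebroid

section Morphism

variable {EP HP P : Type*} [NormedAddCommGroup EP] [NormedSpace ℝ EP] [TopologicalSpace HP]
  [TopologicalSpace P] [ChartedSpace HP P]
  {EM HM M : Type*} [NormedAddCommGroup EM] [NormedSpace ℝ EM] [TopologicalSpace HM]
  [TopologicalSpace M] [ChartedSpace HM M]

/-- A finite formal sum `∑ᵢ fᵢ ⊗ Zᵢ` of smooth functions `fᵢ` on a manifold `P` and smooth sections
`Zᵢ` of a vector bundle `A → M`. Along a map `φ : P → M` it represents the section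
`p ↦ ∑ᵢ fᵢ(p) Zᵢ(φ(p))` of the pullback bundle `φ^* A`. -/
structure FormalSection (IP : ModelWithCorners ℝ EP HP) (P : Type*) [TopologicalSpace P]
    [ChartedSpace HP P] (I : ModelWithCorners ℝ EM HM)
    (F : Type*) [NormedAddCommGroup F] [NormedSpace ℝ F]
    (A : M → Type*) [TopologicalSpace (TotalSpace F A)] [∀ x, TopologicalSpace (A x)]
    [FiberBundle F A] where
  /-- the number of terms -/
  size : ℕ
  /-- the functions `fᵢ` -/
  coeff : Fin size → C^∞⟮IP, P; ℝ⟯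
  /-- the sections `Zᵢ` -/
  sec : Fin size → Cₛ^∞⟮I; F, A⟯

variable {IP : ModelWithCorners ℝ EP HP} {I : ModelWithCorners ℝ EM HM}
  {F : Type*} [NormedAddCommGroup F] [NormedSpace ℝ F]
  {A : M → Type*} [TopologicalSpace (TotalSpace F A)] [∀ x, TopologicalSpace (A x)]
  [∀ x, AddCommGroup (A x)] [∀ x, Module ℝ (A x)] [FiberBundle F A] [VectorBundle ℝ F A]

namespace FormalSection

/-- `∑ᵢ fᵢ(p) Zᵢ(x)` -/
def eval (σ : FormalSection IP P I F A) (p : P) (x : M) : A x :=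
  ∑ i, σ.coeff i p • σ.sec i x

/-- The formal sum `1 ⊗ Z`. -/
def single (Z : Cₛ^∞⟮I; F, A⟯) : FormalSection IP P I F A where
  size := 1
  coeff _ := ContMDiffMap.const 1
  sec _ := Z

@[simp] theorem eval_single (Z : Cₛ^∞⟮I; F, A⟯) (p : P) (x : M) :
    (single Z : FormalSection IP P I F A).eval p x = Z x :=
  (Fin.sum_univ_one _).trans (one_smul ℝ _)

variable [IsManifold I ∞ M] [ContMDiffVectorBundle ∞ F A I] [LieAlgebroid I F A]

/-- For formal sums `σ = ∑ᵢ fᵢ ⊗ Zᵢ` and `σ' = ∑ⱼ f'ⱼ ⊗ Z'ⱼ` and tangent vectors `ξ`, `ξ'` of `P` at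
`p`, this is `∑ᵢⱼ fᵢ(p) f'ⱼ(p) [Zᵢ, Z'ⱼ](x) + ∑ⱼ ξ(f'ⱼ) Z'ⱼ(x) - ∑ᵢ ξ'(fᵢ) Zᵢ(x)`. -/
def bracketAt (σ σ' : FormalSection IP P I F A) (p : P) (ξ ξ' : TangentSpace IP p) (x : M) : A x :=
  (∑ i, ∑ j, (σ.coeff i p * σ'.coeff j p) • (⁅σ.sec i, σ'.sec j⁆ : Cₛ^∞⟮I; F, A⟯) x)
    + ∑ j, mvfderiv IP (σ'.coeff j) p ξ • σ'.sec j x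
    - ∑ i, mvfderiv IP (σ.coeff i) p ξ' • σ.sec i x

@[simp] theorem bracketAt_single (Z Z' : Cₛ^∞⟮I; F, A⟯) (p : P) (ξ ξ' : TangentSpace IP p) (x : M) :
    (single Z : FormalSection IP P I F A).bracketAt (single Z') p ξ ξ' x
      = (⁅Z, Z'⁆ : Cₛ^∞⟮I; F, A⟯) x := by
  have h : mvfderiv IP ((ContMDiffMap.const 1 : C^∞⟮IP, P; ℝ⟯) : P → ℝ) p = 0 :=
    mvfderiv_const 1
  have h1 : ((ContMDiffMap.const 1 : C^∞⟮IP, P; ℝ⟯) : P → ℝ) p = 1 := rfl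
  change (∑ i : Fin 1, ∑ j : Fin 1,
    ((ContMDiffMap.const 1 : C^∞⟮IP, P; ℝ⟯) p * (ContMDiffMap.const 1 : C^∞⟮IP, P; ℝ⟯) p) •
      (⁅Z, Z'⁆ : Cₛ^∞⟮I; F, A⟯) x)
    + (∑ j : Fin 1, mvfderiv IP (ContMDiffMap.const 1 : C^∞⟮IP, P; ℝ⟯) p ξ • Z' x)
    - (∑ i : Fin 1, mvfderiv IP (ContMDiffMap.const 1 : C^∞⟮IP, P; ℝ⟯) p ξ' • Z x) = _
  simp [h, h1]

end FormalSection

/-- A vector bundle morphism `Φ : B → A` over `φ : N → M` is a morphism of Lie algebroids if it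
intertwines the anchors and the brackets, where, since `Φ` does not act on sections, the latter
means: if `Φ ∘ X = ∑ᵢ fᵢ (Zᵢ ∘ φ)` and `Φ ∘ X' = ∑ⱼ f'ⱼ (Z'ⱼ ∘ φ)`, then `Φ ∘ [X, X']` equals
`∑ᵢⱼ fᵢ f'ⱼ ([Zᵢ, Z'ⱼ] ∘ φ) + ∑ⱼ (ρ(X) f'ⱼ) (Z'ⱼ ∘ φ) - ∑ᵢ (ρ(X') fᵢ) (Zᵢ ∘ φ)`. -/
structure IsLieAlgebroidMorphism (IP : ModelWithCorners ℝ EP HP) [IsManifold IP ∞ P]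
    (I : ModelWithCorners ℝ EM HM) [IsManifold I ∞ M]
    (FB : Type*) [NormedAddCommGroup FB] [NormedSpace ℝ FB]
    (F : Type*) [NormedAddCommGroup F] [NormedSpace ℝ F]
    {B : P → Type*} [TopologicalSpace (TotalSpace FB B)] [∀ x, TopologicalSpace (B x)]
    [∀ x, AddCommGroup (B x)] [∀ x, Module ℝ (B x)] [FiberBundle FB B] [VectorBundle ℝ FB B]
    [ContMDiffVectorBundle ∞ FB B IP] [LieAlgebroid IP FB B]
    {A : M → Type*} [TopologicalSpace (TotalSpace F A)] [∀ x, TopologicalSpace (A x)]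
    [∀ x, AddCommGroup (A x)] [∀ x, Module ℝ (A x)] [FiberBundle F A] [VectorBundle ℝ F A]
    [ContMDiffVectorBundle ∞ F A I] [LieAlgebroid I F A]
    (φ : P → M) (Φ : ∀ p, B p →L[ℝ] A (φ p)) : Prop where
  anchor_comp : ∀ (p : P) (v : B p),
    LieAlgebroid.rho I F (φ p) (Φ p v) =
      mfderiv IP I φ p (LieAlgebroid.rho IP FB p v)
  map_bracket : ∀ (X X' : Cₛ^∞⟮IP; FB, B⟯) (σ σ' : FormalSection IP P I F A),
    (∀ p, Φ p (X p) = σ.eval p (φ p)) → (∀ p, Φ p (X' p) = σ'.eval p (φ p)) →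
    ∀ p, Φ p ((⁅X, X'⁆ : Cₛ^∞⟮IP; FB, B⟯) p) =
      σ.bracketAt σ' p (LieAlgebroid.rho IP FB p (X p)) (LieAlgebroid.rho IP FB p (X' p))
        (φ p)

end Morphism

section Groupoid

variable {EG HG EM HM : Type*} [NormedAddCommGroup EG] [NormedSpace ℝ EG] [TopologicalSpace HG]
  [NormedAddCommGroup EM] [NormedSpace ℝ EM] [TopologicalSpace HM]

/-- A Lie groupoid `G ⇉ M`. Arrows are composed as in `g h` with `s(g) = t(h)`; the function `mul`
is total, but nothing is assumed about its values on pairs which are not composable. The set of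
composable pairs is an embedded submanifold of `G × G` because `s` and `t` are submersions, so that
smoothness of the multiplication is smoothness on this subset of `G × G`. -/
structure LieGroupoid (I : ModelWithCorners ℝ EG HG) (J : ModelWithCorners ℝ EM HM)
    (G M : Type*) [TopologicalSpace G] [ChartedSpace HG G] [TopologicalSpace M]
    [ChartedSpace HM M] where
  /-- source `s` -/
  src : G → M
  /-- target `t` -/
  tgt : G → M
  /-- unit `x ↦ 1ₓ` -/
  one : M → G
  /-- inversion `i` -/
  inv : G → G
  /-- multiplication `m` -/
  mul : G → G → G
  src_one : ∀ x, src (one x) = x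
  tgt_one : ∀ x, tgt (one x) = x
  src_mul : ∀ g h, src g = tgt h → src (mul g h) = src h
  tgt_mul : ∀ g h, src g = tgt h → tgt (mul g h) = tgt g
  mul_assoc : ∀ g h k, src g = tgt h → src h = tgt k → mul (mul g h) k = mul g (mul h k)
  one_mul : ∀ g, mul (one (tgt g)) g = g
  mul_one : ∀ g, mul g (one (src g)) = g
  src_inv : ∀ g, src (inv g) = tgt g
  tgt_inv : ∀ g, tgt (inv g) = src g
  mul_inv : ∀ g, mul g (inv g) = one (tgt g)
  inv_mul : ∀ g, mul (inv g) g = one (src g)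
  isSubmersion_src : Manifold.IsSubmersion I J ∞ src
  isSubmersion_tgt : Manifold.IsSubmersion I J ∞ tgt
  contMDiff_one : ContMDiff J I ∞ one
  contMDiff_inv : ContMDiff I I ∞ inv
  contMDiffOn_mul : ContMDiffOn (I.prod I) I ∞ (fun p : G × G => mul p.1 p.2)
    {p | src p.1 = tgt p.2}

variable {I : ModelWithCorners ℝ EG HG} {J : ModelWithCorners ℝ EM HM}
  {G M : Type*} [TopologicalSpace G] [ChartedSpace HG G] [TopologicalSpace M] [ChartedSpace HM M]

/-- The derivative `Tm` of the multiplication at a pair `(g, h)`. Only its values on vectors tangent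
to the submanifold of composable pairs, i.e. on `(a, b)` with `Ts(a) = Tt(b)`, are meaningful. -/
def LieGroupoid.tangentMul (𝒢 : LieGroupoid I J G M) (g h : G) :
    TangentSpace I g × TangentSpace I h →L[ℝ] TangentSpace I (𝒢.mul g h) :=
  mfderivWithin (I.prod I) I (fun p : G × G => 𝒢.mul p.1 p.2) {p | 𝒢.src p.1 = 𝒢.tgt p.2} (g, h)

/-- A `VB`-groupoid `V ⇉ E` over the Lie groupoid `G ⇉ M`: vector bundles `V → G` and `E → M`
together with a Lie groupoid structure on their total spaces, all of whose structure maps are vector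
bundle morphisms over the structure maps of `G ⇉ M`. The fibrewise linear map `mulV g h` is relevant
only on pairs of composable vectors (any linear map on the space of these extends to
`V g × V h`). -/
structure VBGroupoid (𝒢 : LieGroupoid I J G M)
    (F : Type*) [NormedAddCommGroup F] [NormedSpace ℝ F]
    (V : G → Type*) [TopologicalSpace (TotalSpace F V)] [∀ x, TopologicalSpace (V x)]
    [∀ x, AddCommGroup (V x)] [∀ x, Module ℝ (V x)] [FiberBundle F V] [VectorBundle ℝ F V]
    (F' : Type*) [NormedAddCommGroup F'] [NormedSpace ℝ F']
    (E : M → Type*) [TopologicalSpace (TotalSpace F' E)] [∀ x, TopologicalSpace (E x)]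
    [∀ x, AddCommGroup (E x)] [∀ x, Module ℝ (E x)] [FiberBundle F' E] [VectorBundle ℝ F' E] where
  /-- the Lie groupoid `V ⇉ E` -/
  total : LieGroupoid (I.prod 𝓘(ℝ, F)) (J.prod 𝓘(ℝ, F')) (TotalSpace F V) (TotalSpace F' E)
  srcV : ∀ g, V g →L[ℝ] E (𝒢.src g)
  tgtV : ∀ g, V g →L[ℝ] E (𝒢.tgt g)
  oneV : ∀ x, E x →L[ℝ] V (𝒢.one x)
  invV : ∀ g, V g →L[ℝ] V (𝒢.inv g)
  mulV : ∀ g h, V g × V h →L[ℝ] V (𝒢.mul g h)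
  total_src : ∀ g (v : V g), total.src ⟨g, v⟩ = ⟨𝒢.src g, srcV g v⟩
  total_tgt : ∀ g (v : V g), total.tgt ⟨g, v⟩ = ⟨𝒢.tgt g, tgtV g v⟩
  total_one : ∀ x (e : E x), total.one ⟨x, e⟩ = ⟨𝒢.one x, oneV x e⟩
  total_inv : ∀ g (v : V g), total.inv ⟨g, v⟩ = ⟨𝒢.inv g, invV g v⟩
  total_mul : ∀ g h (v : V g) (w : V h), total.src ⟨g, v⟩ = total.tgt ⟨h, w⟩ →
    total.mul ⟨g, v⟩ ⟨h, w⟩ = ⟨𝒢.mul g h, mulV g h (v, w)⟩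

variable {𝒢 : LieGroupoid I J G M}
  {F : Type*} [NormedAddCommGroup F] [NormedSpace ℝ F]
  {V : G → Type*} [TopologicalSpace (TotalSpace F V)] [∀ x, TopologicalSpace (V x)]
  [∀ x, AddCommGroup (V x)] [∀ x, Module ℝ (V x)] [FiberBundle F V] [VectorBundle ℝ F V]
  {F' : Type*} [NormedAddCommGroup F'] [NormedSpace ℝ F']
  {E : M → Type*} [TopologicalSpace (TotalSpace F' E)] [∀ x, TopologicalSpace (E x)]
  [∀ x, AddCommGroup (E x)] [∀ x, Module ℝ (E x)] [FiberBundle F' E] [VectorBundle ℝ F' E]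

theorem contMDiff_add_along {f : M → G} {a b : ∀ x, V (f x)}
    (ha : ContMDiff J (I.prod 𝓘(ℝ, F)) ∞ (fun x => (⟨f x, a x⟩ : TotalSpace F V)))
    (hb : ContMDiff J (I.prod 𝓘(ℝ, F)) ∞ (fun x => (⟨f x, b x⟩ : TotalSpace F V))) :
    ContMDiff J (I.prod 𝓘(ℝ, F)) ∞ (fun x => (⟨f x, a x + b x⟩ : TotalSpace F V)) := by
  intro x
  have ha := contMDiffAt_totalSpace.1 (ha x)
  have hb := contMDiffAt_totalSpace.1 (hb x)
  refine contMDiffAt_totalSpace.2 ⟨ha.1, (ha.2.add hb.2).congr_of_eventuallyEq ?_⟩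
  have h := ha.1.continuousAt.preimage_mem_nhds
    ((trivializationAt F V (f x)).open_baseSet.mem_nhds
      (FiberBundle.mem_baseSet_trivializationAt' (f x)))
  filter_upwards [h] with y hy
  exact ((trivializationAt F V (f x)).linear ℝ hy).map_add _ _

theorem contMDiff_smul_along {f : M → G} {a : ∀ x, V (f x)} (r : ℝ)
    (ha : ContMDiff J (I.prod 𝓘(ℝ, F)) ∞ (fun x => (⟨f x, a x⟩ : TotalSpace F V))) :
    ContMDiff J (I.prod 𝓘(ℝ, F)) ∞ (fun x => (⟨f x, r • a x⟩ : TotalSpace F V)) := by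
  intro x
  have ha := contMDiffAt_totalSpace.1 (ha x)
  refine contMDiffAt_totalSpace.2 ⟨ha.1,
    ((contMDiffAt_const (I := J) (I' := 𝓘(ℝ, ℝ)) (c := r)).smul ha.2).congr_of_eventuallyEq ?_⟩
  have h := ha.1.continuousAt.preimage_mem_nhds
    ((trivializationAt F V (f x)).open_baseSet.mem_nhds
      (FiberBundle.mem_baseSet_trivializationAt' (f x)))
  filter_upwards [h] with y hy
  exact ((trivializationAt F V (f x)).linear ℝ hy).map_smul _ _

namespace VBGroupoid

/-- Composability of two vectors `v ∈ V g`, `w ∈ V h`, i.e. `s(v) = t(w)` in `E`. -/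
def Composable (𝒱 : VBGroupoid 𝒢 F V F' E) {g h : G} (v : V g) (w : V h) : Prop :=
  𝒱.total.src ⟨g, v⟩ = 𝒱.total.tgt ⟨h, w⟩

/-- A section `X` of `V → G` is multiplicative if there is a section `e` of `E → M` such that
`X : G → V` is a morphism of groupoids covering `e : M → E`. -/
def IsMultiplicative (𝒱 : VBGroupoid 𝒢 F V F' E) (X : Cₛ^∞⟮I; F, V⟯) : Prop :=
  ∃ e : Cₛ^∞⟮J; F', E⟯,
    (∀ g, 𝒱.srcV g (X g) = e (𝒢.src g)) ∧
    (∀ g, 𝒱.tgtV g (X g) = e (𝒢.tgt g)) ∧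
    (∀ x, X (𝒢.one x) = 𝒱.oneV x (e x)) ∧
    ∀ g h, 𝒢.src g = 𝒢.tgt h → X (𝒢.mul g h) = 𝒱.mulV g h (X g, X h)

/-- The space `Γ(C)` of smooth sections of the core `C = ker(s : V → E)|_M`. -/
def coreSections (𝒱 : VBGroupoid 𝒢 F V F' E) : Submodule ℝ (∀ x, V (𝒢.one x)) where
  carrier := {c | (∀ x, 𝒱.srcV (𝒢.one x) (c x) = 0) ∧
    ContMDiff J (I.prod 𝓘(ℝ, F)) ∞ (fun x => (⟨𝒢.one x, c x⟩ : TotalSpace F V))}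
  zero_mem' := ⟨fun x => by simp, (contMDiff_zeroSection ℝ V).comp 𝒢.contMDiff_one⟩
  add_mem' ha hb := ⟨fun x => by simp [ha.1 x, hb.1 x], contMDiff_add_along ha.2 hb.2⟩
  smul_mem' r a ha := ⟨fun x => by simp [ha.1 x], contMDiff_smul_along r ha.2⟩

/-- The smooth section given by a smooth map `f : G → V` with `f(g) ∈ V g`. -/
def sectionOfMap (f : G → TotalSpace F V) (hf : ContMDiff I (I.prod 𝓘(ℝ, F)) ∞ f)
    (h : ∀ g, (f g).1 = g) : Cₛ^∞⟮I; F, V⟯ where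
  toFun g := h g ▸ (f g).2
  contMDiff_toFun := hf.congr fun g => totalSpace_mk_rec (f g) (h g)

theorem mk_sectionOfMap (f : G → TotalSpace F V) (hf : ContMDiff I (I.prod 𝓘(ℝ, F)) ∞ f)
    (h : ∀ g, (f g).1 = g) (g : G) : (⟨g, sectionOfMap f hf h g⟩ : TotalSpace F V) = f g :=
  totalSpace_mk_rec (f g) (h g)

section

variable (𝒱 : VBGroupoid 𝒢 F V F' E)

theorem core_congr (c : 𝒱.coreSections) {x y : M} (h : x = y) :
    (⟨𝒢.one x, c.1 x⟩ : TotalSpace F V) = ⟨𝒢.one y, c.1 y⟩ := by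
  subst h
  rfl

theorem src_core (c : 𝒱.coreSections) (x : M) :
    𝒱.total.src ⟨𝒢.one x, c.1 x⟩ = zeroSection F' E x := by
  rw [𝒱.total_src, c.2.1 x, 𝒢.src_one]
  rfl

theorem src_zero (g : G) : 𝒱.total.src ⟨g, 0⟩ = zeroSection F' E (𝒢.src g) := by
  rw [𝒱.total_src, map_zero]
  rfl

theorem tgt_zero (g : G) : 𝒱.total.tgt ⟨g, 0⟩ = zeroSection F' E (𝒢.tgt g) := by
  rw [𝒱.total_tgt, map_zero]
  rfl

theorem composable_right (c : 𝒱.coreSections) (g : G) :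
    𝒱.Composable (c.1 (𝒢.tgt g)) (0 : V g) :=
  (𝒱.src_core c _).trans (𝒱.tgt_zero g).symm

theorem composable_left (c : 𝒱.coreSections) (g : G) :
    𝒱.total.src ⟨g, 0⟩ = 𝒱.total.tgt (𝒱.total.inv ⟨𝒢.one (𝒢.src g), c.1 (𝒢.src g)⟩) := by
  rw [𝒱.total.tgt_inv, 𝒱.src_core, 𝒱.src_zero]

theorem contMDiff_right (c : 𝒱.coreSections) : ContMDiff I (I.prod 𝓘(ℝ, F)) ∞
    (fun g => 𝒱.total.mul ⟨𝒢.one (𝒢.tgt g), c.1 (𝒢.tgt g)⟩ ⟨g, 0⟩) := by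
  have h1 : ContMDiff I (I.prod 𝓘(ℝ, F)) ∞
      (fun g => (⟨𝒢.one (𝒢.tgt g), c.1 (𝒢.tgt g)⟩ : TotalSpace F V)) :=
    c.2.2.comp 𝒢.isSubmersion_tgt.contMDiff
  have h2 : ContMDiff I (I.prod 𝓘(ℝ, F)) ∞ (fun g => (⟨g, 0⟩ : TotalSpace F V)) :=
    contMDiff_zeroSection ℝ V
  exact 𝒱.total.contMDiffOn_mul.comp_contMDiff (h1.prodMk h2) (𝒱.composable_right c)

theorem contMDiff_left (c : 𝒱.coreSections) : ContMDiff I (I.prod 𝓘(ℝ, F)) ∞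
    (fun g => 𝒱.total.mul ⟨g, 0⟩ (𝒱.total.inv ⟨𝒢.one (𝒢.src g), c.1 (𝒢.src g)⟩)) := by
  have h1 : ContMDiff I (I.prod 𝓘(ℝ, F)) ∞
      (fun g => 𝒱.total.inv ⟨𝒢.one (𝒢.src g), c.1 (𝒢.src g)⟩) :=
    𝒱.total.contMDiff_inv.comp (c.2.2.comp 𝒢.isSubmersion_src.contMDiff)
  have h2 : ContMDiff I (I.prod 𝓘(ℝ, F)) ∞ (fun g => (⟨g, 0⟩ : TotalSpace F V)) :=
    contMDiff_zeroSection ℝ V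
  exact 𝒱.total.contMDiffOn_mul.comp_contMDiff (h2.prodMk h1) (𝒱.composable_left c)

/-- The right invariant section `c^r(g) = c(t(g)) 0_g`. -/
def rightInvariant (c : 𝒱.coreSections) : Cₛ^∞⟮I; F, V⟯ :=
  sectionOfMap (fun g => 𝒱.total.mul ⟨𝒢.one (𝒢.tgt g), c.1 (𝒢.tgt g)⟩ ⟨g, 0⟩)
    (𝒱.contMDiff_right c)
    (fun g => by rw [𝒱.total_mul _ _ _ _ (𝒱.composable_right c g)]; exact 𝒢.one_mul g)

/-- The left invariant section `c^l(g) = - 0_g c(s(g))⁻¹`. -/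
def leftInvariant (c : 𝒱.coreSections) : Cₛ^∞⟮I; F, V⟯ :=
  - sectionOfMap (fun g => 𝒱.total.mul ⟨g, 0⟩
      (𝒱.total.inv ⟨𝒢.one (𝒢.src g), c.1 (𝒢.src g)⟩))
    (𝒱.contMDiff_left c)
    (fun g => by
      have h := 𝒱.composable_left c g
      rw [𝒱.total_inv] at h ⊢
      rw [𝒱.total_mul _ _ _ _ h]
      have h' : 𝒢.one (𝒢.src g) = 𝒢.inv (𝒢.one (𝒢.src g)) := by
        have := 𝒢.mul_inv (𝒢.one (𝒢.src g))
        have h2 := 𝒢.one_mul (𝒢.inv (𝒢.one (𝒢.src g)))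
        rw [𝒢.tgt_inv, 𝒢.src_one] at h2
        rw [h2, 𝒢.tgt_one] at this
        exact this.symm
      exact (congrArg (𝒢.mul g) h'.symm).trans (𝒢.mul_one g))

theorem mk_rightInvariant (c : 𝒱.coreSections) (g : G) :
    (⟨g, 𝒱.rightInvariant c g⟩ : TotalSpace F V) =
      𝒱.total.mul ⟨𝒢.one (𝒢.tgt g), c.1 (𝒢.tgt g)⟩ ⟨g, 0⟩ :=
  mk_sectionOfMap _ (𝒱.contMDiff_right c) _ g

theorem mk_rightInvariant' (c : 𝒱.coreSections) (g : G) :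
    (⟨g, 𝒱.rightInvariant c g⟩ : TotalSpace F V) =
      ⟨𝒢.mul (𝒢.one (𝒢.tgt g)) g, 𝒱.mulV _ g (c.1 (𝒢.tgt g), 0)⟩ :=
  (𝒱.mk_rightInvariant c g).trans (𝒱.total_mul _ _ _ _ (𝒱.composable_right c g))

theorem rightInvariant_one (c : 𝒱.coreSections) (x : M) :
    𝒱.rightInvariant c (𝒢.one x) = c.1 x := by
  have h : (⟨𝒢.one x, 𝒱.rightInvariant c (𝒢.one x)⟩ : TotalSpace F V) = ⟨𝒢.one x, c.1 x⟩ := by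
    rw [mk_rightInvariant, 𝒱.core_congr c (𝒢.tgt_one x)]
    have h0 : (⟨𝒢.one x, 0⟩ : TotalSpace F V) = 𝒱.total.one (𝒱.total.src ⟨𝒢.one x, c.1 x⟩) := by
      rw [src_core]
      exact ((𝒱.total_one x 0).trans (by rw [map_zero])).symm
    rw [h0, 𝒱.total.mul_one]
  rwa [TotalSpace.mk_inj] at h

theorem srcV_rightInvariant (c : 𝒱.coreSections) (g : G) :
    𝒱.srcV g (𝒱.rightInvariant c g) = 0 := by
  have h := 𝒱.total_src g (𝒱.rightInvariant c g)
  rw [mk_rightInvariant, 𝒱.total.src_mul _ _ (𝒱.composable_right c g), src_zero] at h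
  exact ((TotalSpace.mk_inj).1 h).symm

theorem rightInvariant_add (c c' : 𝒱.coreSections) :
    𝒱.rightInvariant (c + c') = 𝒱.rightInvariant c + 𝒱.rightInvariant c' := by
  ext g
  have h := totalSpace_add_eq (𝒱.mk_rightInvariant' c g) (𝒱.mk_rightInvariant' c' g)
  rw [← map_add, Prod.mk_add_mk, add_zero] at h
  exact (TotalSpace.mk_inj).1 ((𝒱.mk_rightInvariant' (c + c') g).trans h.symm)

theorem rightInvariant_injective : Function.Injective 𝒱.rightInvariant := by
  intro c c' h
  ext x
  rw [← rightInvariant_one, ← rightInvariant_one, h]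

theorem rightInvariant_smul (r : ℝ) (c : 𝒱.coreSections) :
    𝒱.rightInvariant (r • c) = r • 𝒱.rightInvariant c := by
  ext g
  have h' := totalSpace_smul_eq r (𝒱.mk_rightInvariant' c g)
  rw [← map_smul, Prod.smul_mk, smul_zero] at h'
  exact (TotalSpace.mk_inj).1 ((𝒱.mk_rightInvariant' (r • c) g).trans h'.symm)

/-- `X₁(g) X₂(h) = X(g h)` for all composable `g`, `h`. -/
def MulRelated (X₁ X₂ X : Cₛ^∞⟮I; F, V⟯) : Prop :=
  ∀ g h, 𝒢.src g = 𝒢.tgt h →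
    𝒱.Composable (X₁ g) (X₂ h) ∧ 𝒱.mulV g h (X₁ g, X₂ h) = X (𝒢.mul g h)

theorem mulRelated_rightInvariant (c : 𝒱.coreSections) :
    𝒱.MulRelated (𝒱.rightInvariant c) 0 (𝒱.rightInvariant c) := by
  intro g h hgh
  have h1 : 𝒱.Composable (𝒱.rightInvariant c g) ((0 : Cₛ^∞⟮I; F, V⟯) h) := by
    change 𝒱.total.src _ = 𝒱.total.tgt ⟨h, 0⟩
    rw [mk_rightInvariant, 𝒱.total.src_mul _ _ (𝒱.composable_right c g), src_zero, tgt_zero, hgh]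
  refine ⟨h1, (TotalSpace.mk_inj (F := F)).1 ?_⟩
  refine (𝒱.total_mul _ _ _ _ h1).symm.trans ?_
  change 𝒱.total.mul _ ⟨h, 0⟩ = _
  refine Eq.trans ?_ (𝒱.mk_rightInvariant c (𝒢.mul g h)).symm
  rw [mk_rightInvariant, 𝒱.core_congr c (𝒢.tgt_mul g h hgh)]
  have h2 : 𝒱.total.src ⟨g, 0⟩ = 𝒱.total.tgt ⟨h, 0⟩ := by rw [src_zero, tgt_zero, hgh]
  have h3 : (⟨𝒢.mul g h, 0⟩ : TotalSpace F V) = 𝒱.total.mul ⟨g, 0⟩ ⟨h, 0⟩ := by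
    rw [𝒱.total_mul _ _ _ _ h2, Prod.mk_zero_zero, map_zero]
  rw [h3]
  exact 𝒱.total.mul_assoc _ _ _ (𝒱.composable_right c g) h2

/-- Restriction to the units of a section of `ker(s)`. -/
def coreOfSection (X : Cₛ^∞⟮I; F, V⟯) (h : ∀ g, 𝒱.srcV g (X g) = 0) : 𝒱.coreSections :=
  ⟨fun x => X (𝒢.one x), fun _ => h _, X.contMDiff.comp 𝒢.contMDiff_one⟩

theorem rightInvariant_coreOfSection (X : Cₛ^∞⟮I; F, V⟯) (h : ∀ g, 𝒱.srcV g (X g) = 0)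
    (h' : 𝒱.MulRelated X 0 X) : 𝒱.rightInvariant (𝒱.coreOfSection X h) = X := by
  ext g
  have h1 := (h' (𝒢.one (𝒢.tgt g)) g (𝒢.src_one _)).2
  have h2 := 𝒱.mk_rightInvariant' (𝒱.coreOfSection X h) g
  rw [← TotalSpace.mk_inj (F := F)]
  refine h2.trans ?_
  change (⟨_, 𝒱.mulV _ g (X (𝒢.one (𝒢.tgt g)), (0 : Cₛ^∞⟮I; F, V⟯) g)⟩ : TotalSpace F V) = _
  rw [h1, 𝒢.one_mul]

end

/-- The object component at `x` of a functor `X : G → V`: the base section `e` of a multiplicative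
section `X` is recovered as `e(x) = s(X(1ₓ))`. -/
def base (𝒱 : VBGroupoid 𝒢 F V F' E) (X : Cₛ^∞⟮I; F, V⟯) (x : M) : TotalSpace F' E :=
  𝒱.total.src ⟨𝒢.one x, X (𝒢.one x)⟩

/-- Objects of the category `Sec(G, V)` of multiplicative sections. -/
@[ext] structure Sec (𝒱 : VBGroupoid 𝒢 F V F' E) where
  sec : Cₛ^∞⟮I; F, V⟯
  isMultiplicative : 𝒱.IsMultiplicative sec

/-- Morphisms `X ⇒ Y` of the category `Sec(G, V)`: smooth natural transformations `τ : M → V`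
between the functors `X, Y : G → V` whose composition with the projection `V → G` is the identity
transformation of the identity functor, i.e. `τ(x) ∈ V_{1ₓ}`. -/
@[ext] structure SecHom (𝒱 : VBGroupoid 𝒢 F V F' E) (X Y : 𝒱.Sec) where
  toFun : M → TotalSpace F V
  contMDiff : ContMDiff J (I.prod 𝓘(ℝ, F)) ∞ toFun
  proj_eq : ∀ x, (toFun x).1 = 𝒢.one x
  src_eq : ∀ x, 𝒱.total.src (toFun x) = 𝒱.base X.sec x
  tgt_eq : ∀ x, 𝒱.total.tgt (toFun x) = 𝒱.base Y.sec x
  natural : ∀ g, 𝒱.total.mul (toFun (𝒢.tgt g)) ⟨g, X.sec g⟩ =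
    𝒱.total.mul ⟨g, Y.sec g⟩ (toFun (𝒢.src g))

theorem base_eq {𝒱 : VBGroupoid 𝒢 F V F' E} {X : Cₛ^∞⟮I; F, V⟯} {e : Cₛ^∞⟮J; F', E⟯}
    (h : ∀ g, 𝒱.srcV g (X g) = e (𝒢.src g)) (x : M) : 𝒱.base X x = ⟨x, e x⟩ := by
  rw [base, 𝒱.total_src, h, 𝒢.src_one]

theorem total_src_sec {𝒱 : VBGroupoid 𝒢 F V F' E} (X : 𝒱.Sec) (g : G) :
    𝒱.total.src ⟨g, X.sec g⟩ = 𝒱.base X.sec (𝒢.src g) := by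
  obtain ⟨e, h1, -⟩ := X.isMultiplicative
  rw [base_eq h1, 𝒱.total_src, h1]

theorem total_tgt_sec {𝒱 : VBGroupoid 𝒢 F V F' E} (X : 𝒱.Sec) (g : G) :
    𝒱.total.tgt ⟨g, X.sec g⟩ = 𝒱.base X.sec (𝒢.tgt g) := by
  obtain ⟨e, h1, h2, -⟩ := X.isMultiplicative
  rw [base_eq h1, 𝒱.total_tgt, h2]

theorem one_base {𝒱 : VBGroupoid 𝒢 F V F' E} (X : 𝒱.Sec) (x : M) :
    𝒱.total.one (𝒱.base X.sec x) = ⟨𝒢.one x, X.sec (𝒢.one x)⟩ := by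
  obtain ⟨e, h1, h2, h3, -⟩ := X.isMultiplicative
  rw [base_eq h1, 𝒱.total_one, h3]

/-- The category of multiplicative sections, with vertical composition of natural transformations:
`(σ ∘ τ)(x) = σ(x) τ(x)`. -/
instance (𝒱 : VBGroupoid 𝒢 F V F' E) : CategoryTheory.Category 𝒱.Sec where
  Hom X Y := 𝒱.SecHom X Y
  id X :=
    { toFun := fun x => ⟨𝒢.one x, X.sec (𝒢.one x)⟩
      contMDiff := X.sec.contMDiff.comp 𝒢.contMDiff_one
      proj_eq := fun x => rfl
      src_eq := fun x => rfl
      tgt_eq := fun x => by rw [total_tgt_sec, 𝒢.tgt_one]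
      natural := fun g => by
        rw [← one_base, ← one_base, ← total_tgt_sec, ← total_src_sec, 𝒱.total.one_mul,
          𝒱.total.mul_one] }
  comp {X Y Z} τ σ :=
    { toFun := fun x => 𝒱.total.mul (σ.toFun x) (τ.toFun x)
      contMDiff := 𝒱.total.contMDiffOn_mul.comp_contMDiff
        (f := fun x => (σ.toFun x, τ.toFun x)) (σ.contMDiff.prodMk τ.contMDiff)
        (fun x => (σ.src_eq x).trans (τ.tgt_eq x).symm)
      proj_eq := fun x => by
        have h := (σ.src_eq x).trans (τ.tgt_eq x).symm
        have h2 := 𝒱.total_mul (σ.toFun x).1 (τ.toFun x).1 (σ.toFun x).2 (τ.toFun x).2 h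
        refine (congrArg TotalSpace.proj h2).trans ?_
        have h3 := 𝒢.mul_one (𝒢.one x)
        rw [𝒢.src_one] at h3
        change 𝒢.mul (σ.toFun x).1 (τ.toFun x).1 = _
        rw [σ.proj_eq, τ.proj_eq, h3]
      src_eq := fun x => by
        rw [𝒱.total.src_mul _ _ ((σ.src_eq x).trans (τ.tgt_eq x).symm), τ.src_eq]
      tgt_eq := fun x => by
        rw [𝒱.total.tgt_mul _ _ ((σ.src_eq x).trans (τ.tgt_eq x).symm), σ.tgt_eq]
      natural := fun g => by
        rw [𝒱.total.mul_assoc _ _ _ ((σ.src_eq _).trans (τ.tgt_eq _).symm)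
            ((τ.src_eq _).trans (total_tgt_sec X g).symm), τ.natural,
          ← 𝒱.total.mul_assoc _ _ _ ((σ.src_eq _).trans (total_tgt_sec Y g).symm)
            ((total_src_sec Y g).trans (τ.tgt_eq _).symm), σ.natural,
          𝒱.total.mul_assoc _ _ _ ((total_src_sec Z g).trans (σ.tgt_eq _).symm)
            ((σ.src_eq _).trans (τ.tgt_eq _).symm)] }
  id_comp {X Y} τ := by
    apply SecHom.ext
    funext x
    change 𝒱.total.mul _ ⟨_, _⟩ = _
    rw [← one_base, ← τ.src_eq, 𝒱.total.mul_one]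
  comp_id {X Y} τ := by
    apply SecHom.ext
    funext x
    change 𝒱.total.mul ⟨_, _⟩ _ = _
    rw [← one_base, ← τ.tgt_eq, 𝒱.total.one_mul]
  assoc {W X Y Z} ρ τ σ := by
    apply SecHom.ext
    funext x
    exact (𝒱.total.mul_assoc _ _ _ ((σ.src_eq x).trans (τ.tgt_eq x).symm)
      ((τ.src_eq x).trans (ρ.tgt_eq x).symm)).symm

end VBGroupoid

/-- The anchor of the product Lie algebroid `V × V → G × G` applied to the section
`(g, h) ↦ (∑ᵢ aᵢ(g, h) Xᵢ(g), ∑ⱼ bⱼ(g, h) Yⱼ(h))`. -/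
def pairAnchor [IsManifold I ∞ G] [ContMDiffVectorBundle ∞ F V I] [LieAlgebroid I F V]
    (σ₁ σ₂ : FormalSection (I.prod I) (G × G) I F V) (g h : G) : TangentSpace (I.prod I) (g, h) :=
  (LieAlgebroid.rho I F g (σ₁.eval (g, h) g), LieAlgebroid.rho I F h (σ₂.eval (g, h) h))

/-- An `LA`-groupoid: a `VB`-groupoid `V ⇉ E` over `G ⇉ M` such that `V → G` and `E → M` are Lie
algebroids and all structure maps of `V ⇉ E` are Lie algebroid morphisms over the structure maps of
`G ⇉ M`.

For the multiplication this refers to the Lie algebroid of composable pairs, a subalgebroid of the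
product `V × V → G × G`. Its sections are the restrictions of the sections
`(g, h) ↦ (∑ᵢ aᵢ(g, h) Xᵢ(g), ∑ⱼ bⱼ(g, h) Yⱼ(h))` of `V × V` with composable values on composable
pairs; both the bracket of `V × V` and the condition of being a morphism are written out on them. -/
structure LAGroupoid [IsManifold I ∞ G] [IsManifold J ∞ M] (𝒢 : LieGroupoid I J G M)
    (F : Type*) [NormedAddCommGroup F] [NormedSpace ℝ F]
    (V : G → Type*) [TopologicalSpace (TotalSpace F V)] [∀ x, TopologicalSpace (V x)]
    [∀ x, AddCommGroup (V x)] [∀ x, Module ℝ (V x)] [FiberBundle F V] [VectorBundle ℝ F V]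
    [ContMDiffVectorBundle ∞ F V I] [LieAlgebroid I F V]
    (F' : Type*) [NormedAddCommGroup F'] [NormedSpace ℝ F']
    (E : M → Type*) [TopologicalSpace (TotalSpace F' E)] [∀ x, TopologicalSpace (E x)]
    [∀ x, AddCommGroup (E x)] [∀ x, Module ℝ (E x)] [FiberBundle F' E] [VectorBundle ℝ F' E]
    [ContMDiffVectorBundle ∞ F' E J] [LieAlgebroid J F' E]
    extends VBGroupoid 𝒢 F V F' E where
  src_morphism : IsLieAlgebroidMorphism I J F F' 𝒢.src srcV
  tgt_morphism : IsLieAlgebroidMorphism I J F F' 𝒢.tgt tgtV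
  one_morphism : IsLieAlgebroidMorphism J I F' F 𝒢.one oneV
  inv_morphism : IsLieAlgebroidMorphism I I F F 𝒢.inv invV
  mul_anchor : ∀ g h (v : V g) (w : V h), toVBGroupoid.Composable v w →
    LieAlgebroid.rho I F (𝒢.mul g h) (mulV g h (v, w)) =
      𝒢.tangentMul g h (LieAlgebroid.rho I F g v, LieAlgebroid.rho I F h w)
  mul_bracket : ∀ (σ₁ σ₂ σ τ₁ τ₂ τ : FormalSection (I.prod I) (G × G) I F V),
    (∀ g h, 𝒢.src g = 𝒢.tgt h →
      toVBGroupoid.Composable (σ₁.eval (g, h) g) (σ₂.eval (g, h) h) ∧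
      mulV g h (σ₁.eval (g, h) g, σ₂.eval (g, h) h) = σ.eval (g, h) (𝒢.mul g h)) →
    (∀ g h, 𝒢.src g = 𝒢.tgt h →
      toVBGroupoid.Composable (τ₁.eval (g, h) g) (τ₂.eval (g, h) h) ∧
      mulV g h (τ₁.eval (g, h) g, τ₂.eval (g, h) h) = τ.eval (g, h) (𝒢.mul g h)) →
    ∀ g h, 𝒢.src g = 𝒢.tgt h →
      toVBGroupoid.Composable
        (σ₁.bracketAt τ₁ (g, h) (pairAnchor σ₁ σ₂ g h) (pairAnchor τ₁ τ₂ g h) g)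
        (σ₂.bracketAt τ₂ (g, h) (pairAnchor σ₁ σ₂ g h) (pairAnchor τ₁ τ₂ g h) h) ∧
      mulV g h
        (σ₁.bracketAt τ₁ (g, h) (pairAnchor σ₁ σ₂ g h) (pairAnchor τ₁ τ₂ g h) g,
          σ₂.bracketAt τ₂ (g, h) (pairAnchor σ₁ σ₂ g h) (pairAnchor τ₁ τ₂ g h) h) =
        σ.bracketAt τ (g, h) (pairAnchor σ₁ σ₂ g h) (pairAnchor τ₁ τ₂ g h) (𝒢.mul g h)

/-- The tangent groupoid `TG ⇉ TM`: the `VB`-groupoid on the tangent bundles whose structure maps are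
the derivatives of the structure maps of `G ⇉ M`. -/
structure VBGroupoid.IsTangentGroupoid [IsManifold I ∞ G] [IsManifold J ∞ M]
    (𝒯 : VBGroupoid 𝒢 EG (TangentSpace I : G → Type _) EM (TangentSpace J : M → Type _)) :
    Prop where
  srcV_eq : ∀ g, 𝒯.srcV g = mfderiv I J 𝒢.src g
  tgtV_eq : ∀ g, 𝒯.tgtV g = mfderiv I J 𝒢.tgt g
  oneV_eq : ∀ x, 𝒯.oneV x = mfderiv J I 𝒢.one x
  invV_eq : ∀ g, 𝒯.invV g = mfderiv I I 𝒢.inv g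
  mulV_eq : ∀ g h (a : TangentSpace I g) (b : TangentSpace I h), 𝒯.Composable a b →
    𝒯.mulV g h (a, b) = 𝒢.tangentMul g h (a, b)

namespace LAGroupoid

variable [IsManifold I ∞ G] [IsManifold J ∞ M]
  [ContMDiffVectorBundle ∞ F V I] [LieAlgebroid I F V]
  [ContMDiffVectorBundle ∞ F' E J] [LieAlgebroid J F' E]

section

variable (𝒱 : LAGroupoid 𝒢 F V F' E)

theorem mulRelated_lie {X₁ X₂ X Y₁ Y₂ Y : Cₛ^∞⟮I; F, V⟯} (hX : 𝒱.MulRelated X₁ X₂ X)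
    (hY : 𝒱.MulRelated Y₁ Y₂ Y) : 𝒱.MulRelated ⁅X₁, Y₁⁆ ⁅X₂, Y₂⁆ ⁅X, Y⁆ := by
  intro g h hgh
  have := 𝒱.mul_bracket (.single X₁) (.single X₂) (.single X) (.single Y₁) (.single Y₂) (.single Y)
    (fun g h hgh => by simpa using hX g h hgh) (fun g h hgh => by simpa using hY g h hgh)
    g h hgh
  simpa using this

theorem srcV_lie {X X' : Cₛ^∞⟮I; F, V⟯} {e e' : Cₛ^∞⟮J; F', E⟯}
    (h : ∀ g, 𝒱.srcV g (X g) = e (𝒢.src g)) (h' : ∀ g, 𝒱.srcV g (X' g) = e' (𝒢.src g)) (g : G) :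
    𝒱.srcV g ((⁅X, X'⁆ : Cₛ^∞⟮I; F, V⟯) g) = (⁅e, e'⁆ : Cₛ^∞⟮J; F', E⟯) (𝒢.src g) := by
  have := 𝒱.src_morphism.map_bracket X X' (.single e) (.single e') (by simpa using h)
    (by simpa using h') g
  simpa using this

/-- The Lie algebra `Γ_mult(V)` of multiplicative sections, a Lie subalgebra of `Γ(V)`. -/
def multSections : LieSubalgebra ℝ Cₛ^∞⟮I; F, V⟯ where
  carrier := {X | 𝒱.IsMultiplicative X}
  zero_mem' := ⟨0, fun g => by simp, fun g => by simp, fun g => by simp, fun g h _ => by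
    change (0 : V _) = 𝒱.mulV g h (0, 0)
    rw [Prod.mk_zero_zero, map_zero]⟩
  add_mem' := by
    rintro X Y ⟨e, h1, h2, h3, h4⟩ ⟨f, k1, k2, k3, k4⟩
    refine ⟨e + f, fun g => by simp [h1, k1], fun g => by simp [h2, k2],
      fun g => by simp [h3, k3], fun g h hgh => ?_⟩
    change X _ + Y _ = 𝒱.mulV g h (X g + Y g, X h + Y h)
    rw [h4 g h hgh, k4 g h hgh, ← map_add, Prod.mk_add_mk]
  smul_mem' := by
    rintro r X ⟨e, h1, h2, h3, h4⟩
    refine ⟨r • e, fun g => by simp [h1], fun g => by simp [h2],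
      fun g => by simp [h3], fun g h hgh => ?_⟩
    change r • X _ = 𝒱.mulV g h (r • X g, r • X h)
    rw [h4 g h hgh, ← map_smul, Prod.smul_mk]
  lie_mem' := by
    rintro X Y ⟨e, h1, h2, h3, h4⟩ ⟨f, k1, k2, k3, k4⟩
    have hX : 𝒱.MulRelated X X X := fun g h hgh =>
      ⟨by rw [VBGroupoid.Composable, 𝒱.total_src, 𝒱.total_tgt, h1, h2, hgh], (h4 g h hgh).symm⟩
    have hY : 𝒱.MulRelated Y Y Y := fun g h hgh =>
      ⟨by rw [VBGroupoid.Composable, 𝒱.total_src, 𝒱.total_tgt, k1, k2, hgh], (k4 g h hgh).symm⟩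
    refine ⟨⁅e, f⁆, 𝒱.srcV_lie h1 k1, fun g => ?_, fun x => ?_,
      fun g h hgh => (𝒱.mulRelated_lie hX hY g h hgh).2.symm⟩
    · have := 𝒱.tgt_morphism.map_bracket X Y (.single e) (.single f) (by simpa using h2)
        (by simpa using k2) g
      simpa using this
    · have := 𝒱.one_morphism.map_bracket e f (.single X) (.single Y)
        (by simpa using fun x => (h3 x).symm) (by simpa using fun x => (k3 x).symm) x
      simpa using this.symm

theorem srcV_lie_rightInvariant (c c' : 𝒱.coreSections) (g : G) :
    𝒱.srcV g ((⁅𝒱.rightInvariant c, 𝒱.rightInvariant c'⁆ : Cₛ^∞⟮I; F, V⟯) g) = 0 := by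
  rw [𝒱.srcV_lie (e := 0) (e' := 0) (𝒱.srcV_rightInvariant c) (𝒱.srcV_rightInvariant c'), lie_self]
  rfl

/-- The Lie bracket on `Γ(C)`, determined by `[c, c']^r = [c^r, c'^r]`. -/
instance : Bracket 𝒱.coreSections 𝒱.coreSections where
  bracket c c' := 𝒱.coreOfSection ⁅𝒱.rightInvariant c, 𝒱.rightInvariant c'⁆
    (𝒱.srcV_lie_rightInvariant c c')

theorem rightInvariant_lie (c c' : 𝒱.coreSections) :
    𝒱.rightInvariant ⁅c, c'⁆ = ⁅𝒱.rightInvariant c, 𝒱.rightInvariant c'⁆ := by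
  refine 𝒱.rightInvariant_coreOfSection _ (𝒱.srcV_lie_rightInvariant c c') ?_
  have := 𝒱.mulRelated_lie (𝒱.mulRelated_rightInvariant c) (𝒱.mulRelated_rightInvariant c')
  rwa [lie_self] at this

/-- The Lie algebra `Γ(C)` of sections of the core. -/
instance : LieRing 𝒱.coreSections where
  add_lie a b c := 𝒱.rightInvariant_injective (by
    simp only [rightInvariant_lie, 𝒱.rightInvariant_add, add_lie])
  lie_add a b c := 𝒱.rightInvariant_injective (by
    simp only [rightInvariant_lie, 𝒱.rightInvariant_add, lie_add])
  lie_self a := 𝒱.rightInvariant_injective (by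
    have h := 𝒱.rightInvariant_smul 0 0
    rw [zero_smul, zero_smul] at h
    rw [rightInvariant_lie, lie_self, h])
  leibniz_lie a b c := 𝒱.rightInvariant_injective (by
    simp only [rightInvariant_lie, 𝒱.rightInvariant_add]
    exact leibniz_lie _ _ _)

instance : LieAlgebra ℝ 𝒱.coreSections where
  lie_smul r a b := 𝒱.rightInvariant_injective (by
    simp only [rightInvariant_lie, 𝒱.rightInvariant_smul, lie_smul])

end

end LAGroupoid

end Groupoid

section LieTwoAlgebra

/-- A crossed module of Lie algebras `𝔤 → 𝔥 → Der(𝔤)`. -/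
structure LieCrossedModule (𝔤 𝔥 : Type*) [LieRing 𝔤] [LieAlgebra ℝ 𝔤] [LieRing 𝔥]
    [LieAlgebra ℝ 𝔥] where
  /-- the homomorphism `∂ : 𝔤 → 𝔥` -/
  bdry : 𝔤 →ₗ⁅ℝ⁆ 𝔥
  /-- the action `φ : 𝔥 → Der(𝔤)` -/
  act : 𝔥 →ₗ⁅ℝ⁆ LieDerivation ℝ 𝔤 𝔤
  act_bdry : ∀ u v : 𝔤, act (bdry u) v = ⁅u, v⁆
  bdry_act : ∀ (X : 𝔥) (u : 𝔤), bdry (act X u) = ⁅X, bdry u⁆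

variable {𝔤₁ 𝔤₀ : Type*} [LieRing 𝔤₁] [LieAlgebra ℝ 𝔤₁] [LieRing 𝔤₀] [LieAlgebra ℝ 𝔤₀]

/-- The fibre product `𝔤₁ ×_{𝔤₀} 𝔤₁` of the pairs `(f, g)` with `s(f) = t(g)`. -/
def composablePairs (s t : 𝔤₁ →ₗ⁅ℝ⁆ 𝔤₀) : LieSubalgebra ℝ (𝔤₁ × 𝔤₁) where
  carrier := {p | s p.1 = t p.2}
  zero_mem' := by simp
  add_mem' {p q} hp hq := by
    change s (p.1 + q.1) = t (p.2 + q.2)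
    rw [map_add, map_add, hp, hq]
  smul_mem' r p hp := by
    change s (r • p.1) = t (r • p.2)
    rw [map_smul, map_smul, hp]
  lie_mem' {p q} hp hq := by
    change s ⁅p.1, q.1⁆ = t ⁅p.2, q.2⁆
    rw [LieHom.map_lie, LieHom.map_lie, hp, hq]

variable (𝔤₁ 𝔤₀) in
/-- A (strict) Lie 2-algebra `𝔤₁ ⇉ 𝔤₀`: a category internal to Lie algebras. The composition of
`(f, g)` with `s(f) = t(g)` is `f ∘ g`. -/
structure LieTwoAlgebra where
  src : 𝔤₁ →ₗ⁅ℝ⁆ 𝔤₀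
  tgt : 𝔤₁ →ₗ⁅ℝ⁆ 𝔤₀
  unit : 𝔤₀ →ₗ⁅ℝ⁆ 𝔤₁
  comp : composablePairs src tgt →ₗ⁅ℝ⁆ 𝔤₁
  src_unit : ∀ X, src (unit X) = X
  tgt_unit : ∀ X, tgt (unit X) = X
  src_comp : ∀ f g (h : src f = tgt g), src (comp ⟨(f, g), h⟩) = src g
  tgt_comp : ∀ f g (h : src f = tgt g), tgt (comp ⟨(f, g), h⟩) = tgt f
  unit_comp : ∀ f, comp ⟨(unit (tgt f), f), src_unit _⟩ = f
  comp_unit : ∀ f, comp ⟨(f, unit (src f)), (tgt_unit _).symm⟩ = f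
  assoc : ∀ f g k (h : src f = tgt g) (h' : src g = tgt k),
    comp ⟨(comp ⟨(f, g), h⟩, k), (src_comp f g h).trans h'⟩ =
      comp ⟨(f, comp ⟨(g, k), h'⟩), h.trans (tgt_comp g k h').symm⟩

/-- The objects of the underlying category of a Lie 2-algebra. -/
@[ext] structure LieTwoAlgebra.Obj (L : LieTwoAlgebra 𝔤₁ 𝔤₀) where
  val : 𝔤₀

theorem LieTwoAlgebra.comp_unit' (L : LieTwoAlgebra 𝔤₁ 𝔤₀) (f : 𝔤₁) (X : 𝔤₀) (h : L.src f = X) :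
    L.comp ⟨(f, L.unit X), h.trans (L.tgt_unit X).symm⟩ = f := by
  subst h
  exact L.comp_unit f

theorem LieTwoAlgebra.unit_comp' (L : LieTwoAlgebra 𝔤₁ 𝔤₀) (f : 𝔤₁) (X : 𝔤₀) (h : L.tgt f = X) :
    L.comp ⟨(L.unit X, f), (L.src_unit X).trans h.symm⟩ = f := by
  subst h
  exact L.unit_comp f

/-- The underlying category of a Lie 2-algebra. -/
instance (L : LieTwoAlgebra 𝔤₁ 𝔤₀) : CategoryTheory.Category L.Obj where
  Hom X Y := {f : 𝔤₁ // L.src f = X.val ∧ L.tgt f = Y.val}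
  id X := ⟨L.unit X.val, L.src_unit _, L.tgt_unit _⟩
  comp f g := ⟨L.comp ⟨(g.1, f.1), g.2.1.trans f.2.2.symm⟩,
    (L.src_comp _ _ _).trans f.2.1, (L.tgt_comp _ _ _).trans g.2.2⟩
  id_comp f := Subtype.ext (L.comp_unit' f.1 _ f.2.1)
  comp_id f := Subtype.ext (L.unit_comp' f.1 _ f.2.2)
  assoc _ _ _ := Subtype.ext (L.assoc _ _ _ _ _).symm

end LieTwoAlgebra

section Statement

variable {EG HG EM HM : Type*} [NormedAddCommGroup EG] [NormedSpace ℝ EG] [TopologicalSpace HG]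
  [NormedAddCommGroup EM] [NormedSpace ℝ EM] [TopologicalSpace HM]
  {I : ModelWithCorners ℝ EG HG} {J : ModelWithCorners ℝ EM HM}
  {G M : Type*} [TopologicalSpace G] [ChartedSpace HG G] [TopologicalSpace M] [ChartedSpace HM M]
  [IsManifold I ∞ G] [IsManifold J ∞ M]
  {𝒢 : LieGroupoid I J G M}
  {F : Type*} [NormedAddCommGroup F] [NormedSpace ℝ F]
  {V : G → Type*} [TopologicalSpace (TotalSpace F V)] [∀ x, TopologicalSpace (V x)]
  [∀ x, AddCommGroup (V x)] [∀ x, Module ℝ (V x)] [FiberBundle F V] [VectorBundle ℝ F V]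
  [ContMDiffVectorBundle ∞ F V I] [LieAlgebroid I F V]
  {F' : Type*} [NormedAddCommGroup F'] [NormedSpace ℝ F']
  {E : M → Type*} [TopologicalSpace (TotalSpace F' E)] [∀ x, TopologicalSpace (E x)]
  [∀ x, AddCommGroup (E x)] [∀ x, Module ℝ (E x)] [FiberBundle F' E] [VectorBundle ℝ F' E]
  [ContMDiffVectorBundle ∞ F' E J] [LieAlgebroid J F' E]

namespace LAGroupoid

/-- The crossed module `X` of `Γ(C)` and `Γ_mult(V)` has boundary map `δ(c) = c^r - c^l` and action
`D_X(c) = [X, c^r] ∘ 1`. -/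
structure IsCrossedModule (𝒱 : LAGroupoid 𝒢 F V F' E)
    (X : LieCrossedModule 𝒱.coreSections 𝒱.multSections) : Prop where
  bdry_eq : ∀ c, (X.bdry c : Cₛ^∞⟮I; F, V⟯) = 𝒱.rightInvariant c - 𝒱.leftInvariant c
  act_eq : ∀ (Y : 𝒱.multSections) (c : 𝒱.coreSections) (x : M),
    (X.act Y c).1 x = (⁅(Y : Cₛ^∞⟮I; F, V⟯), 𝒱.rightInvariant c⁆ : Cₛ^∞⟮I; F, V⟯) (𝒢.one x)

/-- The structure maps of the Lie 2-algebra `L` on `Γ(C) ⊕ Γ_mult(V) ⇉ Γ_mult(V)` are those of the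
2-vector space of multiplicative sections: `s(c, X) = X`, `t(c, X) = X + c^r - c^l`, `1_X = (0, X)`
and `(c, X) ∘ (c', X') = (c + c', X')`. The Lie bracket on `Γ(C) ⊕ Γ_mult(V)` is that of the
semidirect sum given by the crossed module `X`. -/
structure IsLieTwoAlgebra (𝒱 : LAGroupoid 𝒢 F V F' E)
    (X : LieCrossedModule 𝒱.coreSections 𝒱.multSections)
    (L : LieTwoAlgebra (LieAlgebra.SemiDirectSum 𝒱.coreSections 𝒱.multSections X.act)
      𝒱.multSections) : Prop where
  src_eq : ∀ f, L.src f = f.right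
  tgt_eq : ∀ f, (L.tgt f : Cₛ^∞⟮I; F, V⟯) =
    f.right + 𝒱.rightInvariant f.left - 𝒱.leftInvariant f.left
  unit_eq : ∀ Y, L.unit Y = ⟨0, Y⟩
  comp_eq : ∀ f g (h : L.src f = L.tgt g), L.comp ⟨(f, g), h⟩ = ⟨f.left + g.left, g.right⟩

/-- The functor `Φ` from the underlying category of the Lie 2-algebra `L` to the category `Sec(G, V)`
of multiplicative sections is the identity on objects and sends `(c, X)` to the natural
transformation `x ↦ c(x) + X(1ₓ)`, and it is an isomorphism of categories, i.e. bijective on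
objects, full and faithful. -/
structure IsSecIso (𝒱 : LAGroupoid 𝒢 F V F' E)
    {X : LieCrossedModule 𝒱.coreSections 𝒱.multSections}
    {L : LieTwoAlgebra (LieAlgebra.SemiDirectSum 𝒱.coreSections 𝒱.multSections X.act)
      𝒱.multSections} (Φ : L.Obj ⥤ 𝒱.Sec) : Prop where
  obj_eq : ∀ Y : L.Obj, (Φ.obj Y).sec = Y.val
  map_eq : ∀ {Y Z : L.Obj} (f : Y ⟶ Z) (x : M), (Φ.map f).toFun x =
    ⟨𝒢.one x, f.1.left.1 x + (Y.val : Cₛ^∞⟮I; F, V⟯) (𝒢.one x)⟩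
  bijective_obj : Function.Bijective Φ.obj
  full : Φ.Full
  faithful : Φ.Faithful

/-- The category `Sec(G, V) ≅ (Γ(C) ⊕ Γ_mult(V) ⇉ Γ_mult(V))` of multiplicative sections is a Lie
2-algebra, by means of the crossed module `Γ(C) → Γ_mult(V) → Der(Γ(C))`. All of the data asserted
to exist are determined uniquely by the equations which they satisfy. -/
def CarriesLieTwoAlgebra (𝒱 : LAGroupoid 𝒢 F V F' E) : Prop :=
  ∃ X : LieCrossedModule 𝒱.coreSections 𝒱.multSections, 𝒱.IsCrossedModule X ∧
    ∃ L : LieTwoAlgebra (LieAlgebra.SemiDirectSum 𝒱.coreSections 𝒱.multSections X.act)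
      𝒱.multSections, 𝒱.IsLieTwoAlgebra X L ∧
      ∃ Φ : L.Obj ⥤ 𝒱.Sec, 𝒱.IsSecIso Φ

end LAGroupoid

end Statement

end

open Bundle
open scoped Manifold ContDiff CategoryTheory Topology

noncomputable section

/-! ### Lie brackets and iterated derivatives of vector-valued functions -/

section
variable {E H M F : Type*} [NormedAddCommGroup E] [NormedSpace ℝ E] [TopologicalSpace H]
  {I : ModelWithCorners ℝ E H} [TopologicalSpace M] [ChartedSpace H M] [IsManifold I ∞ M]
  [NormedAddCommGroup F] [NormedSpace ℝ F]

/-! The algebra rests on one observation. Call (X₁, X₂, X) related if X₁(g) X₂(h) = X(gh) for all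
composable g, h. Since the multiplication is a morphism of Lie algebroids, brackets of related
triples are related (`mulRelated_lie`). A multiplicative section X gives the triple (X, X, X); a
core section c gives (c^r, 0, c^r) and (0, -c^l, -c^l). Bracketing such triples shows that [c^r,
c'^r] and [X, c^r] are again right invariant and that [c^r, c'^l] = 0. The inversion, also a
morphism of Lie algebroids, preserves multiplicative sections and carries c^r to -c^l, which yields
the brackets with left invariant sections. As c ↦ c^r is injective, the identities in Γ(C) can be
checked in Γ(V).

The linear structure enters through the interchange law (v + v')(w + w') = vw + v'w'
(`total_mul_add`). It makes c^r - c^l multiplicative and x ↦ c(x) + X(1ₓ) natural; with cancellation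
in the groupoid it shows that every natural transformation out of X has this form. The Lie 2-algebra
itself is the one attached to any crossed module: equivariance of the boundary makes the target map
a homomorphism, and the Peiffer identity does the same for the composition.

For the tangent groupoid the difficulty is that the composable pairs are only a submanifold of G ×
G. Because s is a submersion, there is near each composable pair a map r(g, h) = (ρ(g, h), h) into
the composable pairs whose derivative fixes all composable pairs of tangent vectors
(`exists_retraction`). Hence Tm can be computed as the derivative of m ∘ r on an open set, and the
groupoid axioms of TG follow by differentiating those of G. For brackets one uses [X, Y]u = X(Yu) -
Y(Xu) for a coordinate map u: if Tr fixes X and Y at a point, the outer derivatives there see only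
the values of Yu and Xu along the image of r, where the hypotheses on composable pairs apply
(`mfderiv_mlieBracket_along`, `tangentMap_mlieBracket_congr_along`). -/

theorem ContMDiffOn.contMDiffOn_tangentMap {E' H' M' : Type*} [NormedAddCommGroup E']
    [NormedSpace ℝ E'] [TopologicalSpace H'] {I' : ModelWithCorners ℝ E' H'} [TopologicalSpace M']
    [ChartedSpace H' M'] [IsManifold I' ∞ M'] {f : M → M'} {U : Set M} (hU : IsOpen U)
    (hf : ContMDiffOn I I' ∞ f U) :
    ContMDiffOn I.tangent I'.tangent ∞ (tangentMap I I' f) (TotalSpace.proj ⁻¹' U) := by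
  have h1 : IsManifold I 1 M := .of_le (n := ∞) (by simp)
  have h1 : IsManifold I' 1 M' := .of_le (n := ∞) (by simp)
  refine (hf.contMDiffOn_tangentMapWithin (m := ∞) (by simp) hU.uniqueMDiffOn).congr fun v hv => ?_
  simp only [tangentMap, tangentMapWithin, mfderivWithin_of_isOpen hU hv]

theorem ContMDiffOn.mvfderiv_apply {u : M → F} {U : Set M} (hU : IsOpen U)
    (hu : ContMDiffOn I 𝓘(ℝ, F) ∞ u U) {X : ∀ q, TangentSpace I q}
    (hX : ContMDiff I I.tangent ∞ (fun q => (⟨q, X q⟩ : TangentBundle I M))) :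
    ContMDiffOn I 𝓘(ℝ, F) ∞ (fun q => mvfderiv I u q (X q)) U := by
  have h := (contMDiff_snd_tangentBundle_modelSpace F 𝓘(ℝ, F) (n := ∞)).comp_contMDiffOn
    ((hu.contMDiffOn_tangentMap hU).comp hX.contMDiffOn (fun q hq => hq))
  exact h

/-- By the product rule the right-hand side differs from the left only by second derivatives of `u`
on `V x` and `W x`, which cancel by symmetry. -/
theorem fderiv_lieBracket {u : E → F} {V W : E → E} {x : E} (hu : ContDiffAt ℝ 2 u x)
    (hV : DifferentiableAt ℝ V x) (hW : DifferentiableAt ℝ W x) :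
    fderiv ℝ u x (VectorField.lieBracket ℝ V W x) =
      fderiv ℝ (fun y => fderiv ℝ u y (W y)) x (V x)
        - fderiv ℝ (fun y => fderiv ℝ u y (V y)) x (W x) := by
  have h1 : DifferentiableAt ℝ (fderiv ℝ u) x :=
    (hu.fderiv_right (m := 1) (by norm_num)).differentiableAt one_ne_zero
  have h2 : IsSymmSndFDerivAt ℝ u x := hu.isSymmSndFDerivAt (by simp)
  rw [VectorField.lieBracket, fderiv_clm_apply h1 hW, fderiv_clm_apply h1 hV]
  simp [h2.eq (V x) (W x)]

/-- The identity in a vector space, transported by a chart at `p`. Vector values are allowed so that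
`u` can later be a whole coordinate map, which detects tangent vectors. -/
theorem mvfderiv_mlieBracket [I.Boundaryless] [CompleteSpace E] {u : M → F} {U : Set M}
    (hU : IsOpen U) (hu : ContMDiffOn I 𝓘(ℝ, F) ∞ u U) {X Y : ∀ q, TangentSpace I q}
    (hX : ContMDiff I I.tangent ∞ (fun q => (⟨q, X q⟩ : TangentBundle I M)))
    (hY : ContMDiff I I.tangent ∞ (fun q => (⟨q, Y q⟩ : TangentBundle I M))) {p : M} (hp : p ∈ U) :
    mvfderiv I u p (VectorField.mlieBracket I X Y p) =
      mvfderiv I (fun q => mvfderiv I u q (Y q)) p (X p)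
        - mvfderiv I (fun q => mvfderiv I u q (X q)) p (Y p) := by
  have i1 : IsManifold I 1 M := .of_le (n := ∞) (by simp)
  have i2 : IsManifold I 2 M := .of_le (n := ∞) two_le_infty
  set φ := extChartAt I p with hφ
  have hr : Set.range I = Set.univ := I.range_eq_univ
  have hpt : φ p ∈ φ.target := mem_extChartAt_target p
  have hinv : φ.symm (φ p) = p := extChartAt_to_inv p
  have htn : φ.target ∈ 𝓝 (φ p) := extChartAt_target_mem_nhds p
  have hsymm : ∀ y ∈ φ.target, MDifferentiableAt 𝓘(ℝ, E) I φ.symm y := fun y hy => by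
    have := mdifferentiableWithinAt_extChartAt_symm hy
    rwa [hr, mdifferentiableWithinAt_univ] at this
  have hdu : ∀ q ∈ U, MDifferentiableAt I 𝓘(ℝ, F) u q := fun q hq =>
    ((hu q hq).contMDiffAt (hU.mem_nhds hq)).mdifferentiableAt (by simp)
  have hchain : ∀ (w : M → F) (y : E), y ∈ φ.target → MDifferentiableAt I 𝓘(ℝ, F) w (φ.symm y) →
      ∀ ξ : E, fderiv ℝ (w ∘ φ.symm) y ξ =
        mvfderiv I w (φ.symm y) (mfderiv 𝓘(ℝ, E) I φ.symm y ξ) := fun w y hy hw ξ => by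
    rw [← mfderiv_eq_fderiv, mfderiv_comp y hw (hsymm y hy)]
    rfl
  let pull : (∀ q, TangentSpace I q) → E → E := fun Z =>
    VectorField.mpullbackWithin 𝓘(ℝ, E) I φ.symm Z (Set.range I)
  have hpull : ∀ Z y, y ∈ φ.target →
      mfderiv 𝓘(ℝ, E) I φ.symm y (pull Z y) = Z (φ.symm y) := fun Z y hy => by
    have := isInvertible_mfderivWithin_extChartAt_symm hy
    change mfderiv 𝓘(ℝ, E) I φ.symm y
      ((mfderivWithin 𝓘(ℝ, E) I φ.symm (Set.range I) y).inverse (Z (φ.symm y))) = _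
    rw [hr, mfderivWithin_univ] at *
    exact this.self_apply_inverse _
  have hpd : ∀ Z : (∀ q, TangentSpace I q),
      ContMDiff I I.tangent ∞ (fun q => (⟨q, Z q⟩ : TangentBundle I M)) →
      DifferentiableAt ℝ (pull Z) (φ p) := fun Z hZ => by
    have := MDifferentiableWithinAt.differentiableWithinAt_mpullbackWithin_vectorField (s := Set.univ)
      ((hZ p).mdifferentiableAt (by simp)).mdifferentiableWithinAt
    rw [Set.preimage_univ, Set.univ_inter] at this
    exact DifferentiableWithinAt.differentiableAt (E := E) (F := E) this (by rw [hr]; exact Filter.univ_mem)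
  have hUn : ∀ᶠ y in 𝓝 (φ p), y ∈ φ.target ∧ φ.symm y ∈ U := by
    refine Filter.Eventually.and htn
      ((continuousAt_extChartAt_symm p).preimage_mem_nhds ?_)
    rw [← hφ, hinv]
    exact hU.mem_nhds hp
  -- The coordinate form of `Z u` holds on a whole neighbourhood, so that it may be differentiated
  -- once more.
  have hev : ∀ Z : (∀ q, TangentSpace I q), (fun q => mvfderiv I u q (Z q)) ∘ φ.symm =ᶠ[𝓝 (φ p)]
      fun y => fderiv ℝ (u ∘ φ.symm) y (pull Z y) := fun Z => by
    filter_upwards [hUn] with y hy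
    rw [hchain u y hy.1 (hdu _ hy.2), hpull Z y hy.1]
    rfl
  have hsec : ∀ Z Z' : (∀ q, TangentSpace I q),
      ContMDiff I I.tangent ∞ (fun q => (⟨q, Z q⟩ : TangentBundle I M)) →
      mvfderiv I (fun q => mvfderiv I u q (Z q)) p (Z' p) =
        fderiv ℝ (fun y => fderiv ℝ (u ∘ φ.symm) y (pull Z y)) (φ p) (pull Z' (φ p)) := by
    intro Z Z' hZ
    have hd : MDifferentiableAt I 𝓘(ℝ, F) (fun q => mvfderiv I u q (Z q)) (φ.symm (φ p)) := by
      rw [hinv]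
      exact ((hu.mvfderiv_apply hU hZ p hp).contMDiffAt (hU.mem_nhds hp)).mdifferentiableAt
        (by simp)
    rw [← (hev Z).fderiv_eq, hchain _ _ hpt hd, hpull _ _ hpt, hinv]
  have hû : ContDiffAt ℝ 2 (u ∘ φ.symm) (φ p) := by
    have h1 : ContMDiffAt 𝓘(ℝ, E) I ∞ φ.symm (φ p) :=
      (contMDiffOn_extChartAt_symm p).contMDiffAt htn
    have h2 : ContMDiffAt I 𝓘(ℝ, F) ∞ u (φ.symm (φ p)) := by
      rw [hinv]
      exact (hu p hp).contMDiffAt (hU.mem_nhds hp)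
    exact (h2.comp _ h1).contDiffAt.of_le two_le_infty
  have hbr : VectorField.mlieBracket I X Y p =
      mfderiv 𝓘(ℝ, E) I φ.symm (φ p)
        (VectorField.lieBracket (E := E) ℝ (pull X) (pull Y) (φ p)) := by
    -- The manifold bracket carries the coordinate bracket back by the inverse of the derivative of
    -- the chart, which is the derivative of the inverse chart.
    have h4 : (mfderiv I 𝓘(ℝ, E) φ p).inverse =
        mfderivWithin 𝓘(ℝ, E) I φ.symm (Set.range I) (φ p) :=
      ContinuousLinearMap.inverse_eq
        (by
          have := mfderiv_extChartAt_comp_mfderivWithin_extChartAt_symm (I := I) hpt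
          rwa [hinv] at this)
        (by
          have := mfderivWithin_extChartAt_symm_comp_mfderiv_extChartAt (I := I) hpt
          rwa [hinv] at this)
    rw [← VectorField.mlieBracketWithin_univ, VectorField.mlieBracketWithin_apply, h4]
    simp only [pull, hr, mfderivWithin_univ, Set.preimage_univ, Set.univ_inter, φ]
    exact congrArg _ (congrFun VectorField.lieBracketWithin_univ _)
  have h3 := hchain u (φ p) hpt (by rw [hinv]; exact hdu p hp)
  rw [hsec X Y hX, hsec Y X hY, ← fderiv_lieBracket hû (hpd X hX) (hpd Y hY), h3, hbr, hinv]

/-- An equation in the total space avoids comparing the tangent spaces at `f x` and `g x`;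
identities of the tangent groupoid are derived in this form. -/
theorem tangentMap_congr {E' H' M' : Type*} [NormedAddCommGroup E'] [NormedSpace ℝ E']
    [TopologicalSpace H'] {I' : ModelWithCorners ℝ E' H'} [TopologicalSpace M']
    [ChartedSpace H' M'] {f g : M → M'} {ζ : TangentBundle I M} (h : f =ᶠ[𝓝 ζ.1] g) :
    tangentMap I I' f ζ = tangentMap I I' g ζ := by
  obtain ⟨x, ξ⟩ := ζ
  simp only [tangentMap, h.mfderiv_eq]
  exact congrArg (fun y => (⟨y, mfderiv I I' g x ξ⟩ : TotalSpace E' fun _ : M' => E')) h.eq_of_nhds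

theorem mvfderiv_apply_eq_tangentMap (f : M → F) (ζ : TangentBundle I M) :
    mvfderiv I f ζ.1 ζ.2 = (tangentMap I 𝓘(ℝ, F) f ζ).2 := rfl

theorem tangentMap_fixed_proj {r : M → M} {ζ : TangentBundle I M}
    (h : tangentMap I I r ζ = ζ) : r ζ.1 = ζ.1 :=
  congrArg TotalSpace.proj h

/-- If a map `r` fixes the tangent vector `ζ`, then the derivative of a function along `ζ` depends
only on the values of the function on the image of `r`. -/
theorem mvfderiv_eq_of_comp_eventuallyEq {g h : M → F} {r : M → M} {ζ : TangentBundle I M}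
    (hr : MDifferentiableAt I I r ζ.1) (hζ : tangentMap I I r ζ = ζ)
    (hg : MDifferentiableAt I 𝓘(ℝ, F) g ζ.1) (hh : MDifferentiableAt I 𝓘(ℝ, F) h ζ.1)
    (hgh : g ∘ r =ᶠ[𝓝 ζ.1] h ∘ r) : mvfderiv I g ζ.1 ζ.2 = mvfderiv I h ζ.1 ζ.2 := by
  have h0 := tangentMap_fixed_proj hζ
  have key : ∀ w : M → F, MDifferentiableAt I 𝓘(ℝ, F) w ζ.1 →
      tangentMap I 𝓘(ℝ, F) (w ∘ r) ζ = tangentMap I 𝓘(ℝ, F) w ζ := fun w hw => by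
    -- The chain rule for `w ∘ r`, in which `r` drops out because its derivative fixes `ζ`.
    rw [tangentMap_comp_at ζ (by rwa [h0]) hr, hζ]
  rw [mvfderiv_apply_eq_tangentMap, mvfderiv_apply_eq_tangentMap, ← key g hg, ← key h hh,
    tangentMap_congr hgh]

/-! ### Pushing forward brackets along the image of a map -/

section Along

variable {EP HP P : Type*} [NormedAddCommGroup EP] [NormedSpace ℝ EP] [TopologicalSpace HP]
  {IP : ModelWithCorners ℝ EP HP} [TopologicalSpace P] [ChartedSpace HP P] [IsManifold IP ∞ P]

theorem mvfderiv_comp_map {f : P → M} {w : M → F} {p : P}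
    (hw : MDifferentiableAt I 𝓘(ℝ, F) w (f p)) (hf : MDifferentiableAt IP I f p)
    (ξ : TangentSpace IP p) :
    mvfderiv IP (w ∘ f) p ξ = mvfderiv I w (f p) (mfderiv IP I f p ξ) :=
  mfderiv_comp_apply p hw hf ξ

/-- Along the image of `r` the chain rule turns Y(ψ ∘ f) into ∑ⱼ aⱼ · (Zⱼψ) ∘ f. Since Tr fixes `ζ`,
the derivative along `ζ` may be taken of this sum instead, and the product rule gives the two groups
of terms. -/
theorem mvfderiv_mvfderiv_along {n : ℕ} {f : P → M} {U : Set P} (hU : IsOpen U)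
    (hf : ContMDiffOn IP I ∞ f U) {W : Set M} (hW : IsOpen W) {ψ : M → F}
    (hψ : ContMDiffOn I 𝓘(ℝ, F) ∞ ψ W) {Y : ∀ q, TangentSpace IP q}
    (hY : ContMDiff IP IP.tangent ∞ (fun q => (⟨q, Y q⟩ : TangentBundle IP P)))
    (a : Fin n → C^∞⟮IP, P; ℝ⟯) (Z : Fin n → Cₛ^∞⟮I; E, (TangentSpace I : M → Type _)⟯)
    {r : P → P} {ζ : TangentBundle IP P} (hp : ζ.1 ∈ U) (hpW : f ζ.1 ∈ W)
    (hr : MDifferentiableAt IP IP r ζ.1) (hζ : tangentMap IP IP r ζ = ζ)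
    (hYZ : ∀ᶠ q in 𝓝 ζ.1, mfderiv IP I f (r q) (Y (r q)) = ∑ j, a j (r q) • Z j (f (r q))) :
    mvfderiv IP (fun q => mvfderiv IP (ψ ∘ f) q (Y q)) ζ.1 ζ.2 =
      ∑ j, mvfderiv IP (a j) ζ.1 ζ.2 • mvfderiv I ψ (f ζ.1) (Z j (f ζ.1)) +
      ∑ j, a j ζ.1 • mvfderiv I (fun x => mvfderiv I ψ x (Z j x)) (f ζ.1)
        (mfderiv IP I f ζ.1 ζ.2) := by
  have h0 := tangentMap_fixed_proj hζ
  have hU' : IsOpen (U ∩ f ⁻¹' W) := hf.continuousOn.isOpen_inter_preimage hU hW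
  have hp' : ζ.1 ∈ U ∩ f ⁻¹' W := ⟨hp, hpW⟩
  have hu : ContMDiffOn IP 𝓘(ℝ, F) ∞ (ψ ∘ f) (U ∩ f ⁻¹' W) :=
    hψ.comp (hf.mono Set.inter_subset_left) fun q hq => hq.2
  have hdf : MDifferentiableAt IP I f ζ.1 :=
    ((hf ζ.1 hp).contMDiffAt (hU.mem_nhds hp)).mdifferentiableAt (by simp)
  have hb : ∀ j, MDifferentiableAt I 𝓘(ℝ, F) (fun x => mvfderiv I ψ x (Z j x)) (f ζ.1) := fun j =>
    ((hψ.mvfderiv_apply hW (Z j).contMDiff _ hpW).contMDiffAt (hW.mem_nhds hpW)).mdifferentiableAt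
      (by simp)
  have ha : ∀ j, MDifferentiableAt IP 𝓘(ℝ, ℝ) (a j) ζ.1 := fun j =>
    (a j).contMDiff.mdifferentiable (by simp) _
  have hterm : ∀ j, MDifferentiableAt IP 𝓘(ℝ, F)
      (fun q => a j q • mvfderiv I ψ (f q) (Z j (f q))) ζ.1 := fun j =>
    (ha j).smul ((hb j).comp ζ.1 hdf)
  have hsum : ∀ s : Finset (Fin n), MDifferentiableAt IP 𝓘(ℝ, F)
      (fun q => ∑ j ∈ s, a j q • mvfderiv I ψ (f q) (Z j (f q))) ζ.1 ∧
      mvfderiv IP (fun q => ∑ j ∈ s, a j q • mvfderiv I ψ (f q) (Z j (f q))) ζ.1 ζ.2 =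
        ∑ j ∈ s, (mvfderiv IP (a j) ζ.1 ζ.2 • mvfderiv I ψ (f ζ.1) (Z j (f ζ.1)) +
          a j ζ.1 • mvfderiv I (fun x => mvfderiv I ψ x (Z j x)) (f ζ.1)
            (mfderiv IP I f ζ.1 ζ.2)) := by
    classical
    intro s
    induction s using Finset.induction_on with
    | empty => simpa using ⟨mdifferentiableAt_const, by rw [mvfderiv_const]; rfl⟩
    | insert j s hj ih =>
      simp only [Finset.sum_insert hj]
      refine ⟨(hterm j).add ih.1, ?_⟩
      have h1 := mvfderiv_add (hterm j) ih.1
      have h2 := mvfderiv_smul (ha j) ((hb j).comp ζ.1 hdf)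
      refine (congrArg (fun L : TangentSpace IP ζ.1 →L[ℝ] F => L ζ.2) h1).trans ?_
      refine congrArg₂ (· + ·) ?_ ih.2
      refine (congrArg (fun L : TangentSpace IP ζ.1 →L[ℝ] F => L ζ.2) h2).trans ?_
      exact (add_comm _ _).trans (congrArg₂ (· + ·) rfl
        (congrArg (a j ζ.1 • ·) (mvfderiv_comp_map (hb j) hdf ζ.2)))
  -- The two functions are compared only after composition with `r`: elsewhere nothing is known
  -- about Tf(Y).
  have hev : (fun q => mvfderiv IP (ψ ∘ f) q (Y q)) ∘ r =ᶠ[𝓝 ζ.1]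
      (fun q => ∑ j, a j q • mvfderiv I ψ (f q) (Z j (f q))) ∘ r := by
    have : ∀ᶠ q in 𝓝 ζ.1, r q ∈ U ∩ f ⁻¹' W :=
      hr.continuousAt.preimage_mem_nhds (by rw [h0]; exact hU'.mem_nhds hp')
    filter_upwards [this, hYZ] with q hq hq'
    have h1 : MDifferentiableAt I 𝓘(ℝ, F) ψ (f (r q)) :=
      ((hψ _ hq.2).contMDiffAt (hW.mem_nhds hq.2)).mdifferentiableAt (by simp)
    have h2 : MDifferentiableAt IP I f (r q) :=
      ((hf _ hq.1).contMDiffAt (hU.mem_nhds hq.1)).mdifferentiableAt (by simp)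
    simp only [Function.comp_apply]
    rw [mvfderiv_comp_map h1 h2, hq', map_sum]
    simp only [map_smul]
  rw [mvfderiv_eq_of_comp_eventuallyEq hr hζ ?_ (hsum Finset.univ).1 hev, (hsum Finset.univ).2,
    Finset.sum_add_distrib]
  exact ((hu.mvfderiv_apply hU' hY _ hp').contMDiffAt (hU'.mem_nhds hp')).mdifferentiableAt
      (by simp)

theorem sum_smul_sub_sum_smul {n m : ℕ} (s : Fin n → ℝ) (t : Fin m → ℝ) (B : Fin n → Fin m → F)
    (A : Fin n → Fin m → F) :
    ∑ i, ∑ j, (s i * t j) • (A i j - B i j) =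
      ∑ j, t j • ∑ i, s i • A i j - ∑ i, s i • ∑ j, t j • B i j := by
  simp only [smul_sub, Finset.sum_sub_distrib, Finset.smul_sum, mul_smul]
  refine congrArg₂ (· - ·) ?_ rfl
  rw [Finset.sum_comm]
  exact Finset.sum_congr rfl fun j _ => Finset.sum_congr rfl fun i _ => smul_comm _ _ _

theorem add_sub_add_comm_rearrange (a b c d : F) : a + b - (c + d) = b - d + a - c := by
  abel

/-- If the vector fields `X` and `Y` are tangent at `p` to the image of a map `r`, and along that
image `f` maps them to the formal sums `σ` and `τ`, then `f` maps `[X, Y]` to the bracket of `σ` and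
`τ` at `p`. -/
theorem mfderiv_mlieBracket_along [IP.Boundaryless] [CompleteSpace EP] [I.Boundaryless]
    [FiniteDimensional ℝ E] {f : P → M} {U : Set P} (hU : IsOpen U)
    (hf : ContMDiffOn IP I ∞ f U) {X Y : ∀ q, TangentSpace IP q}
    (hX : ContMDiff IP IP.tangent ∞ (fun q => (⟨q, X q⟩ : TangentBundle IP P)))
    (hY : ContMDiff IP IP.tangent ∞ (fun q => (⟨q, Y q⟩ : TangentBundle IP P)))
    (σ τ : FormalSection IP P I E (TangentSpace I : M → Type _)) {r : P → P} {p : P} (hp : p ∈ U)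
    (hr : MDifferentiableAt IP IP r p) (hrX : tangentMap IP IP r ⟨p, X p⟩ = ⟨p, X p⟩)
    (hrY : tangentMap IP IP r ⟨p, Y p⟩ = ⟨p, Y p⟩)
    (hσ : ∀ᶠ q in 𝓝 p, mfderiv IP I f (r q) (X (r q)) = σ.eval (r q) (f (r q)))
    (hτ : ∀ᶠ q in 𝓝 p, mfderiv IP I f (r q) (Y (r q)) = τ.eval (r q) (f (r q))) :
    mfderiv IP I f p (VectorField.mlieBracket IP X Y p) = σ.bracketAt τ p (X p) (Y p) (f p) := by
  have := FiniteDimensional.complete ℝ E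
  have i1 : IsManifold I 1 M := .of_le (n := ∞) (by simp)
  have h0 : r p = p := tangentMap_fixed_proj hrX
  set ψ := extChartAt I (f p) with hψdef
  have hW : IsOpen (chartAt H (f p)).source := (chartAt H (f p)).open_source
  have hψ : ContMDiffOn I 𝓘(ℝ, E) ∞ ψ (chartAt H (f p)).source := contMDiffOn_extChartAt
  have hpW : f p ∈ (chartAt H (f p)).source := mem_chart_source H (f p)
  have hU' : IsOpen (U ∩ f ⁻¹' (chartAt H (f p)).source) :=
    hf.continuousOn.isOpen_inter_preimage hU hW
  have hu : ContMDiffOn IP 𝓘(ℝ, E) ∞ (ψ ∘ f) (U ∩ f ⁻¹' (chartAt H (f p)).source) :=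
    hψ.comp (hf.mono Set.inter_subset_left) fun q hq => hq.2
  have hdf : MDifferentiableAt IP I f p :=
    ((hf p hp).contMDiffAt (hU.mem_nhds hp)).mdifferentiableAt (by simp)
  have hdψ : MDifferentiableAt I 𝓘(ℝ, E) ψ (f p) := mdifferentiableAt_extChartAt hpW
  -- The coordinate map ψ has injective derivative at `f p`, so it suffices to compare derivatives
  -- of ψ.
  have hinj : Function.Injective (mvfderiv I ψ (f p)) :=
    (isInvertible_mfderiv_extChartAt (mem_extChartAt_source (I := I) (f p))).injective
  have hself : ∀ {Z : ∀ q, TangentSpace IP q} {κ : FormalSection IP P I E (TangentSpace I)},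
      (∀ᶠ q in 𝓝 p, mfderiv IP I f (r q) (Z (r q)) = κ.eval (r q) (f (r q))) →
      mfderiv IP I f p (Z p) = ∑ j, κ.coeff j p • κ.sec j (f p) := fun {Z κ} h => by
    have h1 := h.self_of_nhds
    rw [h0] at h1
    exact h1
  apply hinj
  -- The left side becomes X(Y(ψ ∘ f)) - Y(X(ψ ∘ f)) at `p`. In its expansion, derivatives of
  -- coefficients give the two single sums of `bracketAt`, and second derivatives of ψ combine to
  -- the brackets of the sections.
  rw [← mvfderiv_comp_map hdψ hdf, mvfderiv_mlieBracket hU' hu hX hY ⟨hp, hpW⟩]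
  have hA := mvfderiv_mvfderiv_along hU hf hW hψ hY τ.coeff τ.sec (ζ := ⟨p, X p⟩) hp hpW hr hrX hτ
  have hB := mvfderiv_mvfderiv_along hU hf hW hψ hX σ.coeff σ.sec (ζ := ⟨p, Y p⟩) hp hpW hr hrY hσ
  have hbr : ∀ i j, mvfderiv I ψ (f p)
      ((⁅σ.sec i, τ.sec j⁆ : Cₛ^∞⟮I; E, (TangentSpace I : M → Type _)⟯) (f p)) =
      mvfderiv I (fun x => mvfderiv I ψ x (τ.sec j x)) (f p) (σ.sec i (f p)) -
      mvfderiv I (fun x => mvfderiv I ψ x (σ.sec i x)) (f p) (τ.sec j (f p)) := fun i j =>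
    mvfderiv_mlieBracket hW hψ (σ.sec i).contMDiff (τ.sec j).contMDiff hpW
  refine (congrArg₂ (· - ·) hA hB).trans ?_
  have hL : ∀ {n : ℕ} (c : Fin n → ℝ) (v : Fin n → TangentSpace I (f p)),
      mvfderiv I ψ (f p) (∑ i, c i • v i) = ∑ i, c i • mvfderiv I ψ (f p) (v i) := fun c v => by
    rw [map_sum]
    exact Finset.sum_congr rfl fun i _ => map_smul _ _ _
  have hL' : ∀ (L : TangentSpace I (f p) →L[ℝ] E) {n : ℕ} (c : Fin n → ℝ)
      (v : Fin n → TangentSpace I (f p)), L (∑ i, c i • v i) = ∑ i, c i • L (v i) := fun L n c v => by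
    rw [map_sum]
    exact Finset.sum_congr rfl fun i _ => map_smul _ _ _
  have hR : mvfderiv I ψ (f p) (∑ i, ∑ j, (σ.coeff i p * τ.coeff j p) •
      (⁅σ.sec i, τ.sec j⁆ : Cₛ^∞⟮I; E, (TangentSpace I : M → Type _)⟯) (f p)) =
      ∑ j, τ.coeff j p • mvfderiv I (fun x => mvfderiv I ψ x (τ.sec j x)) (f p)
        (mfderiv IP I f p (X p)) -
      ∑ i, σ.coeff i p • mvfderiv I (fun x => mvfderiv I ψ x (σ.sec i x)) (f p)
        (mfderiv IP I f p (Y p)) := by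
    rw [hself hσ, hself hτ, map_sum]
    simp only [hL]
    simp only [hL', hbr]
    exact sum_smul_sub_sum_smul _ _ _ _
  rw [FormalSection.bracketAt, map_sub, map_add, hR, hL, hL]
  exact add_sub_add_comm_rearrange _ _ _ _

end Along

end

/-! ### Local lifts and tangent maps of submersions -/

section Submersion
variable {E E' : Type*} [NormedAddCommGroup E] [NormedSpace ℝ E] [NormedAddCommGroup E']
  [NormedSpace ℝ E'] {N M : Type*} [TopologicalSpace N] [ChartedSpace E N]
  [TopologicalSpace M] [ChartedSpace E' M] [IsManifold 𝓘(ℝ, E) ∞ N] [IsManifold 𝓘(ℝ, E') ∞ M]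

/-- Near a point, a submersion `s` admits smooth lifts: there is a smooth map `ρ` with
`s (ρ (y, x)) = x` and `ρ (y, s y) = y`. -/
theorem Manifold.IsSubmersion.exists_lift {s : N → M} (hs : IsSubmersion 𝓘(ℝ, E) 𝓘(ℝ, E') ∞ s)
    (y₀ : N) :
    ∃ (U : Set (N × M)) (ρ : N × M → N), IsOpen U ∧ (y₀, s y₀) ∈ U ∧
      ContMDiffOn (𝓘(ℝ, E).prod 𝓘(ℝ, E')) 𝓘(ℝ, E) ∞ ρ U ∧
      (∀ q ∈ U, s (ρ q) = q.2) ∧ ∀ y, (y, s y) ∈ U → ρ (y, s y) = y := by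
  obtain ⟨F, _, _, hF⟩ := hs
  have h : IsSubmersionAtOfComplement F 𝓘(ℝ, E) 𝓘(ℝ, E') ∞ s y₀ := hF y₀
  set φ := h.domChart
  set ψ := h.codChart
  set e := h.equiv
  have hw : ∀ z ∈ φ.target, ψ (s (φ.symm z)) = (e z).1 := fun z hz => by
    have := h.writtenInCharts (show z ∈ (φ.extend 𝓘(ℝ, E)).target by simpa using hz)
    simpa using this
  have hms : ∀ y ∈ φ.source, s y ∈ ψ.source := h.source_subset_preimage_source
  have hφ : ContMDiffOn 𝓘(ℝ, E) 𝓘(ℝ, E) ∞ φ φ.source :=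
    contMDiffOn_of_mem_maximalAtlas h.domChart_mem_maximalAtlas
  have hφ' : ContMDiffOn 𝓘(ℝ, E) 𝓘(ℝ, E) ∞ φ.symm φ.target :=
    contMDiffOn_symm_of_mem_maximalAtlas h.domChart_mem_maximalAtlas
  have hψ : ContMDiffOn 𝓘(ℝ, E') 𝓘(ℝ, E') ∞ ψ ψ.source :=
    contMDiffOn_of_mem_maximalAtlas h.codChart_mem_maximalAtlas
  -- In the charts, `s` is the projection to the first factor. The lift keeps the fibre coordinate
  -- of `y` and replaces its base coordinate by that of `x`; at `x = s y` nothing changes.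
  let z : N × M → E := fun q => e.symm (ψ q.2, (e (φ q.1)).2)
  have hz : ContMDiffOn (𝓘(ℝ, E).prod 𝓘(ℝ, E')) 𝓘(ℝ, E) ∞ z (φ.source ×ˢ ψ.source) := by
    have h1 : ContMDiffOn (𝓘(ℝ, E).prod 𝓘(ℝ, E')) 𝓘(ℝ, E) ∞ (fun q : N × M => φ q.1)
        (φ.source ×ˢ ψ.source) := hφ.comp contMDiffOn_fst fun q hq => hq.1
    have h2 : ContMDiffOn (𝓘(ℝ, E).prod 𝓘(ℝ, E')) 𝓘(ℝ, E') ∞ (fun q : N × M => ψ q.2)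
        (φ.source ×ˢ ψ.source) := hψ.comp contMDiffOn_snd fun q hq => hq.2
    have h3 : ContMDiff 𝓘(ℝ, E) 𝓘(ℝ, F) ∞ (fun x : E => (e x).2) :=
      (contDiff_snd.comp e.contDiff).contMDiff
    exact e.symm.contDiff.contMDiff.comp_contMDiffOn
      (h2.prodMk_space (h3.comp_contMDiffOn h1))
  have hzs : ∀ y ∈ φ.source, z (y, s y) = φ y := fun y hy => by
    have h1 := hw (φ y) (φ.map_source hy)
    rw [φ.left_inv hy] at h1
    change e.symm (ψ (s y), (e (φ y)).2) = φ y
    rw [h1, Prod.mk.eta, e.symm_apply_apply]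
  have hy₀ : y₀ ∈ φ.source := h.mem_domChart_source
  refine ⟨(φ.source ×ˢ ψ.source) ∩ z ⁻¹' φ.target, fun q => φ.symm (z q),
    hz.continuousOn.isOpen_inter_preimage (φ.open_source.prod ψ.open_source) φ.open_target,
    ⟨⟨hy₀, hms _ hy₀⟩, ?_⟩, hφ'.comp (hz.mono Set.inter_subset_left) fun q hq => hq.2, ?_, ?_⟩
  · rw [Set.mem_preimage, hzs _ hy₀]
    exact φ.map_source hy₀
  · intro q hq
    refine ψ.injOn (hms _ (φ.map_target hq.2)) hq.1.2 ?_
    rw [hw _ hq.2, e.apply_symm_apply]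
  · intro y hy
    change φ.symm (z (y, s y)) = y
    rw [hzs _ hy.1.1, φ.left_inv hy.1.1]

theorem contMDiffOn_tangentMap_chart {φ : OpenPartialHomeomorph N E}
    (hφ : φ ∈ IsManifold.maximalAtlas 𝓘(ℝ, E) ∞ N) :
    ContMDiffOn (M' := ModelProd E E) 𝓘(ℝ, E).tangent (𝓘(ℝ, E).prod 𝓘(ℝ, E)) ∞
      (fun v : TangentBundle 𝓘(ℝ, E) N => (φ v.1, mfderiv 𝓘(ℝ, E) 𝓘(ℝ, E) φ v.1 v.2))
      (TotalSpace.proj ⁻¹' φ.source) :=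
  contMDiff_tangentBundleModelSpaceHomeomorph.comp_contMDiffOn
    ((contMDiffOn_of_mem_maximalAtlas hφ).contMDiffOn_tangentMap φ.open_source)

theorem contMDiffOn_tangentMap_chart_symm {φ : OpenPartialHomeomorph N E}
    (hφ : φ ∈ IsManifold.maximalAtlas 𝓘(ℝ, E) ∞ N) :
    ContMDiffOn (𝓘(ℝ, E).prod 𝓘(ℝ, E)) 𝓘(ℝ, E).tangent ∞
      (fun p : ModelProd E E => (⟨φ.symm p.1, mfderiv 𝓘(ℝ, E) 𝓘(ℝ, E) φ.symm p.1 p.2⟩ :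
        TangentBundle 𝓘(ℝ, E) N))
      (Prod.fst ⁻¹' φ.target) :=
  ((contMDiffOn_symm_of_mem_maximalAtlas hφ).contMDiffOn_tangentMap φ.open_target).comp
    contMDiff_tangentBundleModelSpaceHomeomorph_symm.contMDiffOn fun _ hp => hp

theorem mdifferentiable_of_mem_maximalAtlas {φ : OpenPartialHomeomorph N E}
    (hφ : φ ∈ IsManifold.maximalAtlas 𝓘(ℝ, E) ∞ N) : φ.MDifferentiable 𝓘(ℝ, E) 𝓘(ℝ, E) :=
  ⟨(contMDiffOn_of_mem_maximalAtlas hφ).mdifferentiableOn (by simp),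
    (contMDiffOn_symm_of_mem_maximalAtlas hφ).mdifferentiableOn (by simp)⟩

/-- The chart of the tangent bundle induced by a chart of a manifold. -/
def tangentChart (φ : OpenPartialHomeomorph N E)
    (hφ : φ ∈ IsManifold.maximalAtlas 𝓘(ℝ, E) ∞ N) :
    OpenPartialHomeomorph (TangentBundle 𝓘(ℝ, E) N) (ModelProd E E) where
  toFun v := (φ v.1, mfderiv 𝓘(ℝ, E) 𝓘(ℝ, E) φ v.1 v.2)
  invFun p := ⟨φ.symm p.1, mfderiv 𝓘(ℝ, E) 𝓘(ℝ, E) φ.symm p.1 p.2⟩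
  source := TotalSpace.proj ⁻¹' φ.source
  target := Prod.fst ⁻¹' φ.target
  map_source' v hv := φ.map_source hv
  map_target' p hp := φ.map_target hp
  left_inv' v hv := by
    have h := (mdifferentiable_of_mem_maximalAtlas hφ).symm_comp_deriv hv
    have h' := congrArg (fun L : TangentSpace 𝓘(ℝ, E) v.1 →L[ℝ] E => L v.2) h
    change (⟨_, _⟩ : TangentBundle 𝓘(ℝ, E) N) = ⟨v.1, v.2⟩
    refine congrArg₂ (fun (x : N) (ξ : E) => (⟨x, ξ⟩ : TangentBundle 𝓘(ℝ, E) N)) (φ.left_inv hv) h'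
  right_inv' p hp := by
    have h := (mdifferentiable_of_mem_maximalAtlas hφ).comp_symm_deriv hp
    have h' := congrArg (fun L : TangentSpace 𝓘(ℝ, E) p.1 →L[ℝ] E => L p.2) h
    exact Prod.ext (φ.right_inv hp) h'
  open_source := φ.open_source.preimage (FiberBundle.continuous_proj E _)
  open_target := φ.open_target.preimage continuous_fst
  continuousOn_toFun := (contMDiffOn_tangentMap_chart hφ).continuousOn
  continuousOn_invFun := (contMDiffOn_tangentMap_chart_symm hφ).continuousOn

/-- Submersions are defined by a normal form in charts of the maximal atlas, so the tangent map
needs charts of this kind on the tangent bundle. -/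
theorem tangentChart_mem_maximalAtlas (φ : OpenPartialHomeomorph N E)
    (hφ : φ ∈ IsManifold.maximalAtlas 𝓘(ℝ, E) ∞ N) :
    tangentChart φ hφ ∈ IsManifold.maximalAtlas 𝓘(ℝ, E).tangent ∞ (TangentBundle 𝓘(ℝ, E) N) :=
  OpenPartialHomeomorph.mem_maximalAtlas_of_contMDiffOn _ (contMDiffOn_tangentMap_chart hφ)
    (contMDiffOn_tangentMap_chart_symm hφ)

/-- The derivative of a linear projection is that projection. In tangent charts, Ts is therefore two
copies of the local form of `s`, one on points and one on vectors. Regrouping the four factors as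
(E' × E') × (F × F) exhibits it as a projection with complement F × F. -/
theorem Manifold.IsSubmersion.tangentMap {s : N → M}
    (hs : IsSubmersion 𝓘(ℝ, E) 𝓘(ℝ, E') ∞ s) :
    IsSubmersion 𝓘(ℝ, E).tangent 𝓘(ℝ, E').tangent ∞ (tangentMap 𝓘(ℝ, E) 𝓘(ℝ, E') s) := by
  have hc := hs.contMDiff
  obtain ⟨F, _, _, hF⟩ := hs
  refine IsSubmersionOfComplement.isSubmersion (F := F × F) fun v => ?_
  have h : IsSubmersionAtOfComplement F 𝓘(ℝ, E) 𝓘(ℝ, E') ∞ s v.1 := hF v.1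
  set φ := h.domChart
  set ψ := h.codChart
  set e := h.equiv
  have hφ := h.domChart_mem_maximalAtlas
  have hψ := h.codChart_mem_maximalAtlas
  have hw : ∀ z ∈ φ.target, ψ (s (φ.symm z)) = (e z).1 := fun z hz => by
    have := h.writtenInCharts (show z ∈ (φ.extend 𝓘(ℝ, E)).target by simpa using hz)
    simpa using this
  have hms : ∀ y ∈ φ.source, s y ∈ ψ.source := h.source_subset_preimage_source
  have hsd : MDifferentiable 𝓘(ℝ, E) 𝓘(ℝ, E') s := hc.mdifferentiable (by simp)
  refine IsSubmersionAtOfComplement.mk_of_charts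
    ((e.prodCongr e).trans (ContinuousLinearEquiv.prodProdProdComm ℝ E' F E' F))
    (tangentChart φ hφ) (tangentChart ψ hψ) h.mem_domChart_source h.mem_codChart_source
    (tangentChart_mem_maximalAtlas φ hφ) (tangentChart_mem_maximalAtlas ψ hψ)
    (fun w hw => hms _ hw) ?_
  intro p hp
  have hp1 : p.1 ∈ φ.target := by
    have : p ∈ ((tangentChart φ hφ).extend 𝓘(ℝ, E).tangent).target := hp
    rw [OpenPartialHomeomorph.extend_target] at this
    exact this.1
  have hd : mfderiv 𝓘(ℝ, E') 𝓘(ℝ, E') ψ (s (φ.symm p.1))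
      (mfderiv 𝓘(ℝ, E) 𝓘(ℝ, E') s (φ.symm p.1) (mfderiv 𝓘(ℝ, E) 𝓘(ℝ, E) φ.symm p.1 p.2)) =
      (e p.2).1 := by
    have h1 := (mdifferentiable_of_mem_maximalAtlas hφ).mdifferentiableAt_symm hp1
    have h2 := (mdifferentiable_of_mem_maximalAtlas hψ).mdifferentiableAt
      (hms _ (φ.map_target hp1))
    have h5 := mfderiv_comp_apply p.1 h2 ((hsd _).comp _ h1) p.2
    have h6 := mfderiv_comp_apply p.1 (hsd _) h1 p.2
    refine ((congrArg _ h6.symm).trans h5.symm).trans ?_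
    -- Near the point, the coordinate expression of `s` is the linear map z ↦ (e z).1, so its
    -- derivative can be read off.
    have h3 : ψ ∘ s ∘ φ.symm =ᶠ[𝓝 p.1] fun z => (e z).1 := by
      filter_upwards [φ.open_target.mem_nhds hp1] with z hz using hw z hz
    have h4 : HasFDerivAt (fun z => (e z).1)
      ((ContinuousLinearMap.fst ℝ E' F).comp (e : E →L[ℝ] E' × F)) p.1 :=
      ((ContinuousLinearMap.fst ℝ E' F).comp (e : E →L[ℝ] E' × F)).hasFDerivAt
    have h7 : mfderiv 𝓘(ℝ, E) 𝓘(ℝ, E') (ψ ∘ s ∘ φ.symm) p.1 = _ :=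
      (h3.mfderiv_eq.trans mfderiv_eq_fderiv).trans h4.fderiv
    exact congrArg (fun L : E →L[ℝ] E' => L p.2) h7
  exact Prod.ext (hw p.1 hp1) hd

end Submersion

/-! ### The tangent groupoid -/

section TangentMap
variable {EP HP P E H N E' H' M : Type*} [NormedAddCommGroup EP] [NormedSpace ℝ EP]
  [TopologicalSpace HP] {IP : ModelWithCorners ℝ EP HP} [TopologicalSpace P] [ChartedSpace HP P]
  [NormedAddCommGroup E] [NormedSpace ℝ E] [TopologicalSpace H] {I : ModelWithCorners ℝ E H}
  [TopologicalSpace N] [ChartedSpace H N] [NormedAddCommGroup E'] [NormedSpace ℝ E']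
  [TopologicalSpace H'] {J : ModelWithCorners ℝ E' H'} [TopologicalSpace M] [ChartedSpace H' M]

theorem tangentMap_prodMk {f : P → N} {k : P → M} {ζ : TangentBundle IP P}
    (hf : MDifferentiableAt IP I f ζ.1) (hk : MDifferentiableAt IP J k ζ.1) :
    tangentMap IP (I.prod J) (fun q => (f q, k q)) ζ =
      (equivTangentBundleProd I N J M).symm (tangentMap IP I f ζ, tangentMap IP J k ζ) := by
  simp only [tangentMap, mfderiv_prodMk hf hk]
  rfl

end TangentMap

namespace LieGroupoid

variable {EG EM G M : Type*} [NormedAddCommGroup EG] [NormedSpace ℝ EG]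
  [NormedAddCommGroup EM] [NormedSpace ℝ EM]
  [TopologicalSpace G] [ChartedSpace EG G] [TopologicalSpace M] [ChartedSpace EM M]
  (𝒢 : LieGroupoid 𝓘(ℝ, EG) 𝓘(ℝ, EM) G M)
  {EP HP P : Type*} [NormedAddCommGroup EP] [NormedSpace ℝ EP] [TopologicalSpace HP]
  {IP : ModelWithCorners ℝ EP HP} [TopologicalSpace P] [ChartedSpace HP P]

/-- The source map of the tangent groupoid. -/
abbrev tsrc : TangentBundle 𝓘(ℝ, EG) G → TangentBundle 𝓘(ℝ, EM) M :=
  tangentMap 𝓘(ℝ, EG) 𝓘(ℝ, EM) 𝒢.src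

/-- The target map of the tangent groupoid. -/
abbrev ttgt : TangentBundle 𝓘(ℝ, EG) G → TangentBundle 𝓘(ℝ, EM) M :=
  tangentMap 𝓘(ℝ, EG) 𝓘(ℝ, EM) 𝒢.tgt

/-- The unit map of the tangent groupoid. -/
abbrev tone : TangentBundle 𝓘(ℝ, EM) M → TangentBundle 𝓘(ℝ, EG) G :=
  tangentMap 𝓘(ℝ, EM) 𝓘(ℝ, EG) 𝒢.one

/-- The inversion of the tangent groupoid. -/
abbrev tinv : TangentBundle 𝓘(ℝ, EG) G → TangentBundle 𝓘(ℝ, EG) G :=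
  tangentMap 𝓘(ℝ, EG) 𝓘(ℝ, EG) 𝒢.inv

/-- The multiplication of the tangent groupoid. -/
def tmul (v w : TangentBundle 𝓘(ℝ, EG) G) : TangentBundle 𝓘(ℝ, EG) G :=
  ⟨𝒢.mul v.1 w.1, 𝒢.tangentMul v.1 w.1 (v.2, w.2)⟩

theorem mdifferentiable_src : MDifferentiable 𝓘(ℝ, EG) 𝓘(ℝ, EM) 𝒢.src :=
  𝒢.isSubmersion_src.contMDiff.mdifferentiable (by simp)

theorem mdifferentiable_tgt : MDifferentiable 𝓘(ℝ, EG) 𝓘(ℝ, EM) 𝒢.tgt :=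
  𝒢.isSubmersion_tgt.contMDiff.mdifferentiable (by simp)

theorem mdifferentiable_one : MDifferentiable 𝓘(ℝ, EM) 𝓘(ℝ, EG) 𝒢.one :=
  𝒢.contMDiff_one.mdifferentiable (by simp)

theorem mdifferentiable_inv : MDifferentiable 𝓘(ℝ, EG) 𝓘(ℝ, EG) 𝒢.inv :=
  𝒢.contMDiff_inv.mdifferentiable (by simp)

/-- A derivative within the set of composable pairs need not be unique, but composing any choice of
it with a map into that set gives an honest derivative. This chain rule is the only access to
`tangentMul` that is needed. -/
theorem hasMFDerivAt_mul {f k : P → G} {p : P} (hf : MDifferentiableAt IP 𝓘(ℝ, EG) f p)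
    (hk : MDifferentiableAt IP 𝓘(ℝ, EG) k p) (hfk : ∀ᶠ q in 𝓝 p, 𝒢.src (f q) = 𝒢.tgt (k q)) :
    HasMFDerivAt IP 𝓘(ℝ, EG) (fun q => 𝒢.mul (f q) (k q)) p
      ((𝒢.tangentMul (f p) (k p)).comp
        ((mfderiv IP 𝓘(ℝ, EG) f p).prod (mfderiv IP 𝓘(ℝ, EG) k p))) := by
  have hm : HasMFDerivWithinAt (𝓘(ℝ, EG).prod 𝓘(ℝ, EG)) 𝓘(ℝ, EG)
      (fun q : G × G => 𝒢.mul q.1 q.2) {q | 𝒢.src q.1 = 𝒢.tgt q.2} (f p, k p)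
      (𝒢.tangentMul (f p) (k p)) :=
    (𝒢.contMDiffOn_mul.mdifferentiableOn (by simp) (f p, k p) hfk.self_of_nhds).hasMFDerivWithinAt
  have hp := (hf.hasMFDerivAt.prodMk hk.hasMFDerivAt).hasMFDerivWithinAt
    (s := {q | 𝒢.src (f q) = 𝒢.tgt (k q)})
  have hc := HasMFDerivWithinAt.comp (u := {q : G × G | 𝒢.src q.1 = 𝒢.tgt q.2})
    (f := fun q => (f q, k q)) p hm hp fun q hq => hq
  exact hc.hasMFDerivAt hfk

theorem tangentMap_mul {f k : P → G} {ζ : TangentBundle IP P}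
    (hf : MDifferentiableAt IP 𝓘(ℝ, EG) f ζ.1) (hk : MDifferentiableAt IP 𝓘(ℝ, EG) k ζ.1)
    (hfk : ∀ᶠ q in 𝓝 ζ.1, 𝒢.src (f q) = 𝒢.tgt (k q)) :
    tangentMap IP 𝓘(ℝ, EG) (fun q => 𝒢.mul (f q) (k q)) ζ =
      𝒢.tmul (tangentMap IP 𝓘(ℝ, EG) f ζ) (tangentMap IP 𝓘(ℝ, EG) k ζ) := by
  simp only [tangentMap, (𝒢.hasMFDerivAt_mul hf hk hfk).mfderiv]
  rfl

variable [IsManifold 𝓘(ℝ, EG) ∞ G] [IsManifold 𝓘(ℝ, EM) ∞ M]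

/-- Near a composable pair, there is a smooth map `ρ` such that `(ρ (g, h), h)` is composable, and
whose derivative fixes the first component of composable pairs of tangent vectors. -/
theorem exists_retraction {g h : G} (hgh : 𝒢.src g = 𝒢.tgt h) :
    ∃ (U : Set (G × G)) (ρ : G × G → G), IsOpen U ∧ (g, h) ∈ U ∧
      ContMDiffOn (𝓘(ℝ, EG).prod 𝓘(ℝ, EG)) 𝓘(ℝ, EG) ∞ ρ U ∧
      (∀ q ∈ U, 𝒢.src (ρ q) = 𝒢.tgt q.2) ∧
      ∀ ζ : TangentBundle (𝓘(ℝ, EG).prod 𝓘(ℝ, EG)) (G × G), ζ.1 ∈ U →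
        𝒢.tsrc (equivTangentBundleProd _ _ _ _ ζ).1 = 𝒢.ttgt (equivTangentBundleProd _ _ _ _ ζ).2 →
        tangentMap (𝓘(ℝ, EG).prod 𝓘(ℝ, EG)) 𝓘(ℝ, EG) ρ ζ =
          (equivTangentBundleProd _ _ _ _ ζ).1 := by
  obtain ⟨U, ρ, hU, hgU, hρ, h1, h2⟩ := 𝒢.isSubmersion_src.exists_lift g
  have hκ : ContMDiff (𝓘(ℝ, EG).prod 𝓘(ℝ, EG)) (𝓘(ℝ, EG).prod 𝓘(ℝ, EM)) ∞
      (fun q : G × G => (q.1, 𝒢.tgt q.2)) :=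
    contMDiff_fst.prodMk (𝒢.isSubmersion_tgt.contMDiff.comp contMDiff_snd)
  refine ⟨(fun q : G × G => (q.1, 𝒢.tgt q.2)) ⁻¹' U, fun q => ρ (q.1, 𝒢.tgt q.2),
    hU.preimage hκ.continuous, by simpa [hgh] using hgU, hρ.comp hκ.contMDiffOn fun q hq => hq,
    fun q hq => h1 _ hq, fun ζ hζ hc => ?_⟩
  have hb : 𝒢.src ζ.1.1 = 𝒢.tgt ζ.1.2 := congrArg TotalSpace.proj hc
  have hfst : MDifferentiableAt (𝓘(ℝ, EG).prod 𝓘(ℝ, EG)) 𝓘(ℝ, EG) (Prod.fst : G × G → G) ζ.1 :=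
    mdifferentiableAt_fst
  have hsnd : MDifferentiableAt (𝓘(ℝ, EG).prod 𝓘(ℝ, EG)) 𝓘(ℝ, EG) (Prod.snd : G × G → G) ζ.1 :=
    mdifferentiableAt_snd
  have hs := (𝒢.mdifferentiable_src _).comp ζ.1 hfst
  have ht := (𝒢.mdifferentiable_tgt _).comp ζ.1 hsnd
  -- On a composable pair (a, b), the maps (g, h) ↦ (g, t(h)) and (g, h) ↦ (g, s(g)) have the same
  -- derivative (a, Tt b) = (a, Ts a). After the second map, the lift returns `g`.
  have hpair : tangentMap _ (𝓘(ℝ, EG).prod 𝓘(ℝ, EM)) (fun q : G × G => (q.1, 𝒢.tgt q.2)) ζ =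
      tangentMap _ (𝓘(ℝ, EG).prod 𝓘(ℝ, EM)) (fun q : G × G => (q.1, 𝒢.src q.1)) ζ := by
    refine (tangentMap_prodMk hfst ht).trans (Eq.trans ?_ (tangentMap_prodMk hfst hs).symm)
    rw [tangentMap_comp_at ζ (𝒢.mdifferentiable_tgt _) hsnd,
      tangentMap_comp_at ζ (𝒢.mdifferentiable_src _) hfst, tangentMap_prodFst, tangentMap_prodSnd]
    exact congrArg _ (congrArg _ hc.symm)
  have hbU : (ζ.1.1, 𝒢.src ζ.1.1) ∈ U := by rw [hb]; exact hζ
  have hρd : ∀ q ∈ U, MDifferentiableAt (𝓘(ℝ, EG).prod 𝓘(ℝ, EM)) 𝓘(ℝ, EG) ρ q := fun q hq =>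
    ((hρ q hq).contMDiffAt (hU.mem_nhds hq)).mdifferentiableAt (by simp)
  have e1 := tangentMap_comp_at ζ (hρd _ hζ) (hfst.prodMk ht)
  have e2 := tangentMap_comp_at ζ (hρd _ hbU) (hfst.prodMk hs)
  have e3 := e1.trans ((congrArg _ hpair).trans e2.symm)
  refine e3.trans (Eq.trans (tangentMap_congr ?_) tangentMap_prodFst)
  have hcont : Continuous (fun q : G × G => (q.1, 𝒢.src q.1)) :=
    continuous_fst.prodMk (𝒢.isSubmersion_src.contMDiff.continuous.comp continuous_fst)
  filter_upwards [(hU.preimage hcont).mem_nhds hbU] with q hq using h2 _ hq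

end LieGroupoid

namespace LieGroupoid

variable {EG EM G M : Type*} [NormedAddCommGroup EG] [NormedSpace ℝ EG]
  [NormedAddCommGroup EM] [NormedSpace ℝ EM]
  [TopologicalSpace G] [ChartedSpace EG G] [IsManifold 𝓘(ℝ, EG) ∞ G]
  [TopologicalSpace M] [ChartedSpace EM M] [IsManifold 𝓘(ℝ, EM) ∞ M]
  (𝒢 : LieGroupoid 𝓘(ℝ, EG) 𝓘(ℝ, EM) G M)
  {EP HP P : Type*} [NormedAddCommGroup EP] [NormedSpace ℝ EP] [TopologicalSpace HP]
  {IP : ModelWithCorners ℝ EP HP} [TopologicalSpace P] [ChartedSpace HP P]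

/-- Infinitesimal composability is realized by maps: correcting `f₀` with the retraction makes it
composable with `k` near the point, without changing its derivative on `ζ`. -/
theorem exists_composable_map {f₀ k : P → G} {ζ : TangentBundle IP P}
    (hf₀ : MDifferentiableAt IP 𝓘(ℝ, EG) f₀ ζ.1) (hk : MDifferentiableAt IP 𝓘(ℝ, EG) k ζ.1)
    (h : 𝒢.tsrc (tangentMap IP 𝓘(ℝ, EG) f₀ ζ) = 𝒢.ttgt (tangentMap IP 𝓘(ℝ, EG) k ζ)) :
    ∃ f : P → G, MDifferentiableAt IP 𝓘(ℝ, EG) f ζ.1 ∧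
      (∀ᶠ q in 𝓝 ζ.1, 𝒢.src (f q) = 𝒢.tgt (k q)) ∧
      tangentMap IP 𝓘(ℝ, EG) f ζ = tangentMap IP 𝓘(ℝ, EG) f₀ ζ := by
  have hb : 𝒢.src (f₀ ζ.1) = 𝒢.tgt (k ζ.1) := congrArg TotalSpace.proj h
  obtain ⟨U, ρ, hU, hgU, hρ, h1, h2⟩ := 𝒢.exists_retraction hb
  have hρd : MDifferentiableAt (𝓘(ℝ, EG).prod 𝓘(ℝ, EG)) 𝓘(ℝ, EG) ρ (f₀ ζ.1, k ζ.1) :=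
    ((hρ _ hgU).contMDiffAt (hU.mem_nhds hgU)).mdifferentiableAt (by simp)
  have hpair := hf₀.prodMk hk
  refine ⟨ρ ∘ fun q => (f₀ q, k q), hρd.comp ζ.1 hpair, ?_, ?_⟩
  · filter_upwards [hpair.continuousAt.preimage_mem_nhds (hU.mem_nhds hgU)] with q hq
    exact h1 _ hq
  · rw [tangentMap_comp_at ζ hρd hpair, tangentMap_prodMk hf₀ hk]
    exact h2 ((equivTangentBundleProd _ _ _ _).symm _) hgU h

/-- This reduces identities between products of tangent vectors to identities in G: represent the
vectors by maps composable near a point, use the identity pointwise, and differentiate. -/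
theorem exists_composable_pair {v w : TangentBundle 𝓘(ℝ, EG) G} (h : 𝒢.tsrc v = 𝒢.ttgt w) :
    ∃ (f k : G × G → G) (ζ : TangentBundle (𝓘(ℝ, EG).prod 𝓘(ℝ, EG)) (G × G)),
      MDifferentiableAt (𝓘(ℝ, EG).prod 𝓘(ℝ, EG)) 𝓘(ℝ, EG) f ζ.1 ∧
      MDifferentiableAt (𝓘(ℝ, EG).prod 𝓘(ℝ, EG)) 𝓘(ℝ, EG) k ζ.1 ∧
      (∀ᶠ q in 𝓝 ζ.1, 𝒢.src (f q) = 𝒢.tgt (k q)) ∧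
      tangentMap (𝓘(ℝ, EG).prod 𝓘(ℝ, EG)) 𝓘(ℝ, EG) f ζ = v ∧
      tangentMap (𝓘(ℝ, EG).prod 𝓘(ℝ, EG)) 𝓘(ℝ, EG) k ζ = w := by
  set ζ := (equivTangentBundleProd 𝓘(ℝ, EG) G 𝓘(ℝ, EG) G).symm (v, w) with hζ
  have e1 : tangentMap (𝓘(ℝ, EG).prod 𝓘(ℝ, EG)) 𝓘(ℝ, EG) Prod.fst ζ = v := tangentMap_prodFst
  have e2 : tangentMap (𝓘(ℝ, EG).prod 𝓘(ℝ, EG)) 𝓘(ℝ, EG) Prod.snd ζ = w := tangentMap_prodSnd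
  obtain ⟨f, hf, hfk, hfv⟩ := 𝒢.exists_composable_map (IP := 𝓘(ℝ, EG).prod 𝓘(ℝ, EG))
    (f₀ := Prod.fst) (k := Prod.snd) (ζ := ζ) mdifferentiableAt_fst mdifferentiableAt_snd
    (by rw [e1, e2, h])
  exact ⟨f, Prod.snd, ζ, hf, mdifferentiableAt_snd, hfk, hfv.trans e1, e2⟩

theorem tsrc_tmul (v w : TangentBundle 𝓘(ℝ, EG) G) (h : 𝒢.tsrc v = 𝒢.ttgt w) :
    𝒢.tsrc (𝒢.tmul v w) = 𝒢.tsrc w := by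
  obtain ⟨f, k, ζ, hf, hk, hfk, rfl, rfl⟩ := 𝒢.exists_composable_pair h
  rw [← 𝒢.tangentMap_mul hf hk hfk]
  exact (tangentMap_comp_at ζ (𝒢.mdifferentiable_src _)
    (𝒢.hasMFDerivAt_mul hf hk hfk).mdifferentiableAt).symm.trans
    ((tangentMap_congr (hfk.mono fun q hq => 𝒢.src_mul _ _ hq)).trans
      (tangentMap_comp_at ζ (𝒢.mdifferentiable_src _) hk))

theorem ttgt_tmul (v w : TangentBundle 𝓘(ℝ, EG) G) (h : 𝒢.tsrc v = 𝒢.ttgt w) :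
    𝒢.ttgt (𝒢.tmul v w) = 𝒢.ttgt v := by
  obtain ⟨f, k, ζ, hf, hk, hfk, rfl, rfl⟩ := 𝒢.exists_composable_pair h
  rw [← 𝒢.tangentMap_mul hf hk hfk]
  exact (tangentMap_comp_at ζ (𝒢.mdifferentiable_tgt _)
    (𝒢.hasMFDerivAt_mul hf hk hfk).mdifferentiableAt).symm.trans
    ((tangentMap_congr (hfk.mono fun q hq => 𝒢.tgt_mul _ _ hq)).trans
      (tangentMap_comp_at ζ (𝒢.mdifferentiable_tgt _) hf))

/-- The pair (v, w) is represented first. A further factor of G then carries `u`, and the map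
representing `u` is corrected to be composable with the one representing `v`, so that associativity
in G can be differentiated. -/
theorem tmul_assoc (u v w : TangentBundle 𝓘(ℝ, EG) G) (h : 𝒢.tsrc u = 𝒢.ttgt v)
    (h' : 𝒢.tsrc v = 𝒢.ttgt w) :
    𝒢.tmul (𝒢.tmul u v) w = 𝒢.tmul u (𝒢.tmul v w) := by
  obtain ⟨f, k, ζ, hf, hk, hfk, rfl, rfl⟩ := 𝒢.exists_composable_pair h'
  let I2 := 𝓘(ℝ, EG).prod 𝓘(ℝ, EG)
  let ξ := (equivTangentBundleProd 𝓘(ℝ, EG) G I2 (G × G)).symm (u, ζ)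
  have e1 : tangentMap (𝓘(ℝ, EG).prod I2) 𝓘(ℝ, EG) Prod.fst ξ = u := tangentMap_prodFst
  have e2 : tangentMap (𝓘(ℝ, EG).prod I2) I2 Prod.snd ξ = ζ := tangentMap_prodSnd
  have hsnd : MDifferentiableAt (𝓘(ℝ, EG).prod I2) I2 (Prod.snd : G × G × G → G × G) ξ.1 :=
    mdifferentiableAt_snd
  have hf' : MDifferentiableAt (𝓘(ℝ, EG).prod I2) 𝓘(ℝ, EG) (f ∘ Prod.snd) ξ.1 :=
    MDifferentiableAt.comp (I' := I2) ξ.1 (show MDifferentiableAt I2 𝓘(ℝ, EG) f ξ.1.2 from hf) hsnd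
  have hk' : MDifferentiableAt (𝓘(ℝ, EG).prod I2) 𝓘(ℝ, EG) (k ∘ Prod.snd) ξ.1 :=
    MDifferentiableAt.comp (I' := I2) ξ.1 (show MDifferentiableAt I2 𝓘(ℝ, EG) k ξ.1.2 from hk) hsnd
  have ef : tangentMap (𝓘(ℝ, EG).prod I2) 𝓘(ℝ, EG) (f ∘ Prod.snd) ξ = tangentMap I2 𝓘(ℝ, EG) f ζ :=
    (tangentMap_comp_at (I' := I2) ξ (show MDifferentiableAt I2 𝓘(ℝ, EG) f ξ.1.2 from hf) hsnd).trans
      (congrArg _ e2)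
  have ek : tangentMap (𝓘(ℝ, EG).prod I2) 𝓘(ℝ, EG) (k ∘ Prod.snd) ξ = tangentMap I2 𝓘(ℝ, EG) k ζ :=
    (tangentMap_comp_at (I' := I2) ξ (show MDifferentiableAt I2 𝓘(ℝ, EG) k ξ.1.2 from hk) hsnd).trans
      (congrArg _ e2)
  obtain ⟨b, hb, hbf, hbu⟩ := 𝒢.exists_composable_map (IP := 𝓘(ℝ, EG).prod I2)
    (f₀ := Prod.fst) (k := f ∘ Prod.snd) (ζ := ξ) mdifferentiableAt_fst hf' (by rw [e1, ef, h])
  have hfk' : ∀ᶠ q in 𝓝 ξ.1, 𝒢.src ((f ∘ Prod.snd) q) = 𝒢.tgt ((k ∘ Prod.snd) q) :=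
    (continuous_snd.tendsto ξ.1).eventually hfk
  have hL := (𝒢.hasMFDerivAt_mul hb hf' hbf).mdifferentiableAt
  have hR := (𝒢.hasMFDerivAt_mul hf' hk' hfk').mdifferentiableAt
  rw [← ef, ← ek, ← hbu.trans e1, ← 𝒢.tangentMap_mul hb hf' hbf, ← 𝒢.tangentMap_mul hf' hk' hfk',
    ← 𝒢.tangentMap_mul hL hk', ← 𝒢.tangentMap_mul hb hR]
  · refine tangentMap_congr ?_
    filter_upwards [hbf, hfk'] with q hq hq' using 𝒢.mul_assoc _ _ _ hq hq'
  · filter_upwards [hbf, hfk'] with q hq hq'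
    rw [hq, 𝒢.tgt_mul _ _ hq']
  · filter_upwards [hbf, hfk'] with q hq hq'
    rw [𝒢.src_mul _ _ hq, hq']

/-- Near a composable pair of vectors, the product agrees on composable pairs with the tangent map
of q ↦ ρ(q) q₂, which is smooth on an open set. -/
theorem contMDiffOn_tmul :
    ContMDiffOn (𝓘(ℝ, EG).tangent.prod 𝓘(ℝ, EG).tangent) 𝓘(ℝ, EG).tangent ∞
      (fun p : TangentBundle 𝓘(ℝ, EG) G × TangentBundle 𝓘(ℝ, EG) G => 𝒢.tmul p.1 p.2)
      {p | 𝒢.tsrc p.1 = 𝒢.ttgt p.2} := by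
  rintro ⟨v, w⟩ hvw
  have hb : 𝒢.src v.1 = 𝒢.tgt w.1 := congrArg TotalSpace.proj hvw
  obtain ⟨U, ρ, hU, hgU, hρ, h1, h2⟩ := 𝒢.exists_retraction hb
  have hm : ContMDiffOn (𝓘(ℝ, EG).prod 𝓘(ℝ, EG)) 𝓘(ℝ, EG) ∞ (fun q => 𝒢.mul (ρ q) q.2) U :=
    𝒢.contMDiffOn_mul.comp (hρ.prodMk contMDiffOn_snd) h1
  have hT := hm.contMDiffOn_tangentMap hU
  have hE : ContMDiff (𝓘(ℝ, EG).tangent.prod 𝓘(ℝ, EG).tangent) (𝓘(ℝ, EG).prod 𝓘(ℝ, EG)).tangent ∞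
      (equivTangentBundleProd 𝓘(ℝ, EG) G 𝓘(ℝ, EG) G).symm := contMDiff_equivTangentBundleProd_symm
  have hT' := hT.comp (hE.contMDiffOn (s := {p : TangentBundle 𝓘(ℝ, EG) G ×
    TangentBundle 𝓘(ℝ, EG) G | (p.1.1, p.2.1) ∈ U})) fun p hp => hp
  have hopen : IsOpen {p : TangentBundle 𝓘(ℝ, EG) G × TangentBundle 𝓘(ℝ, EG) G |
      (p.1.1, p.2.1) ∈ U} :=
    hU.preimage (((FiberBundle.continuous_proj EG (TangentSpace 𝓘(ℝ, EG))).comp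
      continuous_fst).prodMk ((FiberBundle.continuous_proj EG (TangentSpace 𝓘(ℝ, EG))).comp
      continuous_snd))
  refine ((hT' (v, w) hgU).contMDiffAt (hopen.mem_nhds hgU)).contMDiffWithinAt.congr_of_eventuallyEq
    (s := {p | 𝒢.tsrc p.1 = 𝒢.ttgt p.2}) ?_ ?_
  all_goals
    have key : ∀ p ∈ {p : TangentBundle 𝓘(ℝ, EG) G × TangentBundle 𝓘(ℝ, EG) G |
        (p.1.1, p.2.1) ∈ U}, 𝒢.tsrc p.1 = 𝒢.ttgt p.2 → 𝒢.tmul p.1 p.2 =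
        tangentMap (𝓘(ℝ, EG).prod 𝓘(ℝ, EG)) 𝓘(ℝ, EG) (fun q => 𝒢.mul (ρ q) q.2)
          ((equivTangentBundleProd 𝓘(ℝ, EG) G 𝓘(ℝ, EG) G).symm p) := by
      intro p hp hc
      have hρd : MDifferentiableAt (𝓘(ℝ, EG).prod 𝓘(ℝ, EG)) 𝓘(ℝ, EG) ρ (p.1.1, p.2.1) :=
        ((hρ _ hp).contMDiffAt (hU.mem_nhds hp)).mdifferentiableAt (by simp)
      rw [𝒢.tangentMap_mul hρd mdifferentiableAt_snd
        (by filter_upwards [hU.mem_nhds hp] with q hq using h1 q hq), tangentMap_prodSnd,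
        h2 ((equivTangentBundleProd _ _ _ _).symm p) hp hc]
      rfl
  · filter_upwards [self_mem_nhdsWithin, nhdsWithin_le_nhds (hopen.mem_nhds hgU)] with p hp hp'
    exact key p hp' hp
  · exact key _ hgU hvw

/-- The tangent groupoid of a Lie groupoid. -/
def tangent : LieGroupoid (𝓘(ℝ, EG).prod 𝓘(ℝ, EG)) (𝓘(ℝ, EM).prod 𝓘(ℝ, EM))
    (TotalSpace EG (TangentSpace 𝓘(ℝ, EG) : G → Type _))
    (TotalSpace EM (TangentSpace 𝓘(ℝ, EM) : M → Type _)) where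
  src := 𝒢.tsrc
  tgt := 𝒢.ttgt
  one := 𝒢.tone
  inv := 𝒢.tinv
  mul := 𝒢.tmul
  src_one v := by
    exact (tangentMap_comp_at v (𝒢.mdifferentiable_src _) (𝒢.mdifferentiable_one _)).symm.trans
      ((tangentMap_congr (g := id) (.of_forall 𝒢.src_one)).trans (congrFun tangentMap_id v))
  tgt_one v := by
    exact (tangentMap_comp_at v (𝒢.mdifferentiable_tgt _) (𝒢.mdifferentiable_one _)).symm.trans
      ((tangentMap_congr (g := id) (.of_forall 𝒢.tgt_one)).trans (congrFun tangentMap_id v))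
  src_mul := 𝒢.tsrc_tmul
  tgt_mul := 𝒢.ttgt_tmul
  mul_assoc := 𝒢.tmul_assoc
  one_mul v := by
    have h := 𝒢.tangentMap_mul (ζ := v)
      ((𝒢.mdifferentiable_one _).comp v.1 (𝒢.mdifferentiable_tgt _)) mdifferentiableAt_id
      (.of_forall fun g => 𝒢.src_one _)
    rw [tangentMap_comp_at v (𝒢.mdifferentiable_one _) (𝒢.mdifferentiable_tgt _),
      tangentMap_id] at h
    exact h.symm.trans ((tangentMap_congr (g := id) (.of_forall 𝒢.one_mul)).trans
      (congrFun tangentMap_id v))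
  mul_one v := by
    have h := 𝒢.tangentMap_mul (ζ := v) mdifferentiableAt_id
      ((𝒢.mdifferentiable_one _).comp v.1 (𝒢.mdifferentiable_src _))
      (.of_forall fun g => (𝒢.tgt_one _).symm)
    rw [tangentMap_comp_at v (𝒢.mdifferentiable_one _) (𝒢.mdifferentiable_src _),
      tangentMap_id] at h
    exact h.symm.trans ((tangentMap_congr (g := id) (.of_forall 𝒢.mul_one)).trans
      (congrFun tangentMap_id v))
  src_inv v := by
    exact (tangentMap_comp_at v (𝒢.mdifferentiable_src _) (𝒢.mdifferentiable_inv _)).symm.trans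
      (tangentMap_congr (.of_forall 𝒢.src_inv))
  tgt_inv v := by
    exact (tangentMap_comp_at v (𝒢.mdifferentiable_tgt _) (𝒢.mdifferentiable_inv _)).symm.trans
      (tangentMap_congr (.of_forall 𝒢.tgt_inv))
  mul_inv v := by
    have h := 𝒢.tangentMap_mul (ζ := v) mdifferentiableAt_id (𝒢.mdifferentiable_inv _)
      (.of_forall fun g => (𝒢.tgt_inv _).symm)
    rw [tangentMap_id] at h
    exact h.symm.trans ((tangentMap_congr (.of_forall 𝒢.mul_inv)).trans
      (tangentMap_comp_at v (𝒢.mdifferentiable_one _) (𝒢.mdifferentiable_tgt _)))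
  inv_mul v := by
    have h := 𝒢.tangentMap_mul (ζ := v) (𝒢.mdifferentiable_inv _) mdifferentiableAt_id
      (.of_forall fun g => 𝒢.src_inv _)
    rw [tangentMap_id] at h
    exact h.symm.trans ((tangentMap_congr (.of_forall 𝒢.inv_mul)).trans
      (tangentMap_comp_at v (𝒢.mdifferentiable_one _) (𝒢.mdifferentiable_src _)))
  isSubmersion_src := 𝒢.isSubmersion_src.tangentMap
  isSubmersion_tgt := 𝒢.isSubmersion_tgt.tangentMap
  contMDiff_one := 𝒢.contMDiff_one.contMDiff_tangentMap (by simp)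
  contMDiff_inv := 𝒢.contMDiff_inv.contMDiff_tangentMap (by simp)
  contMDiffOn_mul := 𝒢.contMDiffOn_tmul

/-- The tangent groupoid as a `VB`-groupoid. -/
def tangentVB : VBGroupoid 𝒢 EG (TangentSpace 𝓘(ℝ, EG) : G → Type _)
    EM (TangentSpace 𝓘(ℝ, EM) : M → Type _) where
  total := 𝒢.tangent
  srcV g := mfderiv 𝓘(ℝ, EG) 𝓘(ℝ, EM) 𝒢.src g
  tgtV g := mfderiv 𝓘(ℝ, EG) 𝓘(ℝ, EM) 𝒢.tgt g
  oneV x := mfderiv 𝓘(ℝ, EM) 𝓘(ℝ, EG) 𝒢.one x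
  invV g := mfderiv 𝓘(ℝ, EG) 𝓘(ℝ, EG) 𝒢.inv g
  mulV g h := 𝒢.tangentMul g h
  total_src _ _ := rfl
  total_tgt _ _ := rfl
  total_one _ _ := rfl
  total_inv _ _ := rfl
  total_mul _ _ _ _ _ := rfl

end LieGroupoid

/-! ### Brackets and maps that agree along a subset -/

section Along
variable {E H M : Type*} [NormedAddCommGroup E] [NormedSpace ℝ E] [TopologicalSpace H]
  {I : ModelWithCorners ℝ E H} [TopologicalSpace M] [ChartedSpace H M] [IsManifold I ∞ M]
  {EP HP P : Type*} [NormedAddCommGroup EP] [NormedSpace ℝ EP] [TopologicalSpace HP]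
  {IP : ModelWithCorners ℝ EP HP} [TopologicalSpace P] [ChartedSpace HP P] [IsManifold IP ∞ P]

/-- If the vector fields `X` and `Y` are tangent at `p` to the image of a map `r`, and along that
image the derivatives of `f₁` and `f₂` agree on `X` and on `Y`, then they agree on `[X, Y]`
at `p`. -/
theorem tangentMap_mlieBracket_congr_along [IP.Boundaryless] [CompleteSpace EP] {f₁ f₂ : P → M}
    {U : Set P} (hU : IsOpen U) (hf₁ : ContMDiffOn IP I ∞ f₁ U) (hf₂ : ContMDiffOn IP I ∞ f₂ U)
    {X Y : ∀ q, TangentSpace IP q}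
    (hX : ContMDiff IP IP.tangent ∞ (fun q => (⟨q, X q⟩ : TangentBundle IP P)))
    (hY : ContMDiff IP IP.tangent ∞ (fun q => (⟨q, Y q⟩ : TangentBundle IP P)))
    {r : P → P} {p : P} (hp : p ∈ U) (hr : MDifferentiableAt IP IP r p)
    (hrX : tangentMap IP IP r ⟨p, X p⟩ = ⟨p, X p⟩) (hrY : tangentMap IP IP r ⟨p, Y p⟩ = ⟨p, Y p⟩)
    (hfX : ∀ᶠ q in 𝓝 p, tangentMap IP I f₁ ⟨r q, X (r q)⟩ = tangentMap IP I f₂ ⟨r q, X (r q)⟩)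
    (hfY : ∀ᶠ q in 𝓝 p, tangentMap IP I f₁ ⟨r q, Y (r q)⟩ = tangentMap IP I f₂ ⟨r q, Y (r q)⟩) :
    tangentMap IP I f₁ ⟨p, VectorField.mlieBracket IP X Y p⟩ =
      tangentMap IP I f₂ ⟨p, VectorField.mlieBracket IP X Y p⟩ := by
  have i1 : IsManifold I 1 M := .of_le (n := ∞) (by simp)
  have h0 : r p = p := tangentMap_fixed_proj hrX
  have hb : f₁ p = f₂ p := by
    have := congrArg TotalSpace.proj hfX.self_of_nhds
    change f₁ (r p) = f₂ (r p) at this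
    rwa [h0] at this
  set ψ := extChartAt I (f₁ p) with hψdef
  set W := (chartAt H (f₁ p)).source with hWdef
  have hW : IsOpen W := (chartAt H (f₁ p)).open_source
  have hψ : ContMDiffOn I 𝓘(ℝ, E) ∞ ψ W := contMDiffOn_extChartAt
  have hpW : f₁ p ∈ W := mem_chart_source H (f₁ p)
  -- The two maps need not agree off the image of `r`, so each gets its own neighbourhood on which
  -- it takes values in the chart.
  have hU₁ : IsOpen (U ∩ f₁ ⁻¹' W) := hf₁.continuousOn.isOpen_inter_preimage hU hW
  have hU₂ : IsOpen (U ∩ f₂ ⁻¹' W) := hf₂.continuousOn.isOpen_inter_preimage hU hW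
  have hp₁ : p ∈ U ∩ f₁ ⁻¹' W := ⟨hp, hpW⟩
  have hp₂ : p ∈ U ∩ f₂ ⁻¹' W := ⟨hp, by rwa [Set.mem_preimage, ← hb]⟩
  have hu₁ : ContMDiffOn IP 𝓘(ℝ, E) ∞ (ψ ∘ f₁) (U ∩ f₁ ⁻¹' W) :=
    hψ.comp (hf₁.mono Set.inter_subset_left) fun q hq => hq.2
  have hu₂ : ContMDiffOn IP 𝓘(ℝ, E) ∞ (ψ ∘ f₂) (U ∩ f₂ ⁻¹' W) :=
    hψ.comp (hf₂.mono Set.inter_subset_left) fun q hq => hq.2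
  have hcomp : ∀ {f : P → M}, ContMDiffOn IP I ∞ f U → ∀ ζ : TangentBundle IP P,
      ζ.1 ∈ U ∩ f ⁻¹' W → tangentMap IP 𝓘(ℝ, E) (ψ ∘ f) ζ =
        tangentMap I 𝓘(ℝ, E) ψ (tangentMap IP I f ζ) := fun hf ζ hζ =>
    tangentMap_comp_at ζ (((hψ _ hζ.2).contMDiffAt (hW.mem_nhds hζ.2)).mdifferentiableAt (by simp))
      (((hf _ hζ.1).contMDiffAt (hU.mem_nhds hζ.1)).mdifferentiableAt (by simp))
  have hinj : ∀ v w : TangentBundle I M, v.1 = f₁ p → w.1 = v.1 →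
      (tangentMap I 𝓘(ℝ, E) ψ v).2 = (tangentMap I 𝓘(ℝ, E) ψ w).2 → v = w := by
    rintro ⟨x, v⟩ ⟨y, w⟩ hx hy h
    dsimp only at hx hy
    subst hy hx
    exact (TotalSpace.mk_inj).2
      ((isInvertible_mfderiv_extChartAt (mem_extChartAt_source (I := I) (f₁ p))).injective h)
  have hev : ∀ {Z : ∀ q, TangentSpace IP q},
      (∀ᶠ q in 𝓝 p, tangentMap IP I f₁ ⟨r q, Z (r q)⟩ = tangentMap IP I f₂ ⟨r q, Z (r q)⟩) →
      (fun q => mvfderiv IP (ψ ∘ f₁) q (Z q)) ∘ r =ᶠ[𝓝 p]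
        (fun q => mvfderiv IP (ψ ∘ f₂) q (Z q)) ∘ r := fun {Z} h => by
    have h1 : ∀ᶠ q in 𝓝 p, r q ∈ U ∩ f₁ ⁻¹' W :=
      hr.continuousAt.preimage_mem_nhds (by rw [h0]; exact hU₁.mem_nhds hp₁)
    have h2 : ∀ᶠ q in 𝓝 p, r q ∈ U ∩ f₂ ⁻¹' W :=
      hr.continuousAt.preimage_mem_nhds (by rw [h0]; exact hU₂.mem_nhds hp₂)
    filter_upwards [h, h1, h2] with q hq hq1 hq2
    exact congrArg TotalSpace.snd ((hcomp hf₁ ⟨r q, Z (r q)⟩ hq1).trans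
      ((congrArg _ hq).trans (hcomp hf₂ ⟨r q, Z (r q)⟩ hq2).symm))
  have hd : ∀ {u : P → E} {U' : Set P}, IsOpen U' → ContMDiffOn IP 𝓘(ℝ, E) ∞ u U' → p ∈ U' →
      ∀ {Z : ∀ q, TangentSpace IP q},
      ContMDiff IP IP.tangent ∞ (fun q => (⟨q, Z q⟩ : TangentBundle IP P)) →
      MDifferentiableAt IP 𝓘(ℝ, E) (fun q => mvfderiv IP u q (Z q)) p := fun hU' hu hpU _ hZ =>
    ((hu.mvfderiv_apply hU' hZ _ hpU).contMDiffAt (hU'.mem_nhds hpU)).mdifferentiableAt (by simp)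
  have hmain : mvfderiv IP (ψ ∘ f₁) p (VectorField.mlieBracket IP X Y p) =
      mvfderiv IP (ψ ∘ f₂) p (VectorField.mlieBracket IP X Y p) := by
    -- The inner derivatives of ψ ∘ f₁ and ψ ∘ f₂ agree on the image of `r`; the outer ones are
    -- taken along vectors fixed by Tr, hence agree at `p`.
    rw [mvfderiv_mlieBracket hU₁ hu₁ hX hY hp₁, mvfderiv_mlieBracket hU₂ hu₂ hX hY hp₂]
    exact congrArg₂ (· - ·)
      (mvfderiv_eq_of_comp_eventuallyEq (ζ := ⟨p, X p⟩) hr hrX (hd hU₁ hu₁ hp₁ hY)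
        (hd hU₂ hu₂ hp₂ hY) (hev hfY))
      (mvfderiv_eq_of_comp_eventuallyEq (ζ := ⟨p, Y p⟩) hr hrY (hd hU₁ hu₁ hp₁ hX)
        (hd hU₂ hu₂ hp₂ hX) (hev hfX))
  refine hinj _ _ rfl hb.symm ?_
  have e1 := congrArg TotalSpace.snd (hcomp hf₁ ⟨p, VectorField.mlieBracket IP X Y p⟩ hp₁)
  have e2 := congrArg TotalSpace.snd (hcomp hf₂ ⟨p, VectorField.mlieBracket IP X Y p⟩ hp₂)
  exact e1.symm.trans (hmain.trans e2)

/-- The derivative of a smooth map is a morphism of tangent Lie algebroids. -/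
theorem isLieAlgebroidMorphism_mfderiv [IP.Boundaryless] [FiniteDimensional ℝ EP] [I.Boundaryless]
    [FiniteDimensional ℝ E] {f : P → M} (hf : ContMDiff IP I ∞ f) :
    IsLieAlgebroidMorphism IP I EP E (B := TangentSpace IP) (A := TangentSpace I) f
      (fun p => mfderiv IP I f p) where
  anchor_comp _ _ := rfl
  map_bracket X X' σ σ' h h' p :=
    have := FiniteDimensional.complete ℝ EP
    -- The hypotheses hold on all of P, so the identity serves as `r`.
    mfderiv_mlieBracket_along isOpen_univ hf.contMDiffOn X.contMDiff X'.contMDiff σ σ' (r := id)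
      (Set.mem_univ p) mdifferentiableAt_id (congrFun tangentMap_id _) (congrFun tangentMap_id _)
      (.of_forall h) (.of_forall h')

end Along

/-! ### The multiplication of the tangent groupoid preserves brackets -/

section FormalSection

variable {EP HP P : Type*} [NormedAddCommGroup EP] [NormedSpace ℝ EP] [TopologicalSpace HP]
  [TopologicalSpace P] [ChartedSpace HP P] {EM HM M : Type*} [NormedAddCommGroup EM]
  [NormedSpace ℝ EM] [TopologicalSpace HM] [TopologicalSpace M] [ChartedSpace HM M]
  {IP : ModelWithCorners ℝ EP HP} {I : ModelWithCorners ℝ EM HM}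
  {F : Type*} [NormedAddCommGroup F] [NormedSpace ℝ F]
  {A : M → Type*} [TopologicalSpace (TotalSpace F A)] [∀ x, TopologicalSpace (A x)]
  [∀ x, AddCommGroup (A x)] [∀ x, Module ℝ (A x)] [FiberBundle F A] [VectorBundle ℝ F A]

/-- Taken with the two projections G × G → G as `φ`, this gives the smoothness of pair fields. -/
theorem FormalSection.contMDiff_eval_along (σ : FormalSection IP P I F A) {φ : P → M}
    (hφ : ContMDiff IP I ∞ φ) :
    ContMDiff IP (I.prod 𝓘(ℝ, F)) ∞
      (fun q => (⟨φ q, σ.eval q (φ q)⟩ : TotalSpace F A)) := by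
  intro x
  have hs := fun i => contMDiffAt_totalSpace.1 (((σ.sec i).contMDiff.comp hφ) x)
  refine contMDiffAt_totalSpace.2 ⟨hφ x, ?_⟩
  have hsum : ContMDiffAt IP 𝓘(ℝ, F) ∞ (fun q => ∑ i, σ.coeff i q •
      (trivializationAt F A (φ x) ⟨φ q, σ.sec i (φ q)⟩).2) x :=
    contMDiffAt_finsetSum fun i _ => (σ.coeff i).contMDiff.contMDiffAt.smul (hs i).2
  refine hsum.congr_of_eventuallyEq ?_
  have h := (hφ x).continuousAt.preimage_mem_nhds
    ((trivializationAt F A (φ x)).open_baseSet.mem_nhds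
      (FiberBundle.mem_baseSet_trivializationAt' (φ x)))
  filter_upwards [h] with y hy
  have hl := (trivializationAt F A (φ x)).linear ℝ hy
  exact (map_sum (hl.mk' _) _ _).trans (Finset.sum_congr rfl fun i _ => hl.map_smul _ _)

end FormalSection

namespace LieGroupoid

variable {EG EM G M : Type*} [NormedAddCommGroup EG] [NormedSpace ℝ EG]
  [NormedAddCommGroup EM] [NormedSpace ℝ EM]
  [TopologicalSpace G] [ChartedSpace EG G] [IsManifold 𝓘(ℝ, EG) ∞ G]
  [TopologicalSpace M] [ChartedSpace EM M] [IsManifold 𝓘(ℝ, EM) ∞ M]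
  (𝒢 : LieGroupoid 𝓘(ℝ, EG) 𝓘(ℝ, EM) G M)

/-- The vector field on `G × G` given by a pair of formal sums of vector fields on `G`. -/
def pairField (σ₁ σ₂ : FormalSection (𝓘(ℝ, EG).prod 𝓘(ℝ, EG)) (G × G) 𝓘(ℝ, EG) EG
    (TangentSpace 𝓘(ℝ, EG) : G → Type _)) (q : G × G) :
    TangentSpace (𝓘(ℝ, EG).prod 𝓘(ℝ, EG)) q :=
  (σ₁.eval q q.1, σ₂.eval q q.2)

theorem contMDiff_pairField (σ₁ σ₂ : FormalSection (𝓘(ℝ, EG).prod 𝓘(ℝ, EG)) (G × G) 𝓘(ℝ, EG) EG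
    (TangentSpace 𝓘(ℝ, EG) : G → Type _)) :
    ContMDiff (𝓘(ℝ, EG).prod 𝓘(ℝ, EG)) (𝓘(ℝ, EG).prod 𝓘(ℝ, EG)).tangent ∞
      (fun q => (⟨q, pairField σ₁ σ₂ q⟩ : TangentBundle (𝓘(ℝ, EG).prod 𝓘(ℝ, EG)) (G × G))) := by
  have hE : ContMDiff (𝓘(ℝ, EG).tangent.prod 𝓘(ℝ, EG).tangent) (𝓘(ℝ, EG).prod 𝓘(ℝ, EG)).tangent ∞
      (equivTangentBundleProd 𝓘(ℝ, EG) G 𝓘(ℝ, EG) G).symm := contMDiff_equivTangentBundleProd_symm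
  exact hE.comp ((σ₁.contMDiff_eval_along contMDiff_fst).prodMk
    (σ₂.contMDiff_eval_along contMDiff_snd))

variable [FiniteDimensional ℝ EG]

/-- The bracket on G × G of the two pair fields has as components the two `bracketAt` expressions.
It is composable because Ts ∘ T(pr₁) and Tt ∘ T(pr₂) agree on both fields over composable pairs, and
Tm of it is computed by pushing forward along m ∘ r with the retraction `r`. -/
theorem tangent_mul_bracket (σ₁ σ₂ σ τ₁ τ₂ τ : FormalSection (𝓘(ℝ, EG).prod 𝓘(ℝ, EG)) (G × G)
      𝓘(ℝ, EG) EG (TangentSpace 𝓘(ℝ, EG) : G → Type _))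
    (hσ : ∀ g h, 𝒢.src g = 𝒢.tgt h →
      𝒢.tangentVB.Composable (σ₁.eval (g, h) g) (σ₂.eval (g, h) h) ∧
      𝒢.tangentMul g h (σ₁.eval (g, h) g, σ₂.eval (g, h) h) = σ.eval (g, h) (𝒢.mul g h))
    (hτ : ∀ g h, 𝒢.src g = 𝒢.tgt h →
      𝒢.tangentVB.Composable (τ₁.eval (g, h) g) (τ₂.eval (g, h) h) ∧
      𝒢.tangentMul g h (τ₁.eval (g, h) g, τ₂.eval (g, h) h) = τ.eval (g, h) (𝒢.mul g h))
    (g h : G) (hgh : 𝒢.src g = 𝒢.tgt h) :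
    𝒢.tangentVB.Composable
      (σ₁.bracketAt τ₁ (g, h) (pairField σ₁ σ₂ (g, h)) (pairField τ₁ τ₂ (g, h)) g)
      (σ₂.bracketAt τ₂ (g, h) (pairField σ₁ σ₂ (g, h)) (pairField τ₁ τ₂ (g, h)) h) ∧
    𝒢.tangentMul g h
      (σ₁.bracketAt τ₁ (g, h) (pairField σ₁ σ₂ (g, h)) (pairField τ₁ τ₂ (g, h)) g,
        σ₂.bracketAt τ₂ (g, h) (pairField σ₁ σ₂ (g, h)) (pairField τ₁ τ₂ (g, h)) h) =
      σ.bracketAt τ (g, h) (pairField σ₁ σ₂ (g, h)) (pairField τ₁ τ₂ (g, h)) (𝒢.mul g h) := by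
  have := FiniteDimensional.complete ℝ EG
  let I2 := 𝓘(ℝ, EG).prod 𝓘(ℝ, EG)
  let X := pairField σ₁ σ₂
  let Y := pairField τ₁ τ₂
  have hX : ContMDiff I2 I2.tangent ∞ (fun q => (⟨q, X q⟩ : TangentBundle I2 (G × G))) :=
    contMDiff_pairField σ₁ σ₂
  have hY : ContMDiff I2 I2.tangent ∞ (fun q => (⟨q, Y q⟩ : TangentBundle I2 (G × G))) :=
    contMDiff_pairField τ₁ τ₂
  let B : TangentBundle I2 (G × G) := ⟨(g, h), VectorField.mlieBracket I2 X Y (g, h)⟩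
  -- The projections send the pair fields to the given formal sums everywhere, so no retraction is
  -- needed for the components of the bracket.
  have hB₁ : mfderiv I2 𝓘(ℝ, EG) Prod.fst (g, h) B.2 =
      σ₁.bracketAt τ₁ (g, h) (X (g, h)) (Y (g, h)) g :=
    mfderiv_mlieBracket_along isOpen_univ contMDiff_fst.contMDiffOn hX hY σ₁ τ₁ (r := id)
      (Set.mem_univ _) mdifferentiableAt_id (congrFun tangentMap_id _) (congrFun tangentMap_id _)
      (.of_forall fun q => by simp only [mfderiv_fst]; rfl)
      (.of_forall fun q => by simp only [mfderiv_fst]; rfl)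
  have hB₂ : mfderiv I2 𝓘(ℝ, EG) Prod.snd (g, h) B.2 =
      σ₂.bracketAt τ₂ (g, h) (X (g, h)) (Y (g, h)) h :=
    mfderiv_mlieBracket_along isOpen_univ contMDiff_snd.contMDiffOn hX hY σ₂ τ₂ (r := id)
      (Set.mem_univ _) mdifferentiableAt_id (congrFun tangentMap_id _) (congrFun tangentMap_id _)
      (.of_forall fun q => by simp only [mfderiv_snd]; rfl)
      (.of_forall fun q => by simp only [mfderiv_snd]; rfl)
  have hB : B.2 = (σ₁.bracketAt τ₁ (g, h) (X (g, h)) (Y (g, h)) g,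
      σ₂.bracketAt τ₂ (g, h) (X (g, h)) (Y (g, h)) h) := by
    rw [← hB₁, ← hB₂, mfderiv_fst, mfderiv_snd]
    rfl
  obtain ⟨U, ρ, hU, hgU, hρ, h1, h2⟩ := 𝒢.exists_retraction hgh
  have hρd : ∀ q ∈ U, MDifferentiableAt I2 𝓘(ℝ, EG) ρ q := fun q hq =>
    ((hρ q hq).contMDiffAt (hU.mem_nhds hq)).mdifferentiableAt (by simp)
  let r : G × G → G × G := fun q => (ρ q, q.2)
  have hrd : ∀ q ∈ U, MDifferentiableAt I2 I2 r q := fun q hq =>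
    (hρd q hq).prodMk mdifferentiableAt_snd
  have hfix : ∀ ζ : TangentBundle I2 (G × G), ζ.1 ∈ U →
      𝒢.tsrc (equivTangentBundleProd _ _ _ _ ζ).1 = 𝒢.ttgt (equivTangentBundleProd _ _ _ _ ζ).2 →
      tangentMap I2 I2 r ζ = ζ := fun ζ hζ hc => by
    refine (tangentMap_prodMk (hρd _ hζ) mdifferentiableAt_snd).trans ?_
    rw [h2 ζ hζ hc, tangentMap_prodSnd]
    rfl
  have hmul : ∀ ζ : TangentBundle I2 (G × G), ζ.1 ∈ U →
      𝒢.tsrc (equivTangentBundleProd _ _ _ _ ζ).1 = 𝒢.ttgt (equivTangentBundleProd _ _ _ _ ζ).2 →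
      tangentMap I2 𝓘(ℝ, EG) (fun q => 𝒢.mul (ρ q) q.2) ζ =
        𝒢.tmul (equivTangentBundleProd _ _ _ _ ζ).1 (equivTangentBundleProd _ _ _ _ ζ).2 :=
    fun ζ hζ hc => by
      rw [𝒢.tangentMap_mul (hρd _ hζ) mdifferentiableAt_snd
        (by filter_upwards [hU.mem_nhds hζ] with q hq using h1 q hq), h2 ζ hζ hc,
        tangentMap_prodSnd]
      rfl
  have hr0 : r (g, h) = (g, h) :=
    congrArg TotalSpace.proj (hfix ⟨(g, h), X (g, h)⟩ hgU (hσ g h hgh).1)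
  have hrU : ∀ᶠ q in 𝓝 (g, h), r q ∈ U :=
    (hrd _ hgU).continuousAt.preimage_mem_nhds (by rw [hr0]; exact hU.mem_nhds hgU)
  have hcompB : 𝒢.tangentVB.Composable
      (σ₁.bracketAt τ₁ (g, h) (X (g, h)) (Y (g, h)) g)
      (σ₂.bracketAt τ₂ (g, h) (X (g, h)) (Y (g, h)) h) := by
    have hs : ∀ ζ : TangentBundle I2 (G × G), tangentMap I2 𝓘(ℝ, EM) (𝒢.src ∘ Prod.fst) ζ =
        𝒢.tsrc (equivTangentBundleProd _ _ _ _ ζ).1 := fun ζ =>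
      (tangentMap_comp_at ζ (𝒢.mdifferentiable_src _) mdifferentiableAt_fst).trans
        (congrArg _ tangentMap_prodFst)
    have ht : ∀ ζ : TangentBundle I2 (G × G), tangentMap I2 𝓘(ℝ, EM) (𝒢.tgt ∘ Prod.snd) ζ =
        𝒢.ttgt (equivTangentBundleProd _ _ _ _ ζ).2 := fun ζ =>
      (tangentMap_comp_at ζ (𝒢.mdifferentiable_tgt _) mdifferentiableAt_snd).trans
        (congrArg _ tangentMap_prodSnd)
    -- Points in the image of `r` over U are composable, and there the hypotheses say that the two
    -- derivatives agree on both fields.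
    have key := tangentMap_mlieBracket_congr_along isOpen_univ
      (𝒢.isSubmersion_src.contMDiff.comp contMDiff_fst).contMDiffOn
      (𝒢.isSubmersion_tgt.contMDiff.comp contMDiff_snd).contMDiffOn hX hY (r := r) (p := (g, h))
      (Set.mem_univ _) (hrd _ hgU) (hfix ⟨(g, h), X (g, h)⟩ hgU (hσ g h hgh).1)
      (hfix ⟨(g, h), Y (g, h)⟩ hgU (hτ g h hgh).1)
      (by
        filter_upwards [hU.mem_nhds hgU] with q hq
        rw [hs, ht]
        exact (hσ _ _ (h1 q hq)).1)
      (by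
        filter_upwards [hU.mem_nhds hgU] with q hq
        rw [hs, ht]
        exact (hτ _ _ (h1 q hq)).1)
    have key' := (hs B).symm.trans (key.trans (ht B))
    have e1 : (equivTangentBundleProd _ _ _ _ B).1 =
        ⟨g, σ₁.bracketAt τ₁ (g, h) (X (g, h)) (Y (g, h)) g⟩ :=
      congrArg (fun b : EG × EG => (⟨g, b.1⟩ : TangentBundle 𝓘(ℝ, EG) G)) hB
    have e2 : (equivTangentBundleProd _ _ _ _ B).2 =
        ⟨h, σ₂.bracketAt τ₂ (g, h) (X (g, h)) (Y (g, h)) h⟩ :=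
      congrArg (fun b : EG × EG => (⟨h, b.2⟩ : TangentBundle 𝓘(ℝ, EG) G)) hB
    rw [e1, e2] at key'
    exact key'
  refine ⟨hcompB, ?_⟩
  have hf : ContMDiffOn I2 𝓘(ℝ, EG) ∞ (fun q => 𝒢.mul (ρ q) q.2) U :=
    𝒢.contMDiffOn_mul.comp (hρ.prodMk contMDiffOn_snd) h1
  have hev : ∀ (κ₁ κ₂ κ : FormalSection I2 (G × G) 𝓘(ℝ, EG) EG
        (TangentSpace 𝓘(ℝ, EG) : G → Type _)),
      (∀ g h, 𝒢.src g = 𝒢.tgt h →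
        𝒢.tangentVB.Composable (κ₁.eval (g, h) g) (κ₂.eval (g, h) h) ∧
        𝒢.tangentMul g h (κ₁.eval (g, h) g, κ₂.eval (g, h) h) = κ.eval (g, h) (𝒢.mul g h)) →
      ∀ᶠ q in 𝓝 (g, h), mfderiv I2 𝓘(ℝ, EG) (fun q => 𝒢.mul (ρ q) q.2) (r q)
        (pairField κ₁ κ₂ (r q)) = κ.eval (r q) (𝒢.mul (ρ (r q)) (r q).2) := fun κ₁ κ₂ κ hκ => by
    filter_upwards [hU.mem_nhds hgU, hrU] with q hq hq'
    have hc := hκ _ _ (h1 q hq)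
    have e := hmul ⟨r q, pairField κ₁ κ₂ (r q)⟩ hq' hc.1
    have e0 := congrArg TotalSpace.proj e
    have e3 : 𝒢.tmul (equivTangentBundleProd _ _ _ _
        (⟨r q, pairField κ₁ κ₂ (r q)⟩ : TangentBundle I2 (G × G))).1
        (equivTangentBundleProd _ _ _ _
        (⟨r q, pairField κ₁ κ₂ (r q)⟩ : TangentBundle I2 (G × G))).2 =
        ⟨𝒢.mul (ρ q) q.2, κ.eval (r q) (𝒢.mul (ρ q) q.2)⟩ :=
      congrArg (TotalSpace.mk _) hc.2
    -- The base points ρ(r q) q₂ and ρ(q) q₂ are equal only by `e0`; the comparison is therefore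
    -- made in the total space.
    exact (TotalSpace.mk_inj).1 ((e.trans e3).trans (congrArg (fun y =>
      (⟨y, κ.eval (r q) y⟩ : TangentBundle 𝓘(ℝ, EG) G)) e0.symm))
  have hmain := mfderiv_mlieBracket_along hU hf hX hY σ τ (r := r) hgU (hrd _ hgU)
    (hfix ⟨(g, h), X (g, h)⟩ hgU (hσ g h hgh).1) (hfix ⟨(g, h), Y (g, h)⟩ hgU (hτ g h hgh).1)
    (hev σ₁ σ₂ σ hσ) (hev τ₁ τ₂ τ hτ)
  have hBm := hmul ⟨(g, h), (σ₁.bracketAt τ₁ (g, h) (X (g, h)) (Y (g, h)) g,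
      σ₂.bracketAt τ₂ (g, h) (X (g, h)) (Y (g, h)) h)⟩ hgU hcompB
  have e0 := congrArg TotalSpace.proj hBm
  have hmain' := (congrArg (mfderiv I2 𝓘(ℝ, EG) (fun q => 𝒢.mul (ρ q) q.2) (g, h)) hB).symm.trans
    hmain
  exact (TotalSpace.mk_inj).1 (hBm.symm.trans ((congrArg (TotalSpace.mk _) hmain').trans
    (congrArg (fun y => (⟨y, σ.bracketAt τ (g, h) (X (g, h)) (Y (g, h)) y⟩ :
      TangentBundle 𝓘(ℝ, EG) G)) e0)))

variable [FiniteDimensional ℝ EM]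

/-- The tangent groupoid as an `LA`-groupoid. -/
def tangentLA : LAGroupoid 𝒢 EG (TangentSpace 𝓘(ℝ, EG) : G → Type _)
    EM (TangentSpace 𝓘(ℝ, EM) : M → Type _) where
  toVBGroupoid := 𝒢.tangentVB
  src_morphism := isLieAlgebroidMorphism_mfderiv 𝒢.isSubmersion_src.contMDiff
  tgt_morphism := isLieAlgebroidMorphism_mfderiv 𝒢.isSubmersion_tgt.contMDiff
  one_morphism := isLieAlgebroidMorphism_mfderiv 𝒢.contMDiff_one
  inv_morphism := isLieAlgebroidMorphism_mfderiv 𝒢.contMDiff_inv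
  mul_anchor _ _ _ _ _ := rfl
  mul_bracket := 𝒢.tangent_mul_bracket

theorem isTangentGroupoid_tangentLA : 𝒢.tangentLA.IsTangentGroupoid where
  srcV_eq _ := rfl
  tgtV_eq _ := rfl
  oneV_eq _ := rfl
  invV_eq _ := rfl
  mulV_eq _ _ _ _ _ := rfl

end LieGroupoid

/-! ### Left and right invariant sections; the boundary map δ -/

section Core

variable {EG HG EM HM : Type*} [NormedAddCommGroup EG] [NormedSpace ℝ EG] [TopologicalSpace HG]
  [NormedAddCommGroup EM] [NormedSpace ℝ EM] [TopologicalSpace HM]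
  {I : ModelWithCorners ℝ EG HG} {J : ModelWithCorners ℝ EM HM}
  {G M : Type*} [TopologicalSpace G] [ChartedSpace HG G] [TopologicalSpace M] [ChartedSpace HM M]

namespace LieGroupoid

variable (𝒢 : LieGroupoid I J G M)

theorem eq_inv_of_mul_eq_one {g h : G} (hgh : 𝒢.src g = 𝒢.tgt h)
    (e : 𝒢.mul g h = 𝒢.one (𝒢.tgt g)) : h = 𝒢.inv g := by
  rw [← 𝒢.one_mul h, ← hgh, ← 𝒢.inv_mul g, 𝒢.mul_assoc _ _ _ (𝒢.src_inv g) hgh, e,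
    ← 𝒢.src_inv, 𝒢.mul_one]

theorem inv_inv (g : G) : 𝒢.inv (𝒢.inv g) = g :=
  (𝒢.eq_inv_of_mul_eq_one (𝒢.src_inv g) (by rw [𝒢.inv_mul, 𝒢.tgt_inv])).symm

theorem inv_one (x : M) : 𝒢.inv (𝒢.one x) = 𝒢.one x := by
  have h := 𝒢.mul_one (𝒢.one x)
  rw [𝒢.src_one] at h
  exact (𝒢.eq_inv_of_mul_eq_one (by rw [𝒢.src_one, 𝒢.tgt_one]) (by rw [h, 𝒢.tgt_one])).symm

theorem inv_mul_rev {g h : G} (hgh : 𝒢.src g = 𝒢.tgt h) :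
    𝒢.inv (𝒢.mul g h) = 𝒢.mul (𝒢.inv h) (𝒢.inv g) := by
  have h1 : 𝒢.src (𝒢.inv h) = 𝒢.tgt (𝒢.inv g) := by rw [𝒢.src_inv, 𝒢.tgt_inv, hgh]
  refine (𝒢.eq_inv_of_mul_eq_one ?_ ?_).symm
  · rw [𝒢.src_mul _ _ hgh, 𝒢.tgt_mul _ _ h1, 𝒢.tgt_inv]
  · rw [𝒢.mul_assoc _ _ _ hgh (by rw [𝒢.tgt_mul _ _ h1, 𝒢.tgt_inv]),
      ← 𝒢.mul_assoc _ _ _ (𝒢.tgt_inv h).symm h1, 𝒢.mul_inv, ← hgh, ← 𝒢.tgt_inv, 𝒢.one_mul,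
      𝒢.mul_inv, 𝒢.tgt_mul _ _ hgh]

theorem mul_right_cancel {a b k : G} (ha : 𝒢.src a = 𝒢.tgt k) (hb : 𝒢.src b = 𝒢.tgt k)
    (h : 𝒢.mul a k = 𝒢.mul b k) : a = b := by
  rw [← 𝒢.mul_one a, ← 𝒢.mul_one b, ha, hb, ← 𝒢.mul_inv k,
    ← 𝒢.mul_assoc _ _ _ ha (𝒢.tgt_inv k).symm, ← 𝒢.mul_assoc _ _ _ hb (𝒢.tgt_inv k).symm, h]

end LieGroupoid

variable {𝒢 : LieGroupoid I J G M}
  {F : Type*} [NormedAddCommGroup F] [NormedSpace ℝ F]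
  {V : G → Type*} [TopologicalSpace (TotalSpace F V)] [∀ x, TopologicalSpace (V x)]
  [∀ x, AddCommGroup (V x)] [∀ x, Module ℝ (V x)] [FiberBundle F V] [VectorBundle ℝ F V]
  {F' : Type*} [NormedAddCommGroup F'] [NormedSpace ℝ F']
  {E : M → Type*} [TopologicalSpace (TotalSpace F' E)] [∀ x, TopologicalSpace (E x)]
  [∀ x, AddCommGroup (E x)] [∀ x, Module ℝ (E x)] [FiberBundle F' E] [VectorBundle ℝ F' E]

theorem section_eq_of_inv {X Y : Cₛ^∞⟮I; F, V⟯}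
    (h : ∀ g, X (𝒢.inv g) = Y (𝒢.inv g)) : X = Y := by
  ext g
  have := h (𝒢.inv g)
  rwa [𝒢.inv_inv] at this

namespace VBGroupoid

variable (𝒱 : VBGroupoid 𝒢 F V F' E)

theorem composable_add {g h : G} {v v' : V g} {w w' : V h} (h₁ : 𝒱.Composable v w)
    (h₂ : 𝒱.Composable v' w') : 𝒱.Composable (v + v') (w + w') := by
  rw [Composable, 𝒱.total_src, 𝒱.total_tgt] at *
  rw [map_add, map_add]
  exact totalSpace_add_eq h₁ h₂

/-- The addition of a `VB`-groupoid is a morphism of groupoids. -/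
theorem total_mul_add {g h k : G} {v v' : V g} {w w' : V h} {a b : V k}
    (hc : 𝒱.Composable v w) (hc' : 𝒱.Composable v' w')
    (h₁ : 𝒱.total.mul ⟨g, v⟩ ⟨h, w⟩ = ⟨k, a⟩) (h₂ : 𝒱.total.mul ⟨g, v'⟩ ⟨h, w'⟩ = ⟨k, b⟩) :
    𝒱.total.mul ⟨g, v + v'⟩ ⟨h, w + w'⟩ = ⟨k, a + b⟩ := by
  -- The interchange law is the linearity of `mulV`, restated for products in the total groupoid.
  rw [𝒱.total_mul _ _ _ _ (𝒱.composable_add hc hc'), ← Prod.mk_add_mk, map_add]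
  exact totalSpace_add_eq ((𝒱.total_mul _ _ _ _ hc).symm.trans h₁)
    ((𝒱.total_mul _ _ _ _ hc').symm.trans h₂)

theorem mk_one_zero (x : M) : (⟨𝒢.one x, 0⟩ : TotalSpace F V) =
    𝒱.total.one (zeroSection F' E x) :=
  ((𝒱.total_one x 0).trans (by rw [map_zero])).symm

theorem composable_zero {g h : G} (hgh : 𝒢.src g = 𝒢.tgt h) :
    𝒱.Composable (0 : V g) (0 : V h) := by
  rw [Composable, src_zero, tgt_zero, hgh]

theorem total_mul_zero_zero {g h : G} (hgh : 𝒢.src g = 𝒢.tgt h) :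
    𝒱.total.mul ⟨g, 0⟩ ⟨h, 0⟩ = ⟨𝒢.mul g h, 0⟩ := by
  rw [𝒱.total_mul _ _ _ _ (𝒱.composable_zero hgh), Prod.mk_zero_zero, map_zero]

theorem total_inv_zero (g : G) : 𝒱.total.inv ⟨g, 0⟩ = ⟨𝒢.inv g, 0⟩ := by
  rw [𝒱.total_inv, map_zero]

/-- The section `g ↦ 0_g c(s(g))⁻¹` is `- c^l`. -/
theorem mk_neg_leftInvariant (c : 𝒱.coreSections) (g : G) :
    (⟨g, (-𝒱.leftInvariant c) g⟩ : TotalSpace F V) =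
      𝒱.total.mul ⟨g, 0⟩ (𝒱.total.inv ⟨𝒢.one (𝒢.src g), c.1 (𝒢.src g)⟩) := by
  rw [leftInvariant, neg_neg]
  exact mk_sectionOfMap _ (𝒱.contMDiff_left c) _ g

/-- Inverting a product reverses it: (c(t(g)) 0_g)⁻¹ = 0_{g⁻¹} c(s(g⁻¹))⁻¹. Statements about right
invariant sections thereby transfer to left invariant ones. -/
theorem total_inv_rightInvariant (c : 𝒱.coreSections) (g : G) :
    𝒱.total.inv ⟨g, 𝒱.rightInvariant c g⟩ = ⟨𝒢.inv g, (-𝒱.leftInvariant c) (𝒢.inv g)⟩ := by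
  rw [mk_rightInvariant, 𝒱.total.inv_mul_rev (𝒱.composable_right c g), mk_neg_leftInvariant,
    total_inv_zero, 𝒱.core_congr c (𝒢.src_inv g)]

theorem invV_rightInvariant (c : 𝒱.coreSections) (g : G) :
    𝒱.invV g (𝒱.rightInvariant c g) = (-𝒱.leftInvariant c) (𝒢.inv g) :=
  (TotalSpace.mk_inj (F := F)).1 ((𝒱.total_inv g _).symm.trans (𝒱.total_inv_rightInvariant c g))

theorem leftInvariant_inv (c : 𝒱.coreSections) (g : G) :
    𝒱.leftInvariant c (𝒢.inv g) = -𝒱.invV g (𝒱.rightInvariant c g) := by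
  rw [invV_rightInvariant]
  exact (neg_neg _).symm

theorem leftInvariant_add (c c' : 𝒱.coreSections) :
    𝒱.leftInvariant (c + c') = 𝒱.leftInvariant c + 𝒱.leftInvariant c' :=
  section_eq_of_inv fun g => by
    change _ = 𝒱.leftInvariant c (𝒢.inv g) + 𝒱.leftInvariant c' (𝒢.inv g)
    simp only [leftInvariant_inv, rightInvariant_add]
    change -𝒱.invV g (𝒱.rightInvariant c g + 𝒱.rightInvariant c' g) = _
    rw [map_add, neg_add]

theorem leftInvariant_smul (r : ℝ) (c : 𝒱.coreSections) :
    𝒱.leftInvariant (r • c) = r • 𝒱.leftInvariant c :=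
  section_eq_of_inv fun g => by
    change _ = r • 𝒱.leftInvariant c (𝒢.inv g)
    simp only [leftInvariant_inv, rightInvariant_smul]
    change -𝒱.invV g (r • 𝒱.rightInvariant c g) = _
    rw [map_smul, smul_neg]

theorem src_rightInvariant (c : 𝒱.coreSections) (g : G) :
    𝒱.total.src ⟨g, 𝒱.rightInvariant c g⟩ = zeroSection F' E (𝒢.src g) := by
  rw [𝒱.total_src, srcV_rightInvariant]
  rfl

theorem tgt_rightInvariant (c : 𝒱.coreSections) (g : G) :
    𝒱.total.tgt ⟨g, 𝒱.rightInvariant c g⟩ =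
      𝒱.total.tgt ⟨𝒢.one (𝒢.tgt g), c.1 (𝒢.tgt g)⟩ := by
  rw [mk_rightInvariant, 𝒱.total.tgt_mul _ _ (𝒱.composable_right c g)]

theorem src_neg_leftInvariant (c : 𝒱.coreSections) (g : G) :
    𝒱.total.src ⟨g, (-𝒱.leftInvariant c) g⟩ =
      𝒱.total.tgt ⟨𝒢.one (𝒢.src g), c.1 (𝒢.src g)⟩ := by
  rw [mk_neg_leftInvariant, 𝒱.total.src_mul _ _ (𝒱.composable_left c g), 𝒱.total.src_inv]

theorem tgt_neg_leftInvariant (c : 𝒱.coreSections) (g : G) :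
    𝒱.total.tgt ⟨g, (-𝒱.leftInvariant c) g⟩ = zeroSection F' E (𝒢.tgt g) := by
  rw [mk_neg_leftInvariant, 𝒱.total.tgt_mul _ _ (𝒱.composable_left c g), tgt_zero]

theorem tgtV_neg_leftInvariant (c : 𝒱.coreSections) (g : G) :
    𝒱.tgtV g ((-𝒱.leftInvariant c) g) = 0 :=
  (TotalSpace.mk_inj (F := F')).1
    ((𝒱.total_tgt g _).symm.trans (𝒱.tgt_neg_leftInvariant c g))

/-- `(- c^l)(g) c(s(g)) = 0_g` -/
theorem neg_leftInvariant_mul_core (c : 𝒱.coreSections) (g : G) :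
    𝒱.total.mul ⟨g, (-𝒱.leftInvariant c) g⟩ ⟨𝒢.one (𝒢.src g), c.1 (𝒢.src g)⟩ = ⟨g, 0⟩ := by
  rw [mk_neg_leftInvariant, 𝒱.total.mul_assoc _ _ _ (𝒱.composable_left c g) (𝒱.total.src_inv _),
    𝒱.total.inv_mul, src_core, ← 𝒱.src_zero, 𝒱.total.mul_one]

/-- `(- c^l)(g) c^r(h) = 0` -/
theorem neg_leftInvariant_mul_rightInvariant (c : 𝒱.coreSections) {g h : G}
    (hgh : 𝒢.src g = 𝒢.tgt h) :
    𝒱.total.mul ⟨g, (-𝒱.leftInvariant c) g⟩ ⟨h, 𝒱.rightInvariant c h⟩ = ⟨𝒢.mul g h, 0⟩ := by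
  rw [mk_rightInvariant, ← 𝒱.core_congr c hgh,
    ← 𝒱.total.mul_assoc _ _ _ (𝒱.src_neg_leftInvariant c g)
      (by rw [src_core, tgt_zero, hgh]), neg_leftInvariant_mul_core,
    total_mul_zero_zero _ hgh]

/-- Associativity together with 0_{gh} = 0_g 0_h. This is the mirror image of the relation satisfied
by c^r. -/
theorem mulRelated_neg_leftInvariant (c : 𝒱.coreSections) :
    𝒱.MulRelated 0 (-𝒱.leftInvariant c) (-𝒱.leftInvariant c) := by
  intro g h hgh
  have h1 : 𝒱.Composable ((0 : Cₛ^∞⟮I; F, V⟯) g) ((-𝒱.leftInvariant c) h) := by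
    change 𝒱.total.src ⟨g, 0⟩ = _
    rw [tgt_neg_leftInvariant, src_zero, hgh]
  refine ⟨h1, (TotalSpace.mk_inj (F := F)).1 ((𝒱.total_mul _ _ _ _ h1).symm.trans ?_)⟩
  change 𝒱.total.mul ⟨g, 0⟩ _ = _
  refine Eq.trans ?_ (𝒱.mk_neg_leftInvariant c (𝒢.mul g h)).symm
  rw [mk_neg_leftInvariant, 𝒱.core_congr c (𝒢.src_mul g h hgh),
    ← 𝒱.total_mul_zero_zero hgh,
    𝒱.total.mul_assoc _ _ _ (𝒱.composable_zero hgh) (𝒱.composable_left c h)]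

/-- The section `t ∘ c` of `E`. -/
def coreAnchor (c : 𝒱.coreSections) : Cₛ^∞⟮J; F', E⟯ :=
  sectionOfMap (fun x => 𝒱.total.tgt ⟨𝒢.one x, c.1 x⟩)
    (𝒱.total.isSubmersion_tgt.contMDiff.comp c.2.2)
    (fun x => by rw [𝒱.total_tgt]; exact 𝒢.tgt_one x)

theorem mk_coreAnchor (c : 𝒱.coreSections) (x : M) :
    (⟨x, 𝒱.coreAnchor c x⟩ : TotalSpace F' E) = 𝒱.total.tgt ⟨𝒢.one x, c.1 x⟩ :=
  mk_sectionOfMap _ (𝒱.total.isSubmersion_tgt.contMDiff.comp c.2.2) _ x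

/-- At a unit, -c^l is c⁻¹. Interchange applied to c = c · 0 and c⁻¹ = 0 · c⁻¹ gives c + c⁻¹ = c
c⁻¹, the unit at the target of c. -/
theorem core_add_neg_leftInvariant_one (c : 𝒱.coreSections) (x : M) :
    c.1 x + (-𝒱.leftInvariant c) (𝒢.one x) = 𝒱.oneV x (𝒱.coreAnchor c x) := by
  have e0 : 𝒱.total.inv ⟨𝒢.one x, c.1 x⟩ = ⟨𝒢.one x, (-𝒱.leftInvariant c) (𝒢.one x)⟩ := by
    have h := 𝒱.total_inv_rightInvariant c (𝒢.one x)
    rwa [rightInvariant_one, 𝒢.inv_one] at h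
  have e1 : 𝒱.total.mul ⟨𝒢.one x, c.1 x⟩ ⟨𝒢.one x, 0⟩ = ⟨𝒢.one x, c.1 x⟩ := by
    rw [𝒱.mk_one_zero, ← 𝒱.src_core c, 𝒱.total.mul_one]
  have e2 : 𝒱.total.mul ⟨𝒢.one x, 0⟩ ⟨𝒢.one x, (-𝒱.leftInvariant c) (𝒢.one x)⟩ =
      ⟨𝒢.one x, (-𝒱.leftInvariant c) (𝒢.one x)⟩ := by
    rw [𝒱.mk_one_zero, ← 𝒱.src_core c, ← 𝒱.total.tgt_inv, e0, 𝒱.total.one_mul]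
  have h := 𝒱.total_mul_add (v := c.1 x) (w := 0) (v' := 0)
    (w' := (-𝒱.leftInvariant c) (𝒢.one x))
    (by rw [Composable, src_core, tgt_zero, 𝒢.tgt_one])
    (by rw [Composable, src_zero, tgt_neg_leftInvariant, 𝒢.src_one, 𝒢.tgt_one]) e1 e2
  rw [add_zero, zero_add, ← e0, 𝒱.total.mul_inv, ← 𝒱.mk_coreAnchor, 𝒱.total_one] at h
  exact ((TotalSpace.mk_inj).1 h).symm

/-- The source sees only -c^l and the target only c^r, both giving t ∘ c; multiplicativity is the
interchange law, with the cross term (-c^l)(g) c^r(h) vanishing. -/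
theorem isMultiplicative_rightInvariant_sub_leftInvariant (c : 𝒱.coreSections) :
    𝒱.IsMultiplicative (𝒱.rightInvariant c - 𝒱.leftInvariant c) := by
  rw [sub_eq_add_neg]
  refine ⟨𝒱.coreAnchor c, fun g => ?_, fun g => ?_, fun x => ?_, fun g h hgh => ?_⟩
  · change 𝒱.srcV g (𝒱.rightInvariant c g + (-𝒱.leftInvariant c) g) = _
    rw [map_add, srcV_rightInvariant, zero_add]
    exact (TotalSpace.mk_inj (F := F')).1 ((𝒱.total_src g _).symm.trans
      ((𝒱.src_neg_leftInvariant c g).trans (𝒱.mk_coreAnchor c _).symm))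
  · change 𝒱.tgtV g (𝒱.rightInvariant c g + (-𝒱.leftInvariant c) g) = _
    rw [map_add, tgtV_neg_leftInvariant, add_zero]
    exact (TotalSpace.mk_inj (F := F')).1 ((𝒱.total_tgt g _).symm.trans
      ((𝒱.tgt_rightInvariant c g).trans (𝒱.mk_coreAnchor c _).symm))
  · rw [← core_add_neg_leftInvariant_one, ← rightInvariant_one]
    rfl
  · have hr := 𝒱.mulRelated_rightInvariant c g h hgh
    have hl := 𝒱.mulRelated_neg_leftInvariant c g h hgh
    have hm : 𝒱.Composable ((-𝒱.leftInvariant c) g) (𝒱.rightInvariant c h) := by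
      rw [Composable, src_neg_leftInvariant, tgt_rightInvariant, 𝒱.core_congr c hgh]
    -- The pair of values is split as (c^r(g), 0) + (-c^l(g), c^r(h)) + (0, -c^l(h)), with products
    -- c^r(gh), 0 and -c^l(gh).
    have e := 𝒱.total_mul_add (𝒱.composable_add hr.1 hm) hl.1
      (𝒱.total_mul_add hr.1 hm ((𝒱.total_mul _ _ _ _ hr.1).trans (by rw [hr.2]))
        (𝒱.neg_leftInvariant_mul_rightInvariant c hgh))
      ((𝒱.total_mul _ _ _ _ hl.1).trans (by rw [hl.2]))
    have e' := (𝒱.total_mul _ _ _ _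
      (𝒱.composable_add (𝒱.composable_add hr.1 hm) hl.1)).symm.trans e
    have e'' := ((TotalSpace.mk_inj).1 e').symm
    change _ = 𝒱.mulV g h (𝒱.rightInvariant c g + (-𝒱.leftInvariant c) g + 0,
      0 + 𝒱.rightInvariant c h + (-𝒱.leftInvariant c) h) at e''
    rwa [add_zero, add_zero, zero_add] at e''

/-- A groupoid morphism preserves inverses. -/
theorem total_inv_sec (X : 𝒱.Sec) (g : G) :
    𝒱.total.inv ⟨g, X.sec g⟩ = ⟨𝒢.inv g, X.sec (𝒢.inv g)⟩ := by
  have hc : 𝒱.Composable (X.sec g) (X.sec (𝒢.inv g)) := by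
    rw [Composable, total_src_sec, total_tgt_sec, 𝒢.tgt_inv]
  refine (𝒱.total.eq_inv_of_mul_eq_one hc ?_).symm
  obtain ⟨e, -, -, -, h⟩ := X.isMultiplicative
  rw [𝒱.total_mul _ _ _ _ hc, ← h g _ (𝒢.tgt_inv g).symm, 𝒢.mul_inv, total_tgt_sec, one_base]

/-! ### Natural transformations between multiplicative sections -/

theorem src_core_add_one (c : 𝒱.coreSections) (X : 𝒱.Sec) (x : M) :
    𝒱.total.src ⟨𝒢.one x, c.1 x + X.sec (𝒢.one x)⟩ = 𝒱.base X.sec x := by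
  rw [base, 𝒱.total_src, 𝒱.total_src, map_add, c.2.1, zero_add]

theorem tgt_core_add_one {c : 𝒱.coreSections} {X Y : 𝒱.Sec}
    (h : Y.sec = X.sec + (𝒱.rightInvariant c - 𝒱.leftInvariant c)) (x : M) :
    𝒱.total.tgt ⟨𝒢.one x, c.1 x + X.sec (𝒢.one x)⟩ = 𝒱.base Y.sec x := by
  have h1 := total_tgt_sec Y (𝒢.one x)
  have h2 : Y.sec (𝒢.one x) = c.1 x + X.sec (𝒢.one x) + (-𝒱.leftInvariant c) (𝒢.one x) := by
    rw [h, ← rightInvariant_one, sub_eq_add_neg, add_left_comm, ← add_assoc]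
    rfl
  rw [𝒢.tgt_one] at h1
  rw [← h1, h2, 𝒱.total_tgt, 𝒱.total_tgt, map_add _ (_ + _), tgtV_neg_leftInvariant, add_zero]

theorem composable_core_zero (c : 𝒱.coreSections) {x : M} {g : G} (h : x = 𝒢.tgt g) :
    𝒱.Composable (c.1 x) (0 : V g) := by
  rw [Composable, src_core, tgt_zero, h]

theorem composable_one_sec (X : 𝒱.Sec) {x : M} {g : G} (h : x = 𝒢.tgt g) :
    𝒱.Composable (X.sec (𝒢.one x)) (X.sec g) := by
  rw [Composable, total_src_sec, total_tgt_sec, 𝒢.src_one, h]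

/-- One side of the naturality square, by interchange: c(t(g)) · 0_g is c^r(g), and the unit times
X(g) is X(g). -/
theorem core_add_one_mul_sec (c : 𝒱.coreSections) (X : 𝒱.Sec) (g : G) :
    𝒱.total.mul ⟨𝒢.one (𝒢.tgt g), c.1 (𝒢.tgt g) + X.sec (𝒢.one (𝒢.tgt g))⟩ ⟨g, X.sec g⟩ =
      ⟨g, 𝒱.rightInvariant c g + X.sec g⟩ := by
  have h := 𝒱.total_mul_add (𝒱.composable_core_zero c rfl) (𝒱.composable_one_sec X rfl)
    (𝒱.mk_rightInvariant c g).symm (b := X.sec g)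
    (by rw [← one_base, ← total_tgt_sec, 𝒱.total.one_mul])
  rwa [zero_add] at h

theorem composable_rightInvariant_zero (c : 𝒱.coreSections) (g : G) :
    𝒱.Composable (𝒱.rightInvariant c g) (0 : V (𝒢.one (𝒢.src g))) := by
  rw [Composable, src_rightInvariant, tgt_zero, 𝒢.tgt_one]

theorem composable_neg_leftInvariant_core (c : 𝒱.coreSections) (g : G) :
    𝒱.Composable ((-𝒱.leftInvariant c) g) (c.1 (𝒢.src g)) :=
  𝒱.src_neg_leftInvariant c g

theorem composable_sec_one (X : 𝒱.Sec) (g : G) :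
    𝒱.Composable (X.sec g) (X.sec (𝒢.one (𝒢.src g))) := by
  rw [Composable, total_src_sec, total_tgt_sec, 𝒢.tgt_one]

theorem sec_add_apply (c : 𝒱.coreSections) (X : 𝒱.Sec) (g : G) :
    (X.sec + (𝒱.rightInvariant c - 𝒱.leftInvariant c)) g =
      𝒱.rightInvariant c g + (-𝒱.leftInvariant c) g + X.sec g := by
  rw [sub_eq_add_neg, add_comm X.sec]
  rfl

theorem composable_sec_add_core_add_one (c : 𝒱.coreSections) (X : 𝒱.Sec) (g : G) :
    𝒱.Composable ((X.sec + (𝒱.rightInvariant c - 𝒱.leftInvariant c)) g)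
      (c.1 (𝒢.src g) + X.sec (𝒢.one (𝒢.src g))) := by
  have h := 𝒱.composable_add (𝒱.composable_add (𝒱.composable_rightInvariant_zero c g)
    (𝒱.composable_neg_leftInvariant_core c g)) (𝒱.composable_sec_one X g)
  rwa [zero_add, ← sec_add_apply] at h

/-- The other side of the square: c^r(g) · 0, (-c^l)(g) · c(s(g)) and X(g) · X(1) are c^r(g), 0_g
and X(g). The value is the same as in `core_add_one_mul_sec`, which is naturality. -/
theorem sec_add_mul_core_add_one (c : 𝒱.coreSections) (X : 𝒱.Sec) (g : G) :
    𝒱.total.mul ⟨g, (X.sec + (𝒱.rightInvariant c - 𝒱.leftInvariant c)) g⟩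
      ⟨𝒢.one (𝒢.src g), c.1 (𝒢.src g) + X.sec (𝒢.one (𝒢.src g))⟩ =
      ⟨g, 𝒱.rightInvariant c g + X.sec g⟩ := by
  have c1 := 𝒱.composable_rightInvariant_zero c g
  have c2 := 𝒱.composable_neg_leftInvariant_core c g
  have e1 : 𝒱.total.mul ⟨g, 𝒱.rightInvariant c g⟩ ⟨𝒢.one (𝒢.src g), 0⟩ =
      ⟨g, 𝒱.rightInvariant c g⟩ := by
    rw [𝒱.mk_one_zero, ← 𝒱.src_rightInvariant c, 𝒱.total.mul_one]
  have e3 : 𝒱.total.mul ⟨g, X.sec g⟩ ⟨𝒢.one (𝒢.src g), X.sec (𝒢.one (𝒢.src g))⟩ =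
      ⟨g, X.sec g⟩ := by
    rw [← one_base, ← total_src_sec, 𝒱.total.mul_one]
  have h := 𝒱.total_mul_add (𝒱.composable_add c1 c2) (𝒱.composable_sec_one X g)
    (𝒱.total_mul_add c1 c2 e1 (𝒱.neg_leftInvariant_mul_core c g)) e3
  rwa [zero_add, add_zero, ← sec_add_apply] at h

/-- The natural transformation `x ↦ c(x) + X(1ₓ)` from `X` to `X + c^r - c^l`. -/
def secHomOfCore (c : 𝒱.coreSections) {X Y : 𝒱.Sec}
    (h : Y.sec = X.sec + (𝒱.rightInvariant c - 𝒱.leftInvariant c)) : 𝒱.SecHom X Y where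
  toFun x := ⟨𝒢.one x, c.1 x + X.sec (𝒢.one x)⟩
  contMDiff := contMDiff_add_along c.2.2 (X.sec.contMDiff.comp 𝒢.contMDiff_one)
  proj_eq _ := rfl
  src_eq := 𝒱.src_core_add_one c X
  tgt_eq := 𝒱.tgt_core_add_one h
  natural g := by
    rw [core_add_one_mul_sec, h, sec_add_mul_core_add_one]

/-- Y(1ₓ) is the unit at the target of the right factor, so interchange with c'(x) = c'(x) · 0 turns
composition into addition of core sections. -/
theorem core_add_one_mul_core_add_one (c c' : 𝒱.coreSections) {X Y : 𝒱.Sec}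
    (h : Y.sec = X.sec + (𝒱.rightInvariant c - 𝒱.leftInvariant c)) (x : M) :
    𝒱.total.mul ⟨𝒢.one x, c'.1 x + Y.sec (𝒢.one x)⟩ ⟨𝒢.one x, c.1 x + X.sec (𝒢.one x)⟩ =
      ⟨𝒢.one x, c'.1 x + c.1 x + X.sec (𝒢.one x)⟩ := by
  have c2 : 𝒱.Composable (Y.sec (𝒢.one x)) (c.1 x + X.sec (𝒢.one x)) := by
    rw [Composable, 𝒱.tgt_core_add_one h, total_src_sec, 𝒢.src_one]
  have e := 𝒱.total_mul_add (𝒱.composable_core_zero c' (𝒢.tgt_one x).symm) c2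
    (a := c'.1 x) (by rw [𝒱.mk_one_zero, ← 𝒱.src_core c', 𝒱.total.mul_one])
    (b := c.1 x + X.sec (𝒢.one x))
    (by rw [← one_base, ← 𝒱.tgt_core_add_one h, 𝒱.total.one_mul])
  rwa [zero_add, ← add_assoc] at e

/-- The component in `V_{1ₓ}` of a natural transformation. -/
def SecHom.component {X Y : 𝒱.Sec} (τ : 𝒱.SecHom X Y) (x : M) : V (𝒢.one x) :=
  τ.proj_eq x ▸ (τ.toFun x).2

theorem SecHom.mk_component {X Y : 𝒱.Sec} (τ : 𝒱.SecHom X Y) (x : M) :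
    (⟨𝒢.one x, SecHom.component 𝒱 τ x⟩ : TotalSpace F V) = τ.toFun x :=
  totalSpace_mk_rec (τ.toFun x) (τ.proj_eq x)

/-- The section `τ - X ∘ 1` of the core, for a natural transformation `τ` with source `X`. -/
def coreOfSecHom {X Y : 𝒱.Sec} (τ : 𝒱.SecHom X Y) : 𝒱.coreSections :=
  -- The difference is written as a sum with a multiple by -1, to which the smoothness lemmas for
  -- sums and multiples along a map apply.
  ⟨fun x => SecHom.component 𝒱 τ x + (-1 : ℝ) • X.sec (𝒢.one x), fun x => by
    have h := τ.src_eq x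
    rw [← SecHom.mk_component, base, 𝒱.total_src, 𝒱.total_src] at h
    rw [map_add, map_smul, (TotalSpace.mk_inj).1 h, neg_one_smul, add_neg_cancel],
    contMDiff_add_along
      (τ.contMDiff.congr fun x => SecHom.mk_component 𝒱 τ x)
      (contMDiff_smul_along _ (X.sec.contMDiff.comp 𝒢.contMDiff_one))⟩

theorem mk_coreOfSecHom_add {X Y : 𝒱.Sec} (τ : 𝒱.SecHom X Y) (x : M) :
    (⟨𝒢.one x, (𝒱.coreOfSecHom τ).1 x + X.sec (𝒢.one x)⟩ : TotalSpace F V) = τ.toFun x := by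
  refine Eq.trans ?_ (SecHom.mk_component 𝒱 τ x)
  refine (TotalSpace.mk_inj).2 ?_
  change SecHom.component 𝒱 τ x + (-1 : ℝ) • X.sec (𝒢.one x) + X.sec (𝒢.one x) = _
  rw [neg_one_smul, neg_add_cancel_right]

/-- With c = τ - X ∘ 1, naturality of τ and the computation for X + c^r - c^l give the same product
with τ(s(g)) on the right; cancelling it identifies Y(g). -/
theorem sec_eq_of_secHom {X Y : 𝒱.Sec} (τ : 𝒱.SecHom X Y) :
    Y.sec = X.sec + (𝒱.rightInvariant (𝒱.coreOfSecHom τ) -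
      𝒱.leftInvariant (𝒱.coreOfSecHom τ)) := by
  ext g
  have h := τ.natural g
  have hs := (total_src_sec Y g).trans (τ.tgt_eq (𝒢.src g)).symm
  rw [← 𝒱.mk_coreOfSecHom_add τ, ← 𝒱.mk_coreOfSecHom_add τ, core_add_one_mul_sec,
    ← sec_add_mul_core_add_one] at h
  rw [← 𝒱.mk_coreOfSecHom_add τ] at hs
  refine (TotalSpace.mk_inj (F := F)).1
    (𝒱.total.mul_right_cancel hs (𝒱.composable_sec_add_core_add_one _ X g) h.symm)

end VBGroupoid

end Core

/-! ### Brackets of invariant sections and the crossed module -/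

section CrossedModule

variable {EG HG EM HM : Type*} [NormedAddCommGroup EG] [NormedSpace ℝ EG] [TopologicalSpace HG]
  [NormedAddCommGroup EM] [NormedSpace ℝ EM] [TopologicalSpace HM]
  {I : ModelWithCorners ℝ EG HG} {J : ModelWithCorners ℝ EM HM}
  {G M : Type*} [TopologicalSpace G] [ChartedSpace HG G] [TopologicalSpace M] [ChartedSpace HM M]
  [IsManifold I ∞ G] [IsManifold J ∞ M]
  {𝒢 : LieGroupoid I J G M}
  {F : Type*} [NormedAddCommGroup F] [NormedSpace ℝ F]
  {V : G → Type*} [TopologicalSpace (TotalSpace F V)] [∀ x, TopologicalSpace (V x)]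
  [∀ x, AddCommGroup (V x)] [∀ x, Module ℝ (V x)] [FiberBundle F V] [VectorBundle ℝ F V]
  [ContMDiffVectorBundle ∞ F V I] [LieAlgebroid I F V]
  {F' : Type*} [NormedAddCommGroup F'] [NormedSpace ℝ F']
  {E : M → Type*} [TopologicalSpace (TotalSpace F' E)] [∀ x, TopologicalSpace (E x)]
  [∀ x, AddCommGroup (E x)] [∀ x, Module ℝ (E x)] [FiberBundle F' E] [VectorBundle ℝ F' E]
  [ContMDiffVectorBundle ∞ F' E J] [LieAlgebroid J F' E]

namespace LAGroupoid

variable (𝒱 : LAGroupoid 𝒢 F V F' E)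

theorem invV_lie {X X' Y Y' : Cₛ^∞⟮I; F, V⟯} (h : ∀ g, 𝒱.invV g (X g) = Y (𝒢.inv g))
    (h' : ∀ g, 𝒱.invV g (X' g) = Y' (𝒢.inv g)) (g : G) :
    𝒱.invV g ((⁅X, X'⁆ : Cₛ^∞⟮I; F, V⟯) g) = (⁅Y, Y'⁆ : Cₛ^∞⟮I; F, V⟯) (𝒢.inv g) := by
  have := 𝒱.inv_morphism.map_bracket X X' (.single Y) (.single Y') (by simpa using h)
    (by simpa using h') g
  simpa using this

theorem invV_multSections (X : 𝒱.multSections) (g : G) :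
    𝒱.invV g (X.1 g) = X.1 (𝒢.inv g) :=
  (TotalSpace.mk_inj (F := F)).1
    ((𝒱.total_inv g _).symm.trans (𝒱.total_inv_sec ⟨X.1, X.2⟩ g))

theorem mulRelated_multSections (X : 𝒱.multSections) : 𝒱.MulRelated X.1 X.1 X.1 := by
  intro g h hgh
  obtain ⟨X, hX⟩ := X
  refine ⟨?_, ?_⟩
  · rw [VBGroupoid.Composable, VBGroupoid.total_src_sec (𝒱 := 𝒱.toVBGroupoid) ⟨X, hX⟩,
      VBGroupoid.total_tgt_sec (𝒱 := 𝒱.toVBGroupoid) ⟨X, hX⟩, hgh]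
  · obtain ⟨e, -, -, -, h4⟩ := hX
    exact (h4 g h hgh).symm

/-- The map `δ(c) = c^r - c^l`. -/
def coreBdry : 𝒱.coreSections →ₗ[ℝ] 𝒱.multSections where
  toFun c := ⟨𝒱.rightInvariant c - 𝒱.leftInvariant c,
    𝒱.isMultiplicative_rightInvariant_sub_leftInvariant c⟩
  map_add' c c' := Subtype.ext (by
    change 𝒱.rightInvariant (c + c') - 𝒱.leftInvariant (c + c') =
      𝒱.rightInvariant c - 𝒱.leftInvariant c +
      (𝒱.rightInvariant c' - 𝒱.leftInvariant c')
    rw [𝒱.rightInvariant_add, 𝒱.leftInvariant_add, add_sub_add_comm])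
  map_smul' r c := Subtype.ext (by
    change 𝒱.rightInvariant (r • c) - 𝒱.leftInvariant (r • c) = r • (𝒱.rightInvariant c - 𝒱.leftInvariant c)
    rw [𝒱.rightInvariant_smul, 𝒱.leftInvariant_smul, smul_sub])

theorem coe_coreBdry (c : 𝒱.coreSections) :
    (𝒱.coreBdry c).1 = 𝒱.rightInvariant c - 𝒱.leftInvariant c := rfl

theorem srcV_lie_multSections_rightInvariant (X : 𝒱.multSections) (c : 𝒱.coreSections) (g : G) :
    𝒱.srcV g ((⁅X.1, 𝒱.rightInvariant c⁆ : Cₛ^∞⟮I; F, V⟯) g) = 0 := by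
  obtain ⟨e, he, -⟩ := X.2
  rw [𝒱.srcV_lie (e' := 0) he (𝒱.srcV_rightInvariant c), lie_zero]
  rfl

/-- The map `D_X(c) = [X, c^r] ∘ 1`. -/
def coreAct (X : 𝒱.multSections) (c : 𝒱.coreSections) : 𝒱.coreSections :=
  𝒱.coreOfSection ⁅X.1, 𝒱.rightInvariant c⁆ (𝒱.srcV_lie_multSections_rightInvariant X c)

/-- Bracketing the related triples (X, X, X) and (c^r, 0, c^r) gives ([X, c^r], 0, [X, c^r]). A
section in the kernel of s with this relation is right invariant. -/
theorem rightInvariant_coreAct (X : 𝒱.multSections) (c : 𝒱.coreSections) :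
    𝒱.rightInvariant (𝒱.coreAct X c) = ⁅X.1, 𝒱.rightInvariant c⁆ := by
  refine 𝒱.rightInvariant_coreOfSection _ (𝒱.srcV_lie_multSections_rightInvariant X c) ?_
  have := 𝒱.mulRelated_lie (𝒱.mulRelated_multSections X) (𝒱.mulRelated_rightInvariant c)
  rwa [lie_zero] at this

/-- The inversion carries c^r to -c^l and preserves brackets; the two signs on the left cancel, and
the one on the right remains. -/
theorem leftInvariant_lie (c c' : 𝒱.coreSections) :
    ⁅𝒱.leftInvariant c, 𝒱.leftInvariant c'⁆ = -𝒱.leftInvariant ⁅c, c'⁆ := by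
  refine section_eq_of_inv (𝒢 := 𝒢) fun g => ?_
  have h := 𝒱.invV_lie (𝒱.invV_rightInvariant c) (𝒱.invV_rightInvariant c') g
  rw [neg_lie, lie_neg, neg_neg, ← rightInvariant_lie, 𝒱.invV_rightInvariant] at h
  exact h.symm

/-- The image of [X, c^r] under the inversion, which carries X to itself and c^r to -c^l. -/
theorem lie_leftInvariant (X : 𝒱.multSections) (c : 𝒱.coreSections) :
    ⁅X.1, 𝒱.leftInvariant c⁆ = 𝒱.leftInvariant (𝒱.coreAct X c) := by
  refine neg_injective (section_eq_of_inv (𝒢 := 𝒢) fun g => ?_)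
  have h := 𝒱.invV_lie (𝒱.invV_multSections X) (𝒱.invV_rightInvariant c) g
  rw [lie_neg, ← rightInvariant_coreAct, 𝒱.invV_rightInvariant] at h
  exact h.symm

/-- The triples (c^r, 0, c^r) and (0, -c'^l, -c'^l) have bracket (0, 0, -[c^r, c'^l]), and a product
of zeros is zero. -/
theorem rightInvariant_lie_leftInvariant (c c' : 𝒱.coreSections) :
    ⁅𝒱.rightInvariant c, 𝒱.leftInvariant c'⁆ = 0 := by
  have h := 𝒱.mulRelated_lie (𝒱.mulRelated_rightInvariant c) (𝒱.mulRelated_neg_leftInvariant c')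
  rw [lie_zero, zero_lie, lie_neg] at h
  refine neg_injective ?_
  ext g
  -- Every arrow g is the product g · 1, so the relation reaches all of G.
  have h' := (h g (𝒢.one (𝒢.src g)) (𝒢.tgt_one _).symm).2
  have h0 : 𝒱.mulV g (𝒢.one (𝒢.src g)) ((0 : Cₛ^∞⟮I; F, V⟯) g,
      (0 : Cₛ^∞⟮I; F, V⟯) (𝒢.one (𝒢.src g))) = 0 := map_zero _
  rw [h0, 𝒢.mul_one] at h'
  rw [neg_zero]
  exact h'.symm

/-- The Peiffer identity: c^l commutes with c'^r, so only [c^r, c'^r] remains of [δ(c), c'^r]. -/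
theorem coreAct_bdry (c c' : 𝒱.coreSections) : 𝒱.coreAct (𝒱.coreBdry c) c' = ⁅c, c'⁆ :=
  𝒱.rightInvariant_injective (by
    rw [rightInvariant_coreAct, coe_coreBdry, sub_lie, rightInvariant_lie,
      ← lie_skew (𝒱.leftInvariant c) (𝒱.rightInvariant c'), rightInvariant_lie_leftInvariant,
      neg_zero, sub_zero])

/-- Equivariance of δ: bracketing with X acts on both invariant extensions of c through the same
D_X. -/
theorem coreBdry_act (X : 𝒱.multSections) (c : 𝒱.coreSections) :
    𝒱.coreBdry (𝒱.coreAct X c) = ⁅X, 𝒱.coreBdry c⁆ :=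
  Subtype.ext (by
    rw [LieSubalgebra.coe_bracket, coe_coreBdry, coe_coreBdry, lie_sub, lie_leftInvariant,
      rightInvariant_coreAct])

/-- The derivation `D_X` of `Γ(C)`. -/
def coreDerivation (X : 𝒱.multSections) : LieDerivation ℝ 𝒱.coreSections 𝒱.coreSections where
  toFun := 𝒱.coreAct X
  map_add' c c' := 𝒱.rightInvariant_injective (by
    simp only [𝒱.rightInvariant_add, rightInvariant_coreAct, lie_add])
  map_smul' r c := 𝒱.rightInvariant_injective (by
    simp only [𝒱.rightInvariant_smul, rightInvariant_coreAct, lie_smul, RingHom.id_apply])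
  -- After passing to right invariant sections, this is the Jacobi identity for X, c^r and c'^r.
  leibniz' c c' := 𝒱.rightInvariant_injective (by
    change 𝒱.rightInvariant (𝒱.coreAct X ⁅c, c'⁆) =
      𝒱.rightInvariant (⁅c, 𝒱.coreAct X c'⁆ - ⁅c', 𝒱.coreAct X c⁆)
    rw [← lie_skew c' (𝒱.coreAct X c), sub_neg_eq_add]
    simp only [𝒱.rightInvariant_add, rightInvariant_coreAct, rightInvariant_lie]
    rw [leibniz_lie, add_comm])

/-- The crossed module `Γ(C) → Γ_mult(V) → Der(Γ(C))`. -/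
def crossedModule : LieCrossedModule 𝒱.coreSections 𝒱.multSections where
  bdry :=
    { 𝒱.coreBdry with
      -- The mixed brackets vanish, and [c^l, c'^l] = -[c, c']^l supplies the sign.
      map_lie' := fun {c c'} => Subtype.ext (by
        change (𝒱.coreBdry ⁅c, c'⁆).1 = ⁅(𝒱.coreBdry c).1, (𝒱.coreBdry c').1⁆
        simp only [coe_coreBdry]
        rw [sub_lie, lie_sub, lie_sub, rightInvariant_lie_leftInvariant,
          ← lie_skew (𝒱.leftInvariant c) (𝒱.rightInvariant c'),
          rightInvariant_lie_leftInvariant, leftInvariant_lie, rightInvariant_lie]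
        abel) }
  act :=
    { toFun := 𝒱.coreDerivation
      map_add' := fun X Y => LieDerivation.ext fun c => 𝒱.rightInvariant_injective (by
        change 𝒱.rightInvariant (𝒱.coreAct (X + Y) c) =
          𝒱.rightInvariant (𝒱.coreAct X c + 𝒱.coreAct Y c)
        rw [𝒱.rightInvariant_add]
        simp only [rightInvariant_coreAct]
        exact add_lie _ _ _)
      map_smul' := fun r X => LieDerivation.ext fun c => 𝒱.rightInvariant_injective (by
        change 𝒱.rightInvariant (𝒱.coreAct (r • X) c) = 𝒱.rightInvariant (r • 𝒱.coreAct X c)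
        rw [𝒱.rightInvariant_smul]
        simp only [rightInvariant_coreAct]
        exact smul_lie _ _ _)
      map_lie' := fun {X Y} => LieDerivation.ext fun c => 𝒱.rightInvariant_injective (by
        rw [LieDerivation.commutator_apply]
        change 𝒱.rightInvariant (𝒱.coreAct ⁅X, Y⁆ c) =
          𝒱.rightInvariant (𝒱.coreAct X (𝒱.coreAct Y c) - 𝒱.coreAct Y (𝒱.coreAct X c))
        rw [sub_eq_add_neg, ← neg_one_smul ℝ, 𝒱.rightInvariant_add, 𝒱.rightInvariant_smul]
        simp only [rightInvariant_coreAct, LieSubalgebra.coe_bracket]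
        rw [neg_one_smul, ← sub_eq_add_neg]
        exact lie_lie _ _ _) }
  act_bdry := 𝒱.coreAct_bdry
  bdry_act := 𝒱.coreBdry_act

theorem isCrossedModule_crossedModule : 𝒱.IsCrossedModule 𝒱.crossedModule where
  bdry_eq _ := rfl
  act_eq _ _ _ := rfl

end LAGroupoid

/-! ### The strict Lie 2-algebra of a crossed module -/

section TwoAlgebra

variable {𝔤 𝔥 : Type*} [LieRing 𝔤] [LieAlgebra ℝ 𝔤] [LieRing 𝔥] [LieAlgebra ℝ 𝔥]
  (X : LieCrossedModule 𝔤 𝔥)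

/-- The strict Lie 2-algebra of a crossed module of Lie algebras. -/
def LieCrossedModule.toLieTwoAlgebra :
    LieTwoAlgebra (LieAlgebra.SemiDirectSum 𝔤 𝔥 X.act) 𝔥 where
  src := LieAlgebra.SemiDirectSum.projr X.act
  tgt :=
    { toFun := fun f => f.right + X.bdry f.left
      map_add' := fun f g => by
        simp only [LieAlgebra.SemiDirectSum.add_eq_mk, map_add]
        abel
      map_smul' := fun r f => by simp
      -- Equivariance of the boundary matches the action terms with the mixed brackets.
      map_lie' := fun {f g} => by
        simp only [LieAlgebra.SemiDirectSum.lie_eq_mk, map_add, map_sub, LieHom.map_lie, add_lie,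
          lie_add, X.bdry_act]
        rw [← lie_skew (X.bdry f.left) g.right]
        abel }
  unit := LieAlgebra.SemiDirectSum.inr X.act
  comp :=
    { toFun := fun p => ⟨p.1.1.left + p.1.2.left, p.1.2.right⟩
      map_add' := fun p q => by
        ext
        · change p.1.1.left + q.1.1.left + (p.1.2.left + q.1.2.left) =
            p.1.1.left + p.1.2.left + (q.1.1.left + q.1.2.left)
          abel
        · rfl
      map_smul' := fun r p => by
        ext
        · exact (smul_add _ _ _).symm
        · rfl
      -- Composability replaces the right part of the outer arrow by that of the inner one plus a
      -- boundary. The Peiffer identity turns the action of this boundary into the brackets between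
      -- outer and inner left parts.
      map_lie' := fun {p q} => by
        have hp : p.1.1.right = p.1.2.right + X.bdry p.1.2.left := p.2
        have hq : q.1.1.right = q.1.2.right + X.bdry q.1.2.left := q.2
        ext
        · change ⁅p.1.1, q.1.1⁆.left + ⁅p.1.2, q.1.2⁆.left = _
          simp only [LieAlgebra.SemiDirectSum.lie_eq_mk, hp, hq, map_add, LieDerivation.add_apply,
            X.act_bdry, add_lie, lie_add]
          rw [← lie_skew p.1.1.left q.1.2.left]
          abel
        · rfl }
  src_unit _ := rfl
  tgt_unit Y := by
    change Y + X.bdry 0 = Y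
    rw [map_zero, add_zero]
  src_comp _ _ _ := rfl
  tgt_comp f g h := by
    change g.right + X.bdry (f.left + g.left) = f.right + X.bdry f.left
    have h' : f.right = g.right + X.bdry g.left := h
    rw [h', map_add]
    abel
  unit_comp f := by
    ext
    · exact zero_add _
    · rfl
  comp_unit f := by
    ext
    · exact add_zero _
    · rfl
  assoc f g k _ _ := by
    ext
    · exact add_assoc _ _ _
    · rfl

end TwoAlgebra

namespace LAGroupoid

variable (𝒱 : LAGroupoid 𝒢 F V F' E)

theorem isLieTwoAlgebra_toLieTwoAlgebra :
    𝒱.IsLieTwoAlgebra 𝒱.crossedModule 𝒱.crossedModule.toLieTwoAlgebra where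
  src_eq _ := rfl
  tgt_eq _ := (add_sub_assoc _ _ _).symm
  unit_eq _ := rfl
  comp_eq _ _ _ := rfl

end LAGroupoid
end CrossedModule

/-! ### The isomorphism with the category of multiplicative sections -/

section SecFunctor

variable {EG HG EM HM : Type*} [NormedAddCommGroup EG] [NormedSpace ℝ EG] [TopologicalSpace HG]
  [NormedAddCommGroup EM] [NormedSpace ℝ EM] [TopologicalSpace HM]
  {I : ModelWithCorners ℝ EG HG} {J : ModelWithCorners ℝ EM HM}
  {G M : Type*} [TopologicalSpace G] [ChartedSpace HG G] [TopologicalSpace M] [ChartedSpace HM M]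
  [IsManifold I ∞ G] [IsManifold J ∞ M]
  {𝒢 : LieGroupoid I J G M}
  {F : Type*} [NormedAddCommGroup F] [NormedSpace ℝ F]
  {V : G → Type*} [TopologicalSpace (TotalSpace F V)] [∀ x, TopologicalSpace (V x)]
  [∀ x, AddCommGroup (V x)] [∀ x, Module ℝ (V x)] [FiberBundle F V] [VectorBundle ℝ F V]
  [ContMDiffVectorBundle ∞ F V I] [LieAlgebroid I F V]
  {F' : Type*} [NormedAddCommGroup F'] [NormedSpace ℝ F']
  {E : M → Type*} [TopologicalSpace (TotalSpace F' E)] [∀ x, TopologicalSpace (E x)]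
  [∀ x, AddCommGroup (E x)] [∀ x, Module ℝ (E x)] [FiberBundle F' E] [VectorBundle ℝ F' E]
  [ContMDiffVectorBundle ∞ F' E J] [LieAlgebroid J F' E]

namespace LAGroupoid

variable (𝒱 : LAGroupoid 𝒢 F V F' E)

theorem coe_eq_of_hom {Y Z : 𝒱.crossedModule.toLieTwoAlgebra.Obj} (f : Y ⟶ Z) :
    (Z.val : Cₛ^∞⟮I; F, V⟯) =
      Y.val + (𝒱.rightInvariant f.1.left - 𝒱.leftInvariant f.1.left) := by
  obtain ⟨f, h1, h2⟩ := f
  have h1 : f.right = Y.val := h1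
  have h2 : f.right + 𝒱.coreBdry f.left = Z.val := h2
  rw [h1] at h2
  exact congrArg Subtype.val h2.symm

/-- The underlying category of the Lie 2-algebra of the crossed module `Γ(C) → Γ_mult(V)` maps to
the category of multiplicative sections. -/
def secFunctor : 𝒱.crossedModule.toLieTwoAlgebra.Obj ⥤ 𝒱.Sec where
  obj Y := ⟨Y.val.1, Y.val.2⟩
  map f := 𝒱.secHomOfCore f.1.left (𝒱.coe_eq_of_hom f)
  map_id Y := VBGroupoid.SecHom.ext (funext fun x =>
    (TotalSpace.mk_inj).2 (zero_add (Y.val.1 (𝒢.one x))))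
  map_comp {X Y _} f g := VBGroupoid.SecHom.ext (funext fun x =>
    (𝒱.core_add_one_mul_core_add_one (X := ⟨X.val.1, X.val.2⟩) (Y := ⟨Y.val.1, Y.val.2⟩)
      f.1.left g.1.left (𝒱.coe_eq_of_hom f) x).symm)

theorem isSecIso_secFunctor : 𝒱.IsSecIso 𝒱.secFunctor where
  obj_eq _ := rfl
  map_eq _ _ := rfl
  bijective_obj := ⟨fun Y Z h => LieTwoAlgebra.Obj.ext
    (Subtype.ext (congrArg VBGroupoid.Sec.sec h)), fun X => ⟨⟨⟨X.1, X.2⟩⟩, rfl⟩⟩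
  -- The preimage of τ is (τ - Y ∘ 1, Y); its target is correct by `sec_eq_of_secHom`.
  full := ⟨fun {Y _} τ => ⟨⟨⟨𝒱.coreOfSecHom τ, Y.val⟩, rfl,
    Subtype.ext (𝒱.sec_eq_of_secHom τ).symm⟩,
    VBGroupoid.SecHom.ext (funext fun x => 𝒱.mk_coreOfSecHom_add τ x)⟩⟩
  faithful := ⟨fun {_ _ f g} h => by
    refine Subtype.ext (LieAlgebra.SemiDirectSum.ext (Subtype.ext (funext fun x => ?_))
      (f.2.1.trans g.2.1.symm))
    have h' := congrFun (congrArg VBGroupoid.SecHom.toFun h) x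
    exact add_right_cancel ((TotalSpace.mk_inj).1 h')⟩

/-- The category of multiplicative sections of an `LA`-groupoid is a strict Lie 2-algebra. -/
theorem carriesLieTwoAlgebra : 𝒱.CarriesLieTwoAlgebra :=
  ⟨𝒱.crossedModule, 𝒱.isCrossedModule_crossedModule, 𝒱.crossedModule.toLieTwoAlgebra,
    𝒱.isLieTwoAlgebra_toLieTwoAlgebra, 𝒱.secFunctor, 𝒱.isSecIso_secFunctor⟩

end LAGroupoid

end SecFunctor

end

theorem theorem4p3 {EG EM G M : Type*}
    [NormedAddCommGroup EG] [NormedSpace ℝ EG] [FiniteDimensional ℝ EG]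
    [NormedAddCommGroup EM] [NormedSpace ℝ EM] [FiniteDimensional ℝ EM]
    [TopologicalSpace G] [ChartedSpace EG G] [IsManifold 𝓘(ℝ, EG) ∞ G]
    [TopologicalSpace M] [ChartedSpace EM M] [IsManifold 𝓘(ℝ, EM) ∞ M]
    (𝒢 : LieGroupoid 𝓘(ℝ, EG) 𝓘(ℝ, EM) G M) :
    (∀ (F : Type*) [NormedAddCommGroup F] [NormedSpace ℝ F] [FiniteDimensional ℝ F]
      (V : G → Type*) [TopologicalSpace (TotalSpace F V)] [∀ g, TopologicalSpace (V g)]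
      [∀ g, AddCommGroup (V g)] [∀ g, Module ℝ (V g)] [FiberBundle F V] [VectorBundle ℝ F V]
      [ContMDiffVectorBundle ∞ F V 𝓘(ℝ, EG)] [LieAlgebroid 𝓘(ℝ, EG) F V]
      (F' : Type*) [NormedAddCommGroup F'] [NormedSpace ℝ F'] [FiniteDimensional ℝ F']
      (E : M → Type*) [TopologicalSpace (TotalSpace F' E)] [∀ x, TopologicalSpace (E x)]
      [∀ x, AddCommGroup (E x)] [∀ x, Module ℝ (E x)] [FiberBundle F' E] [VectorBundle ℝ F' E]
      [ContMDiffVectorBundle ∞ F' E 𝓘(ℝ, EM)] [LieAlgebroid 𝓘(ℝ, EM) F' E]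
      (𝒱 : LAGroupoid 𝒢 F V F' E), 𝒱.CarriesLieTwoAlgebra) ∧
    ∃ 𝒯 : LAGroupoid 𝒢 EG (TangentSpace 𝓘(ℝ, EG) : G → Type _)
        EM (TangentSpace 𝓘(ℝ, EM) : M → Type _),
      𝒯.IsTangentGroupoid ∧ 𝒯.CarriesLieTwoAlgebra :=
  ⟨fun _ _ _ _ _ _ _ _ _ _ _ _ _ _ _ _ _ _ _ _ _ _ _ _ _ _ 𝒱 => 𝒱.carriesLieTwoAlgebra,
    𝒢.tangentLA, 𝒢.isTangentGroupoid_tangentLA, 𝒢.tangentLA.carriesLieTwoAlgebra⟩
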